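/- **Theorem (Second-order convergence of the $\theta$-trapezoidal method).** *Setting.* Let $\mathbb X=(\mathbb Z/S)^d$ be the state space $[S]^d$ with periodic boundary conditions, and let $\mathbb D=\mathbb X\setminus\{0\}$ be the set of jumps. Let $0\le\delta<T$. The forward process on $[0,T]$ is a continuous-time Markov chain with rate matrices $Q_t=(Q_t(y,x))_{x,y\in\mathbb X}$ (where $Q_t(y,x)\ge 0$ for $y\ne x$ is the rate of jumping from $x$ to $y$, and $Q_t(x,x)=-\sum_{y\ne x}Q_t(y,x)$) and with marginal laws $p_t$ solving $\frac{d}{dt}p_t=Q_tp_t$. Let $p_\infty$ be the (stationary) probability distribution on $\mathbb X$ that the forward process approaches; the sampler is started from $\widehat y_0\sim\widehat q_0=p_\infty$. Let $s_t(x,y)=p_t(y)/p_t(x)$ be the score, and let $\widehat s_t(x,y)\ge 0$ be an estimated score. For $s\in[0,T-\delta]$, $y\in\mathbb X$ and $\nu\in\mathbb D$, the true and estimated intensities of the backward process are $$\mu_s(\nu,y)=s_{T-s}(y,y+\nu)\,Q_{T-s}(y,y+\nu),\qquad \widehat\mu_s(\nu,y)=\widehat s_{T-s}(y,y+\nu)\,Q_{T-s}(y,y+\nu).$$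 *Sampler.* Let $\theta\in(0,1)$, $\alpha_1=\frac1{2\theta(1-\theta)}$ and $\alpha_2=\frac{(1-\theta)^2+\theta^2}{2\theta(1-\theta)}$. Let $0=s_0<s_1<\dots<s_N=T-\delta$, $\Delta_n=s_{n+1}-s_n$, $\kappa=\max_n\Delta_n$ and $\rho_n=(1-\theta)s_n+\theta s_{n+1}$. For $n=0,\dots,N-1$ the method sets $$\widehat y^*_{\rho_n}=\widehat y_{s_n}+\sum_{\nu\in\mathbb D}\nu\,\mathcal P\big(\widehat\mu_{s_n}(\nu,\widehat y_{s_n})\,\theta\Delta_n\big),$$ $$\widehat y_{s_{n+1}}=\widehat y^*_{\rho_n}+\sum_{\nu\in\mathbb D}\nu\,\mathcal P\Big(\big(\alpha_1\widehat\mu_{\rho_n}(\nu,\widehat y^*_{\rho_n})-\alpha_2\widehat\mu_{s_n}(\nu,\widehat y_{s_n})\big)_+(1-\theta)\Delta_n\Big),$$ where the Poisson variables $\mathcal P(\cdot)$ with the given means are independent (conditionally on the states at which the intensities are evaluated). Let $\widehat q^{\mathrm{trap}}_{T-\delta}$ be the law of $\widehat y_{s_N}$. *Assumptions*, with constants $C_0$,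 $m>0$ and $M$: 1. $D_{\mathrm{KL}}(p_T\|p_\infty)\le C_0e^{-T}$. 2. For every $\nu\in\mathbb D$ and every achievable state $y$ (that is, $p_{T-s}(y)>0$ for some $s\in[0,T-\delta]$), both $s\mapsto\mu_s(\nu,y)$ and $s\mapsto\widehat\mu_s(\nu,y)$ are $C^2$ on $[0,T-\delta]$ and, with their first two derivatives, bounded in absolute value by $M$. If moreover $\nu$ is permissible from $y$ (that is, $p_{T-s}(y)>0$ and $\mu_s(\nu,y)>0$ for some $s\in[0,T-\delta]$), then $\mu_s(\nu,y)\ge m$ and $\widehat\mu_s(\nu,y)\ge m$ for all $s\in[0,T-\delta]$. 3. For every $s\in\bigcup_{n<N}\{s_n,\rho_n\}$, $$\mathbb E_{y\sim p_{T-s}}\sum_{\nu\in\mathbb D}\Big(\mu_s(\nu,y)\big(\log\tfrac{\mu_s(\nu,y)}{\widehat\mu_s(\nu,y)}-1\big)+\widehat\mu_s(\nu,y)\Big)\le\epsilon_{\mathrm I},\qquad \mathbb E_{y\sim p_{T-s}}\sum_{\nu\in\mathbb D}\big|\mu_s(\nu,y)-\widehat\mu_s(\nu,y)\big|\le\epsilon_{\mathrm{II}}.$$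 4. For every $n<N$, almost surely along the sampler, $\alpha_1\widehat\mu_{\rho_n}(\nu,\widehat y^*_{\rho_n})-\alpha_2\widehat\mu_{s_n}(\nu,\widehat y_{s_n})\ge0$ for all $\nu\in\mathbb D$. *Conclusion.* There are constants $C,\kappa_0>0$ depending only on $d,S,\theta,m,M,C_0$ (not on $T$, $\delta$, the process, the estimated score, the time grid, $\epsilon_{\mathrm I}$ or $\epsilon_{\mathrm{II}}$) such that, whenever the above holds and $\kappa\le\kappa_0$, $$D_{\mathrm{KL}}\big(p_\delta\,\big\|\,\widehat q^{\mathrm{trap}}_{T-\delta}\big)\le C\big(e^{-T}+(\epsilon_{\mathrm I}+\epsilon_{\mathrm{II}})T+\kappa^2T\big).$$ -/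

import Mathlib

open MeasureTheory ProbabilityTheory
open scoped NNReal ENNReal

noncomputable section

namespace DiscreteDiffusion

/-- The state space `[S]^d` with periodic boundary conditions. -/
abbrev Torus (d S : ℕ) : Type := Fin d → ZMod S

/-- The set `𝔻` of nonzero jumps (all differences of two distinct states of the torus). -/
abbrev Jump (d S : ℕ) : Type := {ν : Torus d S // ν ≠ 0}

/-- The measure on the (finite, discrete) state space with weights `p`. -/
def vecLaw {d S : ℕ} [NeZero S] (p : Torus d S → ℝ) : Measure (Torus d S) :=
  ∑ x, ENNReal.ofReal (p x) • Measure.dirac x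

/-- A forward continuous-time Markov chain on `[0, T]`, given by its rate matrices and its marginal
laws, which solve `dp_t / dt = Q_t p_t`. Here `rate t y x` is the rate `Q_t(y, x)` of jumping from
`x` to `y`, and `law t x` is `p_t(x)`. -/
structure ForwardProcess (d S : ℕ) [NeZero S] (T : ℝ) where
  rate : ℝ → Torus d S → Torus d S → ℝ
  law : ℝ → Torus d S → ℝ
  rate_nonneg : ∀ t ∈ Set.Icc 0 T, ∀ x y, x ≠ y → 0 ≤ rate t y x
  rate_diag : ∀ t ∈ Set.Icc 0 T, ∀ x, rate t x x = -∑ y ∈ Finset.univ.erase x, rate t y x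
  law_mem : ∀ t ∈ Set.Icc 0 T, law t ∈ stdSimplex ℝ (Torus d S)
  law_deriv : ∀ t ∈ Set.Icc 0 T, ∀ y,
    HasDerivWithinAt (fun u => law u y) (∑ x, rate t y x * law t x) (Set.Icc 0 T) t

variable {d S : ℕ} [NeZero S] {T : ℝ}

/-- The score `s_t(x, y) = p_t(y) / p_t(x)`. -/
def ForwardProcess.score (F : ForwardProcess d S T) (t : ℝ) (x y : Torus d S) : ℝ :=
  F.law t y / F.law t x

/-- The intensity at backward time `s` of a jump `ν` from the state `y`, when the score
is `sc`, that is `sc_{T-s}(y, y+ν) Q_{T-s}(y, y+ν)`. -/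
def ForwardProcess.intensityOf (F : ForwardProcess d S T) (sc : ℝ → Torus d S → Torus d S → ℝ)
    (s : ℝ) (ν y : Torus d S) : ℝ :=
  sc (T - s) y (y + ν) * F.rate (T - s) y (y + ν)

/-- The true backward intensity `μ_s(ν, y)`. -/
def ForwardProcess.intensity (F : ForwardProcess d S T) : ℝ → Torus d S → Torus d S → ℝ :=
  F.intensityOf F.score

/-- A time discretization `0 = s_0 < ⋯ < s_N = τ`. -/
structure TimeGrid (τ : ℝ) where
  N : ℕ
  pt : ℕ → ℝ
  pt_zero : pt 0 = 0
  pt_last : pt N = τ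
  pt_lt : ∀ n < N, pt n < pt (n + 1)

/-- The step size `Δ_n`. -/
def TimeGrid.step {τ : ℝ} (g : TimeGrid τ) (n : ℕ) : ℝ := g.pt (n + 1) - g.pt n

/-- The `θ`-section point `ρ_n`. -/
def TimeGrid.sectionPt {τ : ℝ} (g : TimeGrid τ) (θ : ℝ) (n : ℕ) : ℝ :=
  (1 - θ) * g.pt n + θ * g.pt (n + 1)

/-- The largest step size `κ`. -/
def TimeGrid.maxStep {τ : ℝ} (g : TimeGrid τ) : ℝ := ⨆ n : Fin g.N, g.step n

/-- `α₁ = 1 / (2θ(1-θ))`. -/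
def alpha₁ (θ : ℝ) : ℝ := 1 / (2 * θ * (1 - θ))

/-- `α₂ = ((1-θ)² + θ²) / (2θ(1-θ))`. -/
def alpha₂ (θ : ℝ) : ℝ := ((1 - θ) ^ 2 + θ ^ 2) / (2 * θ * (1 - θ))

/-- The law of `y + ∑_{ν ∈ 𝔻} ν P_ν`, where the `P_ν` are independent Poisson variables with
means `a ν`. -/
def leap (y : Torus d S) (a : Torus d S → ℝ) : Measure (Torus d S) :=
  (Measure.pi fun ν : Jump d S => poissonMeasure (a ν).toNNReal).map
    fun P => y + ∑ ν : Jump d S, P ν • (ν : Torus d S)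

section Sampler

variable {τ : ℝ} (μ' : ℝ → Torus d S → Torus d S → ℝ) (g : TimeGrid τ) (θ : ℝ)

/-- The extrapolated intensity `α₁ μ̂_{ρ_n}(ν, y*) - α₂ μ̂_{s_n}(ν, y)`. -/
def extrapolated (n : ℕ) (y y' ν : Torus d S) : ℝ :=
  alpha₁ θ * μ' (g.sectionPt θ n) ν y' - alpha₂ θ * μ' (g.pt n) ν y

/-- The law of the intermediate state `ŷ*_{ρ_n}` given `ŷ_{s_n} = y`. -/
def firstStage (n : ℕ) (y : Torus d S) : Measure (Torus d S) :=
  leap y fun ν => μ' (g.pt n) ν y * (θ * g.step n)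

/-- The law of `ŷ_{s_{n+1}}` given `ŷ_{s_n} = y` and `ŷ*_{ρ_n} = y'`. -/
def secondStage (n : ℕ) (y y' : Torus d S) : Measure (Torus d S) :=
  leap y' fun ν => max (extrapolated μ' g θ n y y' ν) 0 * ((1 - θ) * g.step n)

/-- The law of `ŷ_{s_n}` in the `θ`-trapezoidal method started from the law `q₀`. -/
def trapLaw (q₀ : Measure (Torus d S)) : ℕ → Measure (Torus d S)
  | 0 => q₀
  | n + 1 => (trapLaw q₀ n).bind fun y => (firstStage μ' g θ n y).bind (secondStage μ' g θ n y)

/-- Along the sampler, the extrapolated intensity is almost surely nonnegative in every step. -/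
def ExtrapolationNonneg (q₀ : Measure (Torus d S)) : Prop :=
  ∀ n < g.N, ∀ᵐ y ∂(trapLaw μ' g θ q₀ n), ∀ᵐ y' ∂(firstStage μ' g θ n y),
    ∀ ν ≠ 0, 0 ≤ extrapolated μ' g θ n y y' ν

end Sampler

/-- `f` is `C²` on `[0, τ]`, and `f`, `f'`, `f''` are bounded by `M` there. -/
def C2Bounded (M τ : ℝ) (f : ℝ → ℝ) : Prop :=
  ContDiffOn ℝ 2 f (Set.Icc 0 τ) ∧
    ∀ k ≤ 2, ∀ s ∈ Set.Icc 0 τ, |iteratedDerivWithin k f (Set.Icc 0 τ) s| ≤ M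

/-- Regularity of the true intensity and of the estimated intensity `μ'` on `[0, T-δ]`: at every
achievable state, both are `C²` with bounds `M`; if moreover the jump is permissible, that is, has
positive true intensity from an achievable state, then both are bounded below by `m`. -/
structure RegularIntensities (F : ForwardProcess d S T) (μ' : ℝ → Torus d S → Torus d S → ℝ)
    (δ m M : ℝ) : Prop where
  smooth : ∀ ν ≠ 0, ∀ y, (∃ s ∈ Set.Icc 0 (T - δ), 0 < F.law (T - s) y) →
    C2Bounded M (T - δ) (fun s => F.intensity s ν y) ∧ C2Bounded M (T - δ) (fun s => μ' s ν y)
  lower : ∀ ν ≠ 0, ∀ y,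
    (∃ s ∈ Set.Icc 0 (T - δ), 0 < F.law (T - s) y ∧ 0 < F.intensity s ν y) →
      ∀ s ∈ Set.Icc 0 (T - δ), m ≤ F.intensity s ν y ∧ m ≤ μ' s ν y

/-- The estimation error of the intensity `μ'` at backward time `s` is at most `εI` in the
score-entropy sense and at most `εII` in the `L¹` sense. -/
structure EstimationErrorAt (F : ForwardProcess d S T) (μ' : ℝ → Torus d S → Torus d S → ℝ)
    (εI εII s : ℝ) : Prop where
  entropy : ∑ y, F.law (T - s) y * ∑ ν : Jump d S,
    (F.intensity s ν y * (Real.log (F.intensity s ν y / μ' s ν y) - 1) + μ' s ν y) ≤ εI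
  l1 : ∑ y, F.law (T - s) y * ∑ ν : Jump d S, |F.intensity s ν y - μ' s ν y| ≤ εII

/-- The estimation error is small at all grid points and all `θ`-section points. -/
def EstimationError (F : ForwardProcess d S T) (μ' : ℝ → Torus d S → Torus d S → ℝ) {τ : ℝ}
    (g : TimeGrid τ) (θ εI εII : ℝ) : Prop :=
  ∀ n < g.N, EstimationErrorAt F μ' εI εII (g.pt n) ∧
    EstimationErrorAt F μ' εI εII (g.sectionPt θ n)

end DiscreteDiffusion

end

/-!
The state space is finite, so the sampler and the backward process can be compared step by step
through their one-step transition probabilities.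

Let `q_n` be the true law at the grid point `s_n`, and let `K_n` and `K'_n` be the transition
probabilities of the backward process and of the sampler from `s_n` to `s_{n+1}`. The log-sum
inequality (`klTerm_transition_le`) gives
`KL(q_{n+1} ‖ q'_{n+1}) ≤ KL(q_n ‖ q'_n) + ∑ y, q_n(y) KL(K_n(y, ·) ‖ K'_n(y, ·))`,
so it suffices to bound the averaged one-step relative entropies by `C (Δ_n ^ 3 + Δ_n εII)`.

*Relative entropy is dominated by total variation* (`StepData.exists_flow_le_mul_stepKernel`). If
`K ≤ C K'`, then `KL(K ‖ K') ≤ (1 + C) ∑ |K - K'|` (`klTerm_le_abs_sub`). From a state `y`, the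
backward process reaches a state at distance `k` in permissible jumps with probability at most of
order `Δ ^ k` (`IsFlow.le_pow`). The first stage of the sampler makes all jumps of a shortest path
with probability at least of order `Δ ^ k`, provided that they are all possible already from `y`.
This is where nonnegativity of the extrapolated intensities enters: if `ν` is permissible from `y`,
every jump that is possible for the estimated intensities from `y + ν` is possible from `y` as well
(`StepData.le_b₀_of_le_b₀_add`), because the first stage leads from `y + ν` back to `y` by repeating
the jump `ν` around the torus.

*The local error is of third order* (`StepData.exists_abs_flow_sub_stepKernel_le`). The law of a
Poisson leap is the exponential of a jump generator (`sum_leap_mul`), that is, the law of a jump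
process with frozen rates (`isFlow_leap`). Hence both `K` and `K'` have Taylor expansions in terms
of generators, and the weights `α₁`, `α₂` are such that they agree up to second order
(`StepData.abs_sub_le_of_expansions`), apart from the estimation errors at the current state and
after one jump. When two first-stage jumps lead out of the support of the true law, the second one
is not permissible after the first; then the true intensity vanishes while the estimated one does
not, so the probability of such a pair of jumps is paid for by the estimation error
(`StepData.le_rateDist_of_not_perm`).

*Averaging* (`StepData.sum_mul_rateDist_le`). The estimation error after one jump, averaged over
`q_n`, is bounded by the average over the true law at the intermediate time, since this law arises
from `q_n` by the backward process. The sum over `n` uses `∑ Δ_n ^ 3 ≤ κ ^ 2 T`.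
-/

namespace DiscreteDiffusion

/-! ### Relative entropy on finite sets -/

/-- The contribution `a log (a / b) - a + b` of one point to the relative entropy of two finite
measures with masses `a` and `b` at that point. -/
noncomputable def klTerm (a b : ℝ) : ℝ := a * Real.log (a / b) - a + b

lemma klTerm_nonneg {a b : ℝ} (ha : 0 ≤ a) (hb : 0 ≤ b) (hab : b = 0 → a = 0) :
    0 ≤ klTerm a b := by
  unfold klTerm
  rcases ha.eq_or_lt with rfl | ha
  · simpa using hb
  have hb : 0 < b := hb.lt_of_ne fun h => ha.ne' (hab h.symm)
  have h := Real.log_le_sub_one_of_pos (div_pos hb ha)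
  have h2 : Real.log (a / b) = -Real.log (b / a) := by rw [← Real.log_inv, inv_div]
  have h3 : a * (b / a) = b := by field_simp
  rw [h2]
  nlinarith [mul_le_mul_of_nonneg_left h ha.le]

/-- When the density ratio is bounded, relative entropy is dominated by total variation. -/
lemma klTerm_le_abs_sub {a b C : ℝ} (ha : 0 ≤ a) (hb : 0 ≤ b) (hab : a ≤ C * b) :
    klTerm a b ≤ (1 + C) * |a - b| := by
  unfold klTerm
  rcases hb.eq_or_lt with rfl | hb
  · have : a = 0 := by linarith
    simp [this]
  rcases ha.eq_or_lt with rfl | ha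
  · simp only [zero_mul, sub_zero, zero_add, zero_sub, abs_neg, abs_of_pos hb]
    linarith
  have h := Real.log_le_sub_one_of_pos (div_pos ha hb)
  have hr : a / b ≤ C := by rwa [div_le_iff₀ hb]
  have hr0 : 0 < a / b := div_pos ha hb
  have key : a * Real.log (a / b) - a + b ≤ (a / b - 1) * (a - b) := by
    have : a * (a / b - 1) - a + b = (a / b - 1) * (a - b) := by field_simp; ring
    nlinarith [mul_le_mul_of_nonneg_left h ha.le]
  refine key.trans ((le_abs_self _).trans ?_)
  rw [abs_mul]
  gcongr
  rw [abs_le]; constructor <;> linarith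

/-- The log-sum inequality, in the form that aggregating masses decreases relative entropy. -/
lemma klTerm_sum_le {ι : Type*} (s : Finset ι) (a b : ι → ℝ) (ha : ∀ i, 0 ≤ a i)
    (hb : ∀ i, 0 ≤ b i) (hab : ∀ i, b i = 0 → a i = 0) :
    klTerm (∑ i ∈ s, a i) (∑ i ∈ s, b i) ≤ ∑ i ∈ s, klTerm (a i) (b i) := by
  set A := ∑ i ∈ s, a i with hA
  set B := ∑ i ∈ s, b i with hB
  have hA0 : 0 ≤ A := Finset.sum_nonneg fun i _ => ha i
  have hB0 : 0 ≤ B := Finset.sum_nonneg fun i _ => hb i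
  rcases hA0.eq_or_lt with hAz | hApos
  · have hz : ∀ i ∈ s, a i = 0 := (Finset.sum_eq_zero_iff_of_nonneg fun i _ => ha i).1 hAz.symm
    rw [← hAz, Finset.sum_congr rfl fun i hi => by rw [hz i hi]]
    simp [klTerm, hB]
  have hBpos : 0 < B := by
    refine hB0.lt_of_ne fun h => hApos.ne' ?_
    have hz : ∀ i ∈ s, b i = 0 := (Finset.sum_eq_zero_iff_of_nonneg fun i _ => hb i).1 h.symm
    exact Finset.sum_eq_zero fun i hi => hab i (hz i hi)
  have hr : 0 < A / B := div_pos hApos hBpos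
  -- each summand is compared with the tangent of the logarithm at the aggregate ratio `A / B`
  have key : ∀ i ∈ s, a i * Real.log (A / B) + a i - A / B * b i ≤ a i * Real.log (a i / b i) := by
    intro i _
    rcases (ha i).eq_or_lt with h0 | hai
    · rw [← h0]; have := mul_nonneg hr.le (hb i); simp; linarith
    have hbi : 0 < b i := (hb i).lt_of_ne fun h => hai.ne' (hab i h.symm)
    have h := klTerm_nonneg hai.le (mul_nonneg hr.le hbi.le)
      (fun h => absurd h (mul_pos hr hbi).ne')
    unfold klTerm at h
    have h2 : Real.log (a i / (A / B * b i)) = Real.log (a i / b i) - Real.log (A / B) := by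
      rw [← Real.log_div (div_pos hai hbi).ne' hr.ne']
      congr 1
      field_simp
    rw [h2] at h
    linarith
  have h := Finset.sum_le_sum key
  have e1 : ∑ i ∈ s, (a i * Real.log (A / B) + a i - A / B * b i) = A * Real.log (A / B) := by
    rw [Finset.sum_sub_distrib, Finset.sum_add_distrib, ← Finset.sum_mul, ← Finset.mul_sum, ← hA,
      ← hB]
    field_simp
    ring
  have e2 : ∑ i ∈ s, klTerm (a i) (b i) = ∑ i ∈ s, a i * Real.log (a i / b i) - A + B := by
    unfold klTerm
    rw [Finset.sum_add_distrib, Finset.sum_sub_distrib]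
  rw [e2]
  unfold klTerm
  linarith

/-- The chain rule for relative entropy combined with the data processing inequality: one
transition of a Markov chain adds at most the averaged relative entropy of the two kernels. -/
lemma klTerm_transition_le {X : Type*} [Fintype X] (p q : X → ℝ) (K K' : X → X → ℝ)
    (hp : ∀ x, 0 ≤ p x) (hq : ∀ x, 0 ≤ q x) (hpq : ∀ x, q x = 0 → p x = 0)
    (hK : ∀ x y, 0 ≤ K x y) (hK' : ∀ x y, 0 ≤ K' x y)
    (hKK' : ∀ x, 0 < p x → ∀ y, K' x y = 0 → K x y = 0)
    (hK1 : ∀ x, ∑ y, K x y = 1) (hK1' : ∀ x, ∑ y, K' x y = 1) :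
    ∑ y, klTerm (∑ x, p x * K x y) (∑ x, q x * K' x y) ≤
      ∑ x, klTerm (p x) (q x) + ∑ x, p x * ∑ y, klTerm (K x y) (K' x y) := by
  have hac : ∀ x y, q x * K' x y = 0 → p x * K x y = 0 := by
    intro x y h
    rcases mul_eq_zero.1 h with h | h
    · simp [hpq x h]
    · rcases (hp x).eq_or_lt with h0 | h0
      · simp [← h0]
      · simp [hKK' x h0 y h]
  have step : ∀ x, ∑ y, klTerm (p x * K x y) (q x * K' x y) =
      klTerm (p x) (q x) + p x * ∑ y, klTerm (K x y) (K' x y) := by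
    intro x
    have hterm : ∀ y, klTerm (p x * K x y) (q x * K' x y) =
        p x * klTerm (K x y) (K' x y) + K x y * (p x * Real.log (p x / q x))
          + (q x - p x) * K' x y := by
      intro y
      unfold klTerm
      rcases (hp x).eq_or_lt with h0 | h0
      · simp [← h0]
      rcases (hK x y).eq_or_lt with h1 | h1
      · simp [← h1]; ring
      have hqx : q x ≠ 0 := fun h => h0.ne' (hpq x h)
      have hk' : K' x y ≠ 0 := fun h => h1.ne' (hKK' x h0 y h)
      rw [mul_div_mul_comm, Real.log_mul (div_ne_zero h0.ne' hqx) (div_ne_zero h1.ne' hk')]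
      ring
    rw [Finset.sum_congr rfl fun y _ => hterm y, Finset.sum_add_distrib, Finset.sum_add_distrib,
      ← Finset.mul_sum, ← Finset.sum_mul, ← Finset.mul_sum, hK1, hK1']
    unfold klTerm
    ring
  calc ∑ y, klTerm (∑ x, p x * K x y) (∑ x, q x * K' x y)
      ≤ ∑ y, ∑ x, klTerm (p x * K x y) (q x * K' x y) :=
        Finset.sum_le_sum fun y _ => klTerm_sum_le _ _ _ (fun x => mul_nonneg (hp x) (hK x y))
          (fun x => mul_nonneg (hq x) (hK' x y)) (fun x => hac x y)
    _ = ∑ x, ∑ y, klTerm (p x * K x y) (q x * K' x y) := Finset.sum_comm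
    _ = _ := by rw [Finset.sum_congr rfl fun x _ => step x, Finset.sum_add_distrib]

/-- The relative entropy of measures on a finite space, as a sum over the points. -/
lemma klDiv_eq_sum_klTerm {X : Type*} [Fintype X] [MeasurableSpace X] [MeasurableSingletonClass X]
    (P Q : Measure X) [IsFiniteMeasure P] [IsFiniteMeasure Q]
    (hac : ∀ x, Q.real {x} = 0 → P.real {x} = 0) :
    InformationTheory.klDiv P Q = ENNReal.ofReal (∑ x, klTerm (P.real {x}) (Q.real {x})) := by
  have hQ0 : ∀ x, Q {x} = 0 → P {x} = 0 := by
    intro x h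
    have := hac x (by simp [Measure.real, h])
    rcases (ENNReal.toReal_eq_zero_iff _).1 this with h | h
    · exact h
    · exact absurd h (measure_ne_top _ _)
  set f : X → ℝ≥0∞ := fun x => P {x} / Q {x} with hf
  have hmf : Measurable f := measurable_of_finite f
  have hP : P = Q.withDensity f := by
    refine Measure.ext_of_singleton fun x => ?_
    rw [withDensity_apply _ (measurableSet_singleton x), Measure.restrict_singleton,
      lintegral_smul_measure, lintegral_dirac]
    by_cases h : Q {x} = 0
    · simp [h, hQ0 x h]
    · simp only [hf, smul_eq_mul]
      rw [ENNReal.mul_div_cancel h (measure_ne_top _ _)]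
  have hPQ : P ≪ Q := by rw [hP]; exact withDensity_absolutelyContinuous _ _
  have hrn : ∀ x, Q {x} ≠ 0 → P.rnDeriv Q x = f x := by
    have h := Measure.rnDeriv_withDensity Q hmf
    rw [← hP] at h
    intro x hx
    by_contra hne
    exact hx (measure_mono_null (Set.singleton_subset_iff.2 hne) h)
  rw [InformationTheory.klDiv_eq_lintegral_klFun, if_pos hPQ, lintegral_fintype,
    ENNReal.ofReal_sum_of_nonneg fun x _ =>
      klTerm_nonneg measureReal_nonneg measureReal_nonneg (hac x)]
  refine Finset.sum_congr rfl fun x _ => ?_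
  by_cases h : Q {x} = 0
  · simp [h, Measure.real, hQ0 x h, klTerm]
  have hq : 0 < Q.real {x} := ENNReal.toReal_pos h (measure_ne_top _ _)
  rw [hrn x h, ← ENNReal.ofReal_toReal (measure_ne_top Q {x}), hf]
  simp only [ENNReal.toReal_div]
  rw [← ENNReal.ofReal_mul (InformationTheory.klFun_nonneg (by positivity))]
  congr 1
  change InformationTheory.klFun (P.real {x} / Q.real {x}) * Q.real {x} = _
  rw [InformationTheory.klFun_apply]
  unfold klTerm
  field_simp
  ring

lemma real_singleton_eq_zero_of_klDiv_ne_top {X : Type*} [MeasurableSpace X]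
    {P Q : Measure X} [IsFiniteMeasure Q] (h : InformationTheory.klDiv P Q ≠ ⊤) (x : X)
    (hx : Q.real {x} = 0) : P.real {x} = 0 := by
  have hac := (InformationTheory.klDiv_ne_top_iff.1 h).1
  have : Q {x} = 0 := by
    rcases (ENNReal.toReal_eq_zero_iff _).1 hx with h | h
    · exact h
    · exact absurd h (measure_ne_top _ _)
  simp [Measure.real, hac this]

section VecLaw

variable {d S : ℕ} [NeZero S] {p : Torus d S → ℝ}

instance (p : Torus d S → ℝ) : IsFiniteMeasure (vecLaw p) := by
  refine ⟨?_⟩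
  simp [vecLaw, Measure.finsetSum_apply]

lemma vecLaw_real_singleton (hp : ∀ x, 0 ≤ p x) (x : Torus d S) : (vecLaw p).real {x} = p x := by
  classical
  simp only [vecLaw, Measure.real, Measure.finsetSum_apply, Measure.smul_apply, smul_eq_mul,
    Measure.dirac_apply' _ (measurableSet_singleton x)]
  rw [Finset.sum_eq_single x]
  · simp [hp x]
  · intro y _ hy; simp [hy]
  · simp

lemma isProbabilityMeasure_vecLaw (hp : p ∈ stdSimplex ℝ (Torus d S)) :
    IsProbabilityMeasure (vecLaw p) := by
  refine ⟨?_⟩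
  simp only [vecLaw, Measure.finsetSum_apply, Measure.smul_apply, smul_eq_mul, measure_univ,
    mul_one]
  rw [← ENNReal.ofReal_sum_of_nonneg fun x _ => hp.1 x, hp.2, ENNReal.ofReal_one]

end VecLaw

variable {d S : ℕ} [NeZero S]

/-! ### Compound Poisson leaps as exponentials of jump operators -/

/-- The bounded operators on functions on the torus, with the supremum norm. -/
abbrev FunOp (d S : ℕ) [NeZero S] : Type := (Torus d S → ℝ) →L[ℝ] (Torus d S → ℝ)

/-- The translation operator `f ↦ f (· + v)`. -/
noncomputable def shiftOp (v : Torus d S) : FunOp d S :=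
  LinearMap.toContinuousLinearMap (LinearMap.funLeft ℝ ℝ fun y => y + v)

@[simp]
lemma shiftOp_apply (v y : Torus d S) (f : Torus d S → ℝ) : shiftOp v f y = f (y + v) := rfl

/-- The generator of the translation-invariant jump process with rates `c`. -/
noncomputable def jumpOp (c : Torus d S → ℝ) : FunOp d S :=
  ∑ ν : Jump d S, c ν • (shiftOp (ν : Torus d S) - 1)

lemma jumpOp_apply (c f : Torus d S → ℝ) (y : Torus d S) :
    jumpOp c f y = ∑ ν : Jump d S, c ν * (f (y + ν) - f y) := by
  simp [jumpOp, Finset.sum_apply]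

lemma shiftOp_commute (v w : Torus d S) : Commute (shiftOp v) (shiftOp w) := by
  ext f y
  simp [add_right_comm]

lemma shiftOp_pow_apply (v y : Torus d S) (n : ℕ) (f : Torus d S → ℝ) :
    (shiftOp v ^ n) f y = f (y + n • v) := by
  induction n generalizing y with
  | zero => simp
  | succ n ih =>
    rw [pow_succ', mul_apply_eq_comp, shiftOp_apply, ih, succ_nsmul', add_assoc]

/-- Evaluation of the image of `f` at `y`, as a functional of the operator. -/
noncomputable def evalOp (f : Torus d S → ℝ) (y : Torus d S) : FunOp d S →L[ℝ] ℝ :=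
  (ContinuousLinearMap.proj y).comp (ContinuousLinearMap.apply ℝ (Torus d S → ℝ) f)

@[simp]
lemma evalOp_apply (f : Torus d S → ℝ) (y : Torus d S) (A : FunOp d S) : evalOp f y A = A f y :=
  rfl

/-- The exponential series in Mathlib is defined through an algebra structure over `ℚ`. -/
noncomputable instance : NormedAlgebra ℚ (FunOp d S) := NormedAlgebra.restrictScalars ℚ ℝ _

lemma hasSum_exp_apply (A : FunOp d S) (f : Torus d S → ℝ) (y : Torus d S) :
    HasSum (fun n : ℕ => (n.factorial : ℝ)⁻¹ * (A ^ n) f y) (NormedSpace.exp A f y) := by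
  have h := (NormedSpace.exp_series_hasSum_exp' (𝕂 := ℝ) A).mapL (evalOp f y)
  simpa using! h

lemma exp_smul_sub_one (r : ℝ) (A : FunOp d S) :
    NormedSpace.exp (r • (A - 1)) = Real.exp (-r) • NormedSpace.exp (r • A) := by
  have h1 : r • (A - 1) = algebraMap ℝ (FunOp d S) (-r) + r • A := by
    rw [Algebra.algebraMap_eq_smul_one]; module
  rw [h1, NormedSpace.exp_add_of_commute (Algebra.commutes _ _), ← NormedSpace.algebraMap_exp_comm,
    ← Real.exp_eq_exp_ℝ, Algebra.algebraMap_eq_smul_one, smul_mul_assoc, one_mul]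

/-- Repeating the jump `v` a Poisson number of times is the exponential of the generator of this
jump: the Poisson weights are the coefficients of the exponential series. -/
lemma integral_poissonMeasure_shift (r : ℝ≥0) (v y : Torus d S) (f : Torus d S → ℝ) :
    ∫ n, f (y + n • v) ∂(poissonMeasure r) =
      NormedSpace.exp ((r : ℝ) • (shiftOp v - 1)) f y := by
  rw [integral_poissonMeasure, exp_smul_sub_one]
  have h := (hasSum_exp_apply ((r : ℝ) • shiftOp v) f y).mul_left (Real.exp (-r))
  rw [smul_apply, Pi.smul_apply, smul_eq_mul, ← h.tsum_eq]
  refine tsum_congr fun n => ?_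
  rw [smul_pow, smul_apply, Pi.smul_apply, shiftOp_pow_apply]
  simp only [smul_eq_mul]
  ring

/-- Translations commute, so independent jump counts multiply the exponentials of their
generators. -/
lemma integral_pi_poissonMeasure (a : Jump d S → ℝ≥0) (s : Finset (Jump d S)) (y : Torus d S)
    (f : Torus d S → ℝ) :
    ∫ P, f (y + ∑ ν ∈ s, P ν • (ν : Torus d S)) ∂(Measure.pi fun ν => poissonMeasure (a ν)) =
      NormedSpace.exp (∑ ν ∈ s, (a ν : ℝ) • (shiftOp (ν : Torus d S) - 1)) f y := by
  classical
  set μ : Measure (Jump d S → ℕ) := Measure.pi fun ν => poissonMeasure (a ν) with hμ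
  let X : Jump d S → (Jump d S → ℕ) → Torus d S := fun ν P => P ν • (ν : Torus d S)
  have hX : ∀ ν, Measurable (X ν) := fun ν =>
    (measurable_of_countable fun n : ℕ => n • (ν : Torus d S)).comp (measurable_pi_apply ν)
  have hind : iIndepFun X μ :=
    iIndepFun_pi (X := fun (ν : Jump d S) (n : ℕ) => n • (ν : Torus d S))
      fun ν => (measurable_of_countable _).aemeasurable
  induction s using Finset.induction_on generalizing y f with
  | empty => simp
  | insert ν s hν ih =>
    have hY : Measurable (∑ j ∈ s, X j) := measurable_of_countable _
    have h2 := hind.indepFun_finsetSum_of_notMem hX hν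
    have h3 := (indepFun_iff_map_prod_eq_prod_map_map hY.aemeasurable (hX ν).aemeasurable).1 h2
    have hcomm : Commute (∑ ν ∈ s, (a ν : ℝ) • (shiftOp (ν : Torus d S) - 1))
        ((a ν : ℝ) • (shiftOp (ν : Torus d S) - 1)) := by
      refine Commute.sum_left _ _ _ fun j _ => Commute.smul_left (Commute.smul_right ?_ _) _
      exact Commute.sub_left (Commute.sub_right (shiftOp_commute _ _) (Commute.one_right _))
        (Commute.one_left _)
    rw [Finset.sum_insert hν, add_comm ((a ν : ℝ) • _), NormedSpace.exp_add_of_commute hcomm,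
      mul_apply_eq_comp, ← ih]
    have e1 : ∀ P : Jump d S → ℕ, f (y + ∑ j ∈ insert ν s, P j • (j : Torus d S)) =
        (fun u : Torus d S × Torus d S => f (y + u.1 + u.2)) ((∑ j ∈ s, X j) P, X ν P) := by
      intro P
      simp only [Finset.sum_insert hν, Finset.sum_apply, X]
      congr 1
      abel
    rw [integral_congr_ae (Filter.Eventually.of_forall e1),
      ← integral_map (φ := fun P => ((∑ j ∈ s, X j) P, X ν P))
      (f := fun u : Torus d S × Torus d S => f (y + u.1 + u.2)) (hY.prodMk (hX ν)).aemeasurable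
      (measurable_of_finite _).aestronglyMeasurable, h3]
    have : IsProbabilityMeasure (μ.map (∑ j ∈ s, X j)) :=
      Measure.isProbabilityMeasure_map hY.aemeasurable
    have : IsProbabilityMeasure (μ.map (X ν)) :=
      Measure.isProbabilityMeasure_map (hX ν).aemeasurable
    rw [integral_prod _ Integrable.of_finite, integral_map hY.aemeasurable
      (measurable_of_finite _).aestronglyMeasurable]
    refine integral_congr_ae (Filter.Eventually.of_forall fun P => ?_)
    simp only [Finset.sum_apply, X]
    rw [integral_map (hX ν).aemeasurable (measurable_of_finite _).aestronglyMeasurable,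
      ← integral_poissonMeasure_shift]
    have hmp : MeasurePreserving (Function.eval ν) μ (poissonMeasure (a ν)) :=
      measurePreserving_eval _ ν
    rw [← hmp.map_eq, integral_map hmp.measurable.aemeasurable
      (measurable_of_countable _).aestronglyMeasurable]

lemma measurable_leap_map (y : Torus d S) :
    Measurable fun P : Jump d S → ℕ => y + ∑ ν : Jump d S, P ν • (ν : Torus d S) :=
  measurable_of_countable _

instance (y : Torus d S) (a : Torus d S → ℝ) : IsProbabilityMeasure (leap y a) :=
  Measure.isProbabilityMeasure_map (measurable_leap_map y).aemeasurable

/-- The law of a leap integrates functions as the exponential of the generator does. -/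
lemma sum_leap_mul (y : Torus d S) {c : Torus d S → ℝ} (hc : ∀ ν ≠ 0, 0 ≤ c ν)
    (f : Torus d S → ℝ) :
    ∑ z, (leap y c).real {z} * f z = NormedSpace.exp (jumpOp c) f y := by
  have h := integral_fintype (μ := leap y c) (f := f) Integrable.of_finite
  simp only [smul_eq_mul] at h
  rw [← h, leap, integral_map (measurable_leap_map y).aemeasurable
    (measurable_of_finite _).aestronglyMeasurable]
  have := integral_pi_poissonMeasure (fun ν : Jump d S => (c ν).toNNReal) Finset.univ y f
  have e : ∀ ν : Jump d S, ((c ν).toNNReal : ℝ) = c ν := fun ν => Real.coe_toNNReal _ (hc ν ν.2)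
  simp only [e] at this
  exact this

/-! ### Transition laws of jump processes with time-dependent rates -/

/-- The generator of the jump process in which the jump `ν` occurs from `y` at rate `a ν y`. -/
def gen (a : Torus d S → Torus d S → ℝ) (f : Torus d S → ℝ) (y : Torus d S) : ℝ :=
  ∑ ν : Jump d S, a ν y * (f (y + ν) - f y)

lemma gen_sub (a : Torus d S → Torus d S → ℝ) (f g : Torus d S → ℝ) (y : Torus d S) :
    gen a (fun z => f z - g z) y = gen a f y - gen a g y := by
  simp only [gen, ← Finset.sum_sub_distrib]
  exact Finset.sum_congr rfl fun _ _ => by ring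

lemma gen_add (a : Torus d S → Torus d S → ℝ) (f g : Torus d S → ℝ) (y : Torus d S) :
    gen a (fun z => f z + g z) y = gen a f y + gen a g y := by
  simp only [gen, ← Finset.sum_add_distrib]
  exact Finset.sum_congr rfl fun _ _ => by ring

lemma gen_const_mul (a : Torus d S → Torus d S → ℝ) (r : ℝ) (f : Torus d S → ℝ)
    (y : Torus d S) : gen a (fun z => r * f z) y = r * gen a f y := by
  simp only [gen, Finset.mul_sum]
  exact Finset.sum_congr rfl fun _ _ => by ring

lemma abs_gen_le {a : Torus d S → Torus d S → ℝ} {f : Torus d S → ℝ} {A F : ℝ} (hA : 0 ≤ A)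
    (y : Torus d S) (ha : ∀ ν ≠ 0, |a ν y| ≤ A) (hf : ∀ z, |f z| ≤ F) :
    |gen a f y| ≤ 2 * Fintype.card (Jump d S) * A * F := by
  calc |gen a f y| ≤ ∑ ν : Jump d S, |a ν y * (f (y + ν) - f y)| := Finset.abs_sum_le_sum_abs _ _
    _ ≤ ∑ _ν : Jump d S, A * (2 * F) := by
        refine Finset.sum_le_sum fun ν _ => ?_
        rw [abs_mul]
        refine mul_le_mul (ha ν ν.2) ?_ (abs_nonneg _) hA
        have := abs_sub (f (y + ν)) (f y)
        linarith [hf (y + ν), hf y]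
    _ = 2 * Fintype.card (Jump d S) * A * F := by
        simp only [Finset.sum_const, Finset.card_univ, nsmul_eq_mul]; ring

lemma sum_mul_single (f : Torus d S → ℝ) (y : Torus d S) :
    ∑ z, f z * (Pi.single z (1 : ℝ) : Torus d S → ℝ) y = f y := by
  classical
  simp [Pi.single_apply]

/-- The generator is determined by its values on indicators. -/
lemma sum_gen_single (a : Torus d S → Torus d S → ℝ) (f : Torus d S → ℝ) (y : Torus d S) :
    ∑ z, f z * gen a (Pi.single z 1) y = gen a f y := by
  simp only [gen, Finset.mul_sum]
  rw [Finset.sum_comm]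
  refine Finset.sum_congr rfl fun ν _ => ?_
  rw [← sum_mul_single f (y + ν), ← sum_mul_single f y, ← Finset.sum_sub_distrib, Finset.mul_sum]
  exact Finset.sum_congr rfl fun _ _ => by ring

/-- `v x` is the law at time `x ∈ [0, h]` of a jump process with rates `a x` started from `y₀`:
it consists of probability vectors and solves the forward equation, tested against indicators. -/
structure IsFlow (a : ℝ → Torus d S → Torus d S → ℝ) (h : ℝ) (y₀ : Torus d S)
    (v : ℝ → Torus d S → ℝ) : Prop where
  init : v 0 = Pi.single y₀ 1
  nonneg : ∀ x ∈ Set.Icc 0 h, ∀ z, 0 ≤ v x z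
  sum_eq_one : ∀ x ∈ Set.Icc 0 h, ∑ z, v x z = 1
  deriv : ∀ x ∈ Set.Icc 0 h, ∀ z, HasDerivWithinAt (fun u => v u z)
    (∑ w, v x w * gen (a x) (Pi.single z 1) w) (Set.Icc 0 h) x

namespace IsFlow

variable {a : ℝ → Torus d S → Torus d S → ℝ} {h : ℝ} {y₀ : Torus d S} {v : ℝ → Torus d S → ℝ}

lemma sum_init (hv : IsFlow a h y₀ v) (f : Torus d S → ℝ) : ∑ z, v 0 z * f z = f y₀ := by
  classical
  simp [hv.init, Pi.single_apply]

/-- The forward equation tested against an arbitrary function. -/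
lemma hasDerivWithinAt (hv : IsFlow a h y₀ v) (f : Torus d S → ℝ) {x : ℝ} (hx : x ∈ Set.Icc 0 h) :
    HasDerivWithinAt (fun u => ∑ z, v u z * f z) (∑ w, v x w * gen (a x) f w) (Set.Icc 0 h) x := by
  have h1 := HasDerivWithinAt.fun_sum (u := Finset.univ)
    fun z _ => (hv.deriv x hx z).mul_const (f z)
  convert! h1 using 1
  simp only [Finset.sum_mul]
  rw [Finset.sum_comm]
  refine Finset.sum_congr rfl fun w _ => ?_
  rw [← sum_gen_single, Finset.mul_sum]
  exact Finset.sum_congr rfl fun _ _ => by ring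

lemma abs_sum_le (hv : IsFlow a h y₀ v) {f : Torus d S → ℝ} {F : ℝ} (hf : ∀ z, |f z| ≤ F) {x : ℝ}
    (hx : x ∈ Set.Icc 0 h) : |∑ z, v x z * f z| ≤ F := by
  calc |∑ z, v x z * f z| ≤ ∑ z, |v x z * f z| := Finset.abs_sum_le_sum_abs _ _
    _ ≤ ∑ z, v x z * F := by
        refine Finset.sum_le_sum fun z _ => ?_
        rw [abs_mul, abs_of_nonneg (hv.nonneg x hx z)]
        exact mul_le_mul_of_nonneg_left (hf z) (hv.nonneg x hx z)
    _ = F := by rw [← Finset.sum_mul, hv.sum_eq_one x hx, one_mul]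

end IsFlow

/-- The mean value inequality for a function whose derivative is bounded by a power of time. -/
lemma abs_sub_le_of_deriv_le_pow {g g' : ℝ → ℝ} {h B : ℝ} (k : ℕ) (hB : 0 ≤ B)
    (hg : ∀ x ∈ Set.Icc 0 h, HasDerivWithinAt g (g' x) (Set.Icc 0 h) x)
    (hb : ∀ x ∈ Set.Icc 0 h, |g' x| ≤ B * x ^ k) {x : ℝ} (hx : x ∈ Set.Icc 0 h) :
    |g x - g 0| ≤ B * x ^ (k + 1) := by
  have hsub : Set.Icc 0 x ⊆ Set.Icc 0 h := Set.Icc_subset_Icc_right hx.2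
  have := Convex.norm_image_sub_le_of_norm_hasDerivWithin_le (s := Set.Icc 0 x) (C := B * x ^ k)
    (fun u hu => (hg u (hsub hu)).mono hsub)
    (fun u hu => (hb u (hsub hu)).trans
      (mul_le_mul_of_nonneg_left (pow_le_pow_left₀ hu.1 hu.2 k) hB)) (convex_Icc _ _)
    (Set.left_mem_Icc.2 hx.1) (Set.right_mem_Icc.2 hx.1)
  rw [Real.norm_eq_abs, Real.norm_eq_abs, sub_zero, abs_of_nonneg hx.1] at this
  rw [pow_succ, ← mul_assoc]
  exact this

/-- The rates `a x`, `x ∈ [0, h]`, are bounded by `R` and agree with the affine function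
`a 0 + x a'` up to an error `R x ^ 2`. -/
structure RateBounds (a : ℝ → Torus d S → Torus d S → ℝ) (a' : Torus d S → Torus d S → ℝ)
    (h R : ℝ) : Prop where
  nonneg : 0 ≤ R
  bound : ∀ x ∈ Set.Icc 0 h, ∀ ν ≠ 0, ∀ y, |a x ν y| ≤ R
  lipschitz : ∀ x ∈ Set.Icc 0 h, ∀ ν ≠ 0, ∀ y, |a x ν y - a 0 ν y| ≤ R * x
  deriv_bound : ∀ ν ≠ 0, ∀ y, |a' ν y| ≤ R
  affine : ∀ x ∈ Set.Icc 0 h, ∀ ν ≠ 0, ∀ y, |a x ν y - a 0 ν y - x * a' ν y| ≤ R * x ^ 2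

namespace IsFlow

variable {a : ℝ → Torus d S → Torus d S → ℝ} {a' : Torus d S → Torus d S → ℝ} {h R : ℝ}
  {y₀ : Torus d S} {v : ℝ → Torus d S → ℝ}

lemma abs_sum_sub_le (hv : IsFlow a h y₀ v) (ha : RateBounds a a' h R)
    {f : Torus d S → ℝ} {F : ℝ} (hf : ∀ z, |f z| ≤ F) {x : ℝ} (hx : x ∈ Set.Icc 0 h) :
    |∑ z, v x z * f z - f y₀| ≤ 2 * Fintype.card (Jump d S) * R * F * x := by
  have hR := ha.nonneg
  have hF : 0 ≤ F := (abs_nonneg _).trans (hf y₀)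
  have h1 := abs_sub_le_of_deriv_le_pow (B := 2 * Fintype.card (Jump d S) * R * F) 0 (by positivity)
    (fun x hx => hv.hasDerivWithinAt f hx)
    (fun x hx => by
      rw [pow_zero, mul_one]
      exact hv.abs_sum_le (fun z => abs_gen_le hR z (fun ν hν => ha.bound x hx ν hν z) hf) hx) hx
  rwa [hv.sum_init, zero_add, pow_one] at h1

lemma gen_rate_sub (a b : Torus d S → Torus d S → ℝ) (f : Torus d S → ℝ) (y : Torus d S) :
    gen (fun ν z => a ν z - b ν z) f y = gen a f y - gen b f y := by
  simp only [gen, ← Finset.sum_sub_distrib]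
  exact Finset.sum_congr rfl fun _ _ => by ring

lemma gen_rate_const_mul (r : ℝ) (a : Torus d S → Torus d S → ℝ) (f : Torus d S → ℝ)
    (y : Torus d S) : gen (fun ν z => r * a ν z) f y = r * gen a f y := by
  simp only [gen, Finset.mul_sum]
  exact Finset.sum_congr rfl fun _ _ => by ring

/-- The first-order expansion of the law of a jump process in time. -/
lemma abs_sum_sub_first_order_le (hv : IsFlow a h y₀ v) (ha : RateBounds a a' h R)
    {f : Torus d S → ℝ} {F : ℝ} (hf : ∀ z, |f z| ≤ F) {x : ℝ} (hx : x ∈ Set.Icc 0 h) :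
    |∑ z, v x z * f z - f y₀ - x * gen (a 0) f y₀| ≤
      (2 * Fintype.card (Jump d S) * R + (2 * Fintype.card (Jump d S) * R) ^ 2) * F * x ^ 2 := by
  have hR := ha.nonneg
  have hF : 0 ≤ F := (abs_nonneg _).trans (hf y₀)
  set Λ : ℝ := 2 * Fintype.card (Jump d S) * R with hΛ
  have hΛ0 : 0 ≤ Λ := by positivity
  have h0 : (0 : ℝ) ∈ Set.Icc 0 h := ⟨le_rfl, hx.1.trans hx.2⟩
  have h1 := abs_sub_le_of_deriv_le_pow (g := fun u => ∑ z, v u z * f z - f y₀ - u * gen (a 0) f y₀)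
    (g' := fun u => ∑ w, v u w * gen (a u) f w - gen (a 0) f y₀) (h := h)
    (B := (Λ + Λ ^ 2) * F) 1 (by positivity)
    (fun x hx => by
      convert! ((hv.hasDerivWithinAt f hx).sub_const (f y₀)).sub
        ((hasDerivWithinAt_id x _).mul_const (gen (a 0) f y₀)) using 1
      simp)
    (fun x hx => by
      have e : ∑ w, v x w * gen (a x) f w - gen (a 0) f y₀ =
          ∑ w, v x w * gen (fun ν z => a x ν z - a 0 ν z) f w +
            (∑ w, v x w * gen (a 0) f w - gen (a 0) f y₀) := by
        simp only [gen_rate_sub, mul_sub, Finset.sum_sub_distrib]; ring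
      have b1 := hv.abs_sum_le (fun z => abs_gen_le (a := fun ν z => a x ν z - a 0 ν z)
        (A := R * x) (mul_nonneg hR hx.1) z
        (fun ν hν => ha.lipschitz x hx ν hν z) hf) hx
      have b2 := hv.abs_sum_sub_le ha
        (fun z => abs_gen_le hR z (fun ν hν => ha.bound 0 h0 ν hν z) hf) hx
      rw [e]
      refine (abs_add_le _ _).trans ((add_le_add b1 b2).trans (le_of_eq ?_))
      rw [hΛ]; ring) hx
  simpa [hv.sum_init] using h1

/-- The second-order expansion of the law of a jump process in time. -/
lemma abs_sum_sub_second_order_le (hv : IsFlow a h y₀ v) (ha : RateBounds a a' h R)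
    {f : Torus d S → ℝ} {F : ℝ} (hf : ∀ z, |f z| ≤ F) {x : ℝ} (hx : x ∈ Set.Icc 0 h) :
    |∑ z, v x z * f z - f y₀ - x * gen (a 0) f y₀
        - x ^ 2 / 2 * (gen (a 0) (gen (a 0) f) y₀ + gen a' f y₀)| ≤
      (2 * Fintype.card (Jump d S) * R + 2 * (2 * Fintype.card (Jump d S) * R) ^ 2
        + (2 * Fintype.card (Jump d S) * R) ^ 3) * F * x ^ 3 := by
  have hR := ha.nonneg
  have hF : 0 ≤ F := (abs_nonneg _).trans (hf y₀)
  set Λ : ℝ := 2 * Fintype.card (Jump d S) * R with hΛ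
  have hΛ0 : 0 ≤ Λ := by positivity
  have h0 : (0 : ℝ) ∈ Set.Icc 0 h := ⟨le_rfl, hx.1.trans hx.2⟩
  set G := gen (a 0) (gen (a 0) f) y₀ + gen a' f y₀ with hG
  have h1 := abs_sub_le_of_deriv_le_pow
    (g := fun u => ∑ z, v u z * f z - f y₀ - u * gen (a 0) f y₀ - u ^ 2 / 2 * G)
    (g' := fun u => ∑ w, v u w * gen (a u) f w - gen (a 0) f y₀ - u * G) (h := h)
    (B := (Λ + 2 * Λ ^ 2 + Λ ^ 3) * F) 2 (by positivity)
    (fun x hx => by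
      have d1 := ((hv.hasDerivWithinAt f hx).sub_const (f y₀)).sub
        ((hasDerivWithinAt_id x _).mul_const (gen (a 0) f y₀))
      have d2 := (((hasDerivWithinAt_id x (Set.Icc 0 h)).pow 2).div_const 2).mul_const G
      convert! d1.sub d2 using 1
      simp)
    (fun x hx => by
      have e : ∑ w, v x w * gen (a x) f w - gen (a 0) f y₀ - x * G =
          ∑ w, v x w * gen (fun ν z => a x ν z - a 0 ν z - x * a' ν z) f w +
            (∑ w, v x w * gen (a 0) f w - gen (a 0) f y₀ - x * gen (a 0) (gen (a 0) f) y₀)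
            + x * (∑ w, v x w * gen a' f w - gen a' f y₀) := by
        have e1 : ∀ w, gen (fun ν z => a x ν z - a 0 ν z - x * a' ν z) f w =
            gen (a x) f w - gen (a 0) f w - x * gen a' f w := by
          intro w
          rw [gen_rate_sub (fun ν z => a x ν z - a 0 ν z) (fun ν z => x * a' ν z), gen_rate_sub,
            gen_rate_const_mul]
        have e2 : ∑ w, v x w * (x * gen a' f w) = x * ∑ w, v x w * gen a' f w := by
          rw [Finset.mul_sum]; exact Finset.sum_congr rfl fun _ _ => by ring
        simp only [e1, mul_sub, Finset.sum_sub_distrib, e2, hG]; ring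
      have b1 := hv.abs_sum_le (fun z => abs_gen_le
        (a := fun ν z => a x ν z - a 0 ν z - x * a' ν z) (A := R * x ^ 2) (by positivity) z
        (fun ν hν => ha.affine x hx ν hν z) hf) hx
      have b2 := hv.abs_sum_sub_first_order_le ha
        (fun z => abs_gen_le hR z (fun ν hν => ha.bound 0 h0 ν hν z) hf) hx
      have b3 := hv.abs_sum_sub_le ha
        (fun z => abs_gen_le hR z (fun ν hν => ha.deriv_bound ν hν z) hf) hx
      have b3' := mul_le_mul_of_nonneg_left b3 hx.1
      rw [e]
      refine (abs_add_three _ _ _).trans ?_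
      rw [abs_mul x, abs_of_nonneg hx.1]
      refine (add_le_add (add_le_add b1 b2) b3').trans (le_of_eq ?_)
      rw [hΛ]; ring) hx
  simpa [hv.sum_init] using h1

end IsFlow

/-! ### The flow of a leap -/

lemma jumpOp_smul (x : ℝ) (c : Torus d S → ℝ) :
    jumpOp (fun ν => x * c ν) = x • jumpOp c := by
  simp only [jumpOp, Finset.smul_sum, smul_smul]

/-- The law of a leap over a time `x` with frozen rates `c` is the law of the jump process with
constant rates `c`. -/
lemma isFlow_leap (y : Torus d S) {c : Torus d S → ℝ} (hc : ∀ ν ≠ 0, 0 ≤ c ν) (h : ℝ) :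
    IsFlow (fun _ ν _ => c ν) h y (fun x z => (leap y fun ν => x * c ν).real {z}) := by
  classical
  have key : ∀ x, 0 ≤ x → ∀ f : Torus d S → ℝ, ∑ z, (leap y fun ν => x * c ν).real {z} * f z =
      NormedSpace.exp (x • jumpOp c) f y := by
    intro x hx f
    rw [sum_leap_mul y (fun ν hν => mul_nonneg hx (hc ν hν)), jumpOp_smul]
  have key1 : ∀ x, 0 ≤ x → ∀ z, (leap y fun ν => x * c ν).real {z} =
      NormedSpace.exp (x • jumpOp c) (Pi.single z 1) y := by
    intro x hx z
    rw [← key x hx]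
    simp [Pi.single_apply]
  refine ⟨?_, fun _ _ _ => measureReal_nonneg, fun x _ => ?_, fun x hx z => ?_⟩
  · ext z
    rw [key1 0 le_rfl, zero_smul, NormedSpace.exp_zero, one_apply_eq_self]
    simp [Pi.single_apply, eq_comm]
  · rw [sum_measureReal_singleton]; simp
  · have h1 := ((evalOp (Pi.single z 1) y).hasFDerivAt.comp_hasDerivAt x
      (hasDerivAt_exp_smul_const (jumpOp c) x)).hasDerivWithinAt (s := Set.Icc 0 h)
    have e : ∀ w, gen (fun ν _ => c ν) (Pi.single z 1) w = jumpOp c (Pi.single z 1) w :=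
      fun w => (jumpOp_apply _ _ _).symm
    simp only [e]
    rw [key x hx.1]
    exact h1.congr (fun u hu => key1 u hu.1 z) (key1 x hx.1 z)

/-! ### Existence, uniqueness and short-time size of the transition laws -/

lemma abs_single_le_one (z w : Torus d S) : |(Pi.single z (1 : ℝ) : Torus d S → ℝ) w| ≤ 1 := by
  classical
  rw [Pi.single_apply]; split_ifs <;> simp

lemma gen_one (a : Torus d S → Torus d S → ℝ) (y : Torus d S) : gen a (fun _ => 1) y = 0 := by
  simp [gen]

lemma sum_gen_single_eq_zero (a : Torus d S → Torus d S → ℝ) (w : Torus d S) :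
    ∑ z, gen a (Pi.single z 1) w = 0 := by
  have h := sum_gen_single a (fun _ => 1) w
  simpa [gen_one] using h

lemma gen_single_nonneg {a : Torus d S → Torus d S → ℝ} {w z : Torus d S}
    (ha : ∀ ν ≠ 0, 0 ≤ a ν w) (hwz : w ≠ z) : 0 ≤ gen a (Pi.single z 1) w := by
  classical
  refine Finset.sum_nonneg fun ν _ => mul_nonneg (ha ν ν.2) ?_
  simp only [Pi.single_apply, if_neg hwz, sub_zero]
  split_ifs <;> simp

/-- The right-hand side of the forward equation. -/
def forwardField (a : Torus d S → Torus d S → ℝ) (u : Torus d S → ℝ) : Torus d S → ℝ :=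
  fun z => ∑ w, u w * gen a (Pi.single z 1) w

lemma forwardField_sub (a : Torus d S → Torus d S → ℝ) (u w : Torus d S → ℝ) :
    forwardField a (u - w) = forwardField a u - forwardField a w := by
  ext z
  simp only [forwardField, Pi.sub_apply, sub_mul, Finset.sum_sub_distrib]

/-- A Lipschitz constant of the forward equation with rates bounded by `R`. -/
def fieldBound (d S : ℕ) [NeZero S] (R : ℝ) : ℝ :=
  Fintype.card (Torus d S) * (2 * Fintype.card (Jump d S) * R)

lemma norm_forwardField_le {a : Torus d S → Torus d S → ℝ} {R : ℝ} (hR : 0 ≤ R)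
    (ha : ∀ ν ≠ 0, ∀ y, |a ν y| ≤ R) (u : Torus d S → ℝ) :
    ‖forwardField a u‖ ≤ fieldBound d S R * ‖u‖ := by
  unfold fieldBound
  refine (pi_norm_le_iff_of_nonneg (by positivity)).2 fun z => ?_
  rw [Real.norm_eq_abs]
  calc |∑ w, u w * gen a (Pi.single z 1) w|
      ≤ ∑ w, |u w * gen a (Pi.single z 1) w| := Finset.abs_sum_le_sum_abs _ _
    _ ≤ ∑ _w : Torus d S, ‖u‖ * (2 * Fintype.card (Jump d S) * R) := by
        refine Finset.sum_le_sum fun w _ => ?_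
        rw [abs_mul]
        refine mul_le_mul (norm_le_pi_norm u w) ?_ (abs_nonneg _) (norm_nonneg _)
        simpa using abs_gen_le hR w (fun ν hν => ha ν hν w) (abs_single_le_one z)
    _ = _ := by simp only [Finset.sum_const, Finset.card_univ, nsmul_eq_mul]; ring

lemma hasDerivWithinAt_Ici_of_Icc {E : Type*} [NormedAddCommGroup E] [NormedSpace ℝ E] {f : ℝ → E}
    {f' : E} {a b x : ℝ} (hx : x ∈ Set.Ico a b) (h : HasDerivWithinAt f f' (Set.Icc a b) x) :
    HasDerivWithinAt f f' (Set.Ici x) x :=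
  h.mono_of_mem_nhdsWithin (Icc_mem_nhdsGE_of_mem hx)

/-- The square of the negative part is continuously differentiable. -/
lemma hasDerivAt_min_zero_sq (x : ℝ) :
    HasDerivAt (fun u : ℝ => (min u 0) ^ 2) (2 * min x 0) x := by
  have h1 : HasDerivAt
      (fun u : ℝ => (min u 0) ^ 2 - (min x 0) ^ 2 - 2 * min x 0 * (u - x)) 0 x := by
    have : (fun u : ℝ => (min u 0) ^ 2 - (min x 0) ^ 2 - 2 * min x 0 * (u - x))
        =O[nhds x] fun u => ‖u - x‖ ^ 2 := by
      refine Asymptotics.IsBigO.of_bound 1 (Filter.Eventually.of_forall fun u => ?_)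
      rw [one_mul, norm_pow, norm_norm, Real.norm_eq_abs, Real.norm_eq_abs, sq_abs, abs_le]
      rcases le_total u 0 with hu | hu <;> rcases le_total x 0 with hx | hx <;>
        simp only [min_eq_left, min_eq_right, hu, hx]
      · constructor <;> nlinarith [sq_nonneg (u - x)]
      · constructor <;> nlinarith [mul_nonneg (neg_nonneg.2 hu) hx]
      · constructor <;> nlinarith [mul_nonneg (neg_nonneg.2 hx) hu]
      · constructor <;> nlinarith [sq_nonneg (u - x)]
    have := (this.hasFDerivAt (by norm_num)).hasDerivAt
    simpa using this
  have h2 := (h1.add_const ((min x 0) ^ 2)).add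
    (((hasDerivAt_id x).sub_const x).const_mul (2 * min x 0))
  convert! h2 using 1
  · ext u; simp only [Pi.add_apply, id_eq]; ring
  · simp

/-- The forward equation preserves nonnegativity: the sum of the squared negative parts of a
solution satisfies a Grönwall inequality. -/
lemma nonneg_of_forwardField {a : ℝ → Torus d S → Torus d S → ℝ} {h R : ℝ} (hR : 0 ≤ R)
    (ha0 : ∀ x ∈ Set.Icc 0 h, ∀ ν ≠ 0, ∀ y, 0 ≤ a x ν y)
    (haR : ∀ x ∈ Set.Icc 0 h, ∀ ν ≠ 0, ∀ y, a x ν y ≤ R) {v : ℝ → Torus d S → ℝ}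
    (hv0 : ∀ z, 0 ≤ v 0 z)
    (hv : ∀ x ∈ Set.Icc 0 h, HasDerivWithinAt v (forwardField (a x) (v x)) (Set.Icc 0 h) x)
    {x : ℝ} (hx : x ∈ Set.Icc 0 h) (z : Torus d S) : 0 ≤ v x z := by
  have hpi : ∀ x ∈ Set.Icc 0 h, ∀ z,
      HasDerivWithinAt (fun u => v u z) (forwardField (a x) (v x) z) (Set.Icc 0 h) x :=
    fun x hx => hasDerivWithinAt_pi.1 (hv x hx)
  set Λ : ℝ := 2 * Fintype.card (Jump d S) * R with hΛ
  have hΛ0 : 0 ≤ Λ := by positivity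
  let φ : ℝ → ℝ := fun x => ∑ z, (min (v x z) 0) ^ 2
  let φ' : ℝ → ℝ := fun x => ∑ z, 2 * min (v x z) 0 * forwardField (a x) (v x) z
  have hφ : ∀ x ∈ Set.Icc 0 h, HasDerivWithinAt φ (φ' x) (Set.Icc 0 h) x := fun x hx =>
    HasDerivWithinAt.fun_sum fun z _ =>
      HasDerivAt.comp_hasDerivWithinAt (h₂ := fun u : ℝ => (min u 0) ^ 2) x
        (hasDerivAt_min_zero_sq (v x z)) (hpi x hx z)
  have hbound : ∀ x ∈ Set.Ico 0 h, φ' x ≤ (2 * Λ * Fintype.card (Torus d S)) * φ x + 0 := by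
    intro x hx
    have hx' := Set.Ico_subset_Icc_self hx
    have hterm : ∀ z w, 2 * min (v x z) 0 * (v x w * gen (a x) (Pi.single z 1) w) ≤
        Λ * ((min (v x z) 0) ^ 2 + (min (v x w) 0) ^ 2) := by
      intro z w
      have hA : |gen (a x) (Pi.single z 1) w| ≤ Λ := by
        have := abs_gen_le hR w (fun ν hν =>
          (abs_of_nonneg (ha0 x hx' ν hν w)).trans_le (haR x hx' ν hν w)) (abs_single_le_one z)
        rwa [mul_one] at this
      set A := gen (a x) (Pi.single z 1) w
      have hz : min (v x z) 0 ≤ 0 := min_le_right _ _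
      have hw : min (v x w) 0 ≤ 0 := min_le_right _ _
      have step : min (v x z) 0 * (v x w * A) ≤ min (v x z) 0 * (min (v x w) 0 * A) := by
        by_cases hwz : w = z
        · subst hwz
          rcases le_total (v x w) 0 with hn | hn
          · simp [hn]
          · simp [hn]
        · have hA0 : 0 ≤ A := gen_single_nonneg (fun ν hν => ha0 x hx' ν hν w) hwz
          exact mul_le_mul_of_nonpos_left
            (mul_le_mul_of_nonneg_right (min_le_left _ _) hA0) hz
      have hzw : 0 ≤ min (v x z) 0 * min (v x w) 0 := mul_nonneg_of_nonpos_of_nonpos hz hw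
      have := mul_le_mul_of_nonneg_left ((le_abs_self A).trans hA) hzw
      nlinarith [mul_nonneg hΛ0 (sq_nonneg (min (v x z) 0 - min (v x w) 0))]
    calc φ' x = ∑ z, ∑ w, 2 * min (v x z) 0 * (v x w * gen (a x) (Pi.single z 1) w) := by
          simp only [φ', forwardField, Finset.mul_sum]
      _ ≤ ∑ z, ∑ w, Λ * ((min (v x z) 0) ^ 2 + (min (v x w) 0) ^ 2) :=
          Finset.sum_le_sum fun z _ => Finset.sum_le_sum fun w _ => hterm z w
      _ = (2 * Λ * Fintype.card (Torus d S)) * φ x + 0 := by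
          simp only [← Finset.mul_sum, Finset.sum_add_distrib, Finset.sum_const, Finset.card_univ,
            nsmul_eq_mul, φ]
          ring
  have hφ0 : φ 0 ≤ 0 := by simp [φ, hv0]
  have hle := le_gronwallBound_of_liminf_deriv_right_le
    (fun x hx => (hφ x hx).continuousWithinAt)
    (fun x hx r hr => (hasDerivWithinAt_Ici_of_Icc hx
      (hφ x (Set.Ico_subset_Icc_self hx))).liminf_right_slope_le hr) hφ0 hbound x hx
  rw [gronwallBound_ε0_δ0] at hle
  have h1 : (min (v x z) 0) ^ 2 ≤ φ x :=
    Finset.single_le_sum (f := fun z => (min (v x z) 0) ^ 2) (fun _ _ => sq_nonneg _)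
      (Finset.mem_univ z)
  have h2 : min (v x z) 0 = 0 := by nlinarith [sq_nonneg (min (v x z) 0)]
  exact min_eq_right_iff.1 h2

/-- Over a short time, a jump process with continuous rates has a transition law. The restriction on
the time keeps the Picard iteration in the unit ball around the initial value. -/
lemma exists_isFlow {a : ℝ → Torus d S → Torus d S → ℝ} {h R : ℝ} (hh : 0 ≤ h) (hR : 0 ≤ R)
    (ha0 : ∀ x ∈ Set.Icc 0 h, ∀ ν ≠ 0, ∀ y, 0 ≤ a x ν y)
    (haR : ∀ x ∈ Set.Icc 0 h, ∀ ν ≠ 0, ∀ y, a x ν y ≤ R)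
    (hac : ∀ ν ≠ 0, ∀ y, ContinuousOn (fun x => a x ν y) (Set.Icc 0 h))
    (hsmall : 2 * fieldBound d S R * h ≤ 1) (y₀ : Torus d S) :
    ∃ v, IsFlow a h y₀ v := by
  classical
  have hB0 : 0 ≤ fieldBound d S R := by unfold fieldBound; positivity
  have habs : ∀ x ∈ Set.Icc 0 h, ∀ ν ≠ 0, ∀ y, |a x ν y| ≤ R := fun x hx ν hν y =>
    (abs_of_nonneg (ha0 x hx ν hν y)).trans_le (haR x hx ν hν y)
  let u₀ : Torus d S → ℝ := Pi.single y₀ 1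
  have hu₀ : ‖u₀‖ ≤ 1 := (pi_norm_le_iff_of_nonneg zero_le_one).2 fun w => abs_single_le_one y₀ w
  let K : ℝ≥0 := ⟨fieldBound d S R, hB0⟩
  have hPL : IsPicardLindelof (fun x u => forwardField (a x) u) (tmin := 0) (tmax := h)
      ⟨0, Set.left_mem_Icc.2 hh⟩ u₀ 1 0 (2 * K) K := by
    refine ⟨fun x hx => ?_, fun u _ => ?_, fun x hx u hu => ?_, ?_⟩
    · refine LipschitzWith.lipschitzOnWith (LipschitzWith.of_dist_le_mul fun u w => ?_)
      rw [dist_eq_norm, dist_eq_norm, ← forwardField_sub]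
      exact norm_forwardField_le hR (habs x hx) _
    · refine continuousOn_pi.2 fun z => ?_
      refine continuousOn_finsetSum _ fun w _ => continuousOn_const.mul ?_
      refine continuousOn_finsetSum _ fun ν _ => (hac ν ν.2 w).mul continuousOn_const
    · refine (norm_forwardField_le hR (habs x hx) u).trans ?_
      have : ‖u‖ ≤ 2 := by
        have h1 : ‖u - u₀‖ ≤ 1 := by simpa [dist_eq_norm] using hu
        have h2 := norm_le_norm_add_norm_sub' u u₀
        linarith
      calc fieldBound d S R * ‖u‖ ≤ fieldBound d S R * 2 := by gcongr
        _ = 2 * fieldBound d S R := mul_comm _ _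
    · simp only [sub_zero, NNReal.coe_mul, NNReal.coe_ofNat, NNReal.coe_one, NNReal.coe_zero]
      rw [max_eq_left hh]
      exact hsmall
  obtain ⟨v, hv0, hv⟩ := hPL.exists_eq_forall_mem_Icc_hasDerivWithinAt
    (Metric.mem_closedBall_self le_rfl)
  have hpi : ∀ x ∈ Set.Icc 0 h, ∀ z,
      HasDerivWithinAt (fun u => v u z) (forwardField (a x) (v x) z) (Set.Icc 0 h) x :=
    fun x hx => hasDerivWithinAt_pi.1 (hv x hx)
  refine ⟨v, hv0, fun x hx z => nonneg_of_forwardField hR ha0 haR ?_ hv hx z, fun x hx => ?_, hpi⟩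
  · intro z
    rw [show v 0 = u₀ from hv0]
    simp only [u₀, Pi.single_apply]
    split_ifs <;> simp
  · have hd : ∀ x ∈ Set.Icc 0 h, HasDerivWithinAt (fun u => ∑ z, v u z) 0 (Set.Icc 0 h) x := by
      intro x hx
      convert! HasDerivWithinAt.fun_sum (u := Finset.univ) fun z _ => hpi x hx z using 1
      simp only [forwardField]
      rw [Finset.sum_comm]
      simp [← Finset.mul_sum, sum_gen_single_eq_zero]
    have := abs_sub_le_of_deriv_le_pow (B := 0) 0 le_rfl hd (fun _ _ => by simp) hx
    have h1 : ∑ z, v 0 z = 1 := by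
      rw [show v 0 = u₀ from hv0]; simp [u₀, Pi.single_apply]
    rw [zero_mul] at this
    have := abs_eq_zero.1 (le_antisymm this (abs_nonneg _))
    linarith

/-- Every solution of the forward equation is the mixture of the transition laws by its initial
value. The equation is only needed for right derivatives on `[0, h)`. -/
lemma eq_sum_mul_flow {a : ℝ → Torus d S → Torus d S → ℝ} {h R : ℝ} (hR : 0 ≤ R)
    (haR : ∀ x ∈ Set.Icc 0 h, ∀ ν ≠ 0, ∀ y, |a x ν y| ≤ R)
    {v : Torus d S → ℝ → Torus d S → ℝ} (hv : ∀ y, IsFlow a h y (v y)) {q : ℝ → Torus d S → ℝ}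
    (hqc : ∀ z, ContinuousOn (fun x => q x z) (Set.Icc 0 h))
    (hq : ∀ x ∈ Set.Ico 0 h, ∀ z,
      HasDerivWithinAt (fun u => q u z) (forwardField (a x) (q x) z) (Set.Ici x) x)
    {x : ℝ} (hx : x ∈ Set.Icc 0 h) (z : Torus d S) : q x z = ∑ y, q 0 y * v y x z := by
  classical
  let w : ℝ → Torus d S → ℝ := fun x z => q x z - ∑ y, q 0 y * v y x z
  have hzero := eq_zero_of_abs_deriv_le_mul_abs_self_of_eq_zero_right (f := w)
    (f' := fun x => forwardField (a x) (w x)) (K := fieldBound d S R) (a := 0) (b := h)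
    (continuousOn_pi.2 fun z => (hqc z).sub <| continuousOn_finsetSum _ fun y _ =>
      continuousOn_const.mul fun x hx => ((hv y).deriv x hx z).continuousWithinAt)
    (fun x hx => by
      refine hasDerivWithinAt_pi.2 fun z => ?_
      have h1 := (hq x hx z).sub <| HasDerivWithinAt.fun_sum (u := Finset.univ) fun y _ =>
        (hasDerivWithinAt_Ici_of_Icc hx ((hv y).deriv x (Set.Ico_subset_Icc_self hx) z)).const_mul
          (q 0 y)
      convert! h1 using 1
      simp only [forwardField, w, sub_mul, Finset.sum_sub_distrib, Finset.sum_mul, Finset.mul_sum]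
      rw [Finset.sum_comm (s := Finset.univ) (t := Finset.univ)
        (f := fun w y => q 0 y * v y x w * gen (a x) (Pi.single z 1) w)]
      congr 1
      exact Finset.sum_congr rfl fun _ _ => Finset.sum_congr rfl fun _ _ => by ring)
    (by ext z; simp [w, (hv _).init, Pi.single_apply])
    (fun x hx => norm_forwardField_le hR (haR x (Set.Ico_subset_Icc_self hx)) _) x hx
  have := congrFun hzero z
  simp only [w, Pi.zero_apply] at this
  linarith

/-! ### Paths of permissible jumps -/

/-- The list `l` is a sequence of nonzero jumps which, made one after the other from `y`, are all
permitted by the relation `r`. -/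
def IsJumpPath (r : Torus d S → Torus d S → Prop) : Torus d S → List (Torus d S) → Prop
  | _, [] => True
  | y, ν :: l => ν ≠ 0 ∧ r ν y ∧ IsJumpPath r (y + ν) l

lemma isJumpPath_append {r : Torus d S → Torus d S → Prop} {y : Torus d S}
    {l l' : List (Torus d S)} :
    IsJumpPath r y (l ++ l') ↔ IsJumpPath r y l ∧ IsJumpPath r (y + l.sum) l' := by
  induction l generalizing y with
  | nil => simp [IsJumpPath]
  | cons ν l ih => simp [IsJumpPath, ih, and_assoc, add_assoc]

/-- A shortest path visits no state twice, so its length is at most the number of states. -/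
lemma exists_short_isJumpPath {r : Torus d S → Torus d S → Prop} {y z : Torus d S}
    (h : ∃ l, IsJumpPath r y l ∧ y + l.sum = z) :
    ∃ l, IsJumpPath r y l ∧ y + l.sum = z ∧ l.length ≤ Fintype.card (Torus d S) ∧
      ∀ l', IsJumpPath r y l' → y + l'.sum = z → l.length ≤ l'.length := by
  classical
  have h' : ∃ n, ∃ l, IsJumpPath r y l ∧ y + l.sum = z ∧ l.length = n := by
    obtain ⟨l, h1, h2⟩ := h
    exact ⟨_, l, h1, h2, rfl⟩
  obtain ⟨l, hl, hz, hlen⟩ := Nat.find_spec h'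
  have hmin : ∀ l', IsJumpPath r y l' → y + l'.sum = z → l.length ≤ l'.length := by
    intro l' h1 h2
    rw [hlen]
    exact Nat.find_min' h' ⟨l', h1, h2, rfl⟩
  refine ⟨l, hl, hz, ?_, hmin⟩
  by_contra! hcard
  -- the loop between two visits of the same state could be cut out
  obtain ⟨i, j, hij, hf⟩ := Fintype.exists_ne_map_eq_of_card_lt
    (fun i : Fin l.length => y + (l.take i).sum) (by simpa using hcard)
  wlog hlt : i < j generalizing i j
  · exact this j i hij.symm hf.symm (lt_of_le_of_ne (not_lt.1 hlt) hij.symm)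
  have hj : IsJumpPath r y (l.take j ++ l.drop j) := by rwa [List.take_append_drop]
  have hi : IsJumpPath r y (l.take i ++ l.drop i) := by rwa [List.take_append_drop]
  rw [isJumpPath_append] at hi hj
  have hnew : IsJumpPath r y (l.take i ++ l.drop j) := by
    rw [isJumpPath_append]
    refine ⟨hi.1, ?_⟩
    rw [show y + (l.take i).sum = y + (l.take j).sum from hf]
    exact hj.2
  have hsum : y + (l.take i ++ l.drop j).sum = z := by
    rw [List.sum_append, ← add_assoc, show y + (l.take i).sum = y + (l.take j).sum from hf,
      add_assoc, ← List.sum_append, List.take_append_drop, hz]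
  have := hmin _ hnew hsum
  simp only [List.length_append, List.length_take, List.length_drop] at this
  omega

/-- A state that no permissible path of fewer than `j` jumps reaches is charged with at most the
`j`-th power of the elapsed time. -/
lemma IsFlow.le_pow {a : ℝ → Torus d S → Torus d S → ℝ} {h R : ℝ} {y₀ : Torus d S}
    {v : ℝ → Torus d S → ℝ} (hv : IsFlow a h y₀ v) (hR : 0 ≤ R)
    (haR : ∀ x ∈ Set.Icc 0 h, ∀ ν ≠ 0, ∀ y, |a x ν y| ≤ R)
    {r : Torus d S → Torus d S → Prop}
    (har : ∀ x ∈ Set.Icc 0 h, ∀ ν ≠ 0, ∀ y, ¬ r ν y → a x ν y = 0) (j : ℕ) (z : Torus d S)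
    (hz : ∀ l, IsJumpPath r y₀ l → y₀ + l.sum = z → j ≤ l.length) {x : ℝ}
    (hx : x ∈ Set.Icc 0 h) : v x z ≤ (fieldBound d S R * x) ^ j := by
  classical
  have hB0 : 0 ≤ fieldBound d S R := by unfold fieldBound; positivity
  induction j generalizing z x with
  | zero =>
    rw [pow_zero, ← hv.sum_eq_one x hx]
    exact Finset.single_le_sum (f := fun z => v x z) (fun z _ => hv.nonneg x hx z)
      (Finset.mem_univ z)
  | succ j ih =>
    have hinit : v 0 z = 0 := by
      rw [hv.init, Pi.single_apply, if_neg]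
      rintro rfl
      have := hz [] trivial (by simp)
      simp at this
    have hderiv : ∀ x ∈ Set.Icc 0 h, |∑ w, v x w * gen (a x) (Pi.single z 1) w| ≤
        (fieldBound d S R) ^ (j + 1) * x ^ j := by
      intro x hx
      have hterm : ∀ w, |v x w * gen (a x) (Pi.single z 1) w| ≤
          (fieldBound d S R * x) ^ j * (2 * Fintype.card (Jump d S) * R) := by
        intro w
        have hpow : 0 ≤ (fieldBound d S R * x) ^ j := pow_nonneg (mul_nonneg hB0 hx.1) _
        have hA : |gen (a x) (Pi.single z 1) w| ≤ 2 * Fintype.card (Jump d S) * R := by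
          have := abs_gen_le hR w (fun ν hν => haR x hx ν hν w) (abs_single_le_one z)
          rwa [mul_one] at this
        by_cases hw : ∀ l, IsJumpPath r y₀ l → y₀ + l.sum = w → j ≤ l.length
        · rw [abs_mul, abs_of_nonneg (hv.nonneg x hx w)]
          exact mul_le_mul (ih w hw hx) hA (abs_nonneg _) hpow
        · -- a short path to `w` cannot be prolonged to `z`, so no jump leads from `w` to `z`
          push Not at hw
          obtain ⟨l, hl, hlw, hlen⟩ := hw
          have hwz : w ≠ z := by
            rintro rfl
            have := hz l hl hlw
            omega
          have hgen : gen (a x) (Pi.single z 1) w = 0 := by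
            refine Finset.sum_eq_zero fun ν _ => ?_
            by_cases hν : w + ν = z
            · have hr : ¬ r ν w := by
                intro hr
                have := hz (l ++ [(ν : Torus d S)])
                  (isJumpPath_append.2 ⟨hl, ν.2, by rwa [hlw], trivial⟩)
                  (by rw [List.sum_append, ← add_assoc, hlw]; simpa using hν)
                simp at this
                omega
              rw [har x hx ν ν.2 w hr, zero_mul]
            · simp [hν, hwz]
          rw [hgen, mul_zero, abs_zero]
          positivity
      calc |∑ w, v x w * gen (a x) (Pi.single z 1) w|
          ≤ ∑ w, |v x w * gen (a x) (Pi.single z 1) w| := Finset.abs_sum_le_sum_abs _ _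
        _ ≤ ∑ _w : Torus d S, (fieldBound d S R * x) ^ j * (2 * Fintype.card (Jump d S) * R) :=
            Finset.sum_le_sum fun w _ => hterm w
        _ = (fieldBound d S R * x) ^ j * fieldBound d S R := by
            simp only [Finset.sum_const, Finset.card_univ, nsmul_eq_mul]
            unfold fieldBound; ring
        _ = _ := by ring
    have := abs_sub_le_of_deriv_le_pow j (by positivity) (fun x hx => hv.deriv x hx z) hderiv hx
    rw [hinit, sub_zero] at this
    rw [mul_pow]
    exact (le_abs_self _).trans this

/-- A state that no permissible path reaches is not charged at all in a short time. -/
lemma IsFlow.eq_zero_of_unreachable {a : ℝ → Torus d S → Torus d S → ℝ} {h R : ℝ}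
    {y₀ : Torus d S} {v : ℝ → Torus d S → ℝ} (hv : IsFlow a h y₀ v) (hR : 0 ≤ R)
    (haR : ∀ x ∈ Set.Icc 0 h, ∀ ν ≠ 0, ∀ y, |a x ν y| ≤ R)
    {r : Torus d S → Torus d S → Prop}
    (har : ∀ x ∈ Set.Icc 0 h, ∀ ν ≠ 0, ∀ y, ¬ r ν y → a x ν y = 0) {z : Torus d S}
    (hz : ¬ ∃ l, IsJumpPath r y₀ l ∧ y₀ + l.sum = z) {x : ℝ}
    (hx : x ∈ Set.Icc 0 h) (hsmall : fieldBound d S R * x < 1) : v x z = 0 := by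
  have hB0 : 0 ≤ fieldBound d S R := by unfold fieldBound; positivity
  refine le_antisymm ?_ (hv.nonneg x hx z)
  exact ge_of_tendsto' (tendsto_pow_atTop_nhds_zero_of_lt_one (mul_nonneg hB0 hx.1) hsmall)
    fun j => hv.le_pow hR haR har j z (fun l hl hlz => absurd ⟨l, hl, hlz⟩ hz) hx

/-! ### Lower bounds for leaps -/

lemma leap_real_singleton (y : Torus d S) {c : Torus d S → ℝ} (hc : ∀ ν ≠ 0, 0 ≤ c ν)
    (z : Torus d S) : (leap y c).real {z} = NormedSpace.exp (jumpOp c) (Pi.single z 1) y := by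
  classical
  rw [← sum_leap_mul y hc]
  simp [Pi.single_apply]

/-- The jump part `∑ c ν τ_ν` of the generator with rates `c`. -/
noncomputable def jumpPart (c : Torus d S → ℝ) : FunOp d S :=
  ∑ ν : Jump d S, c ν • shiftOp (ν : Torus d S)

lemma jumpPart_apply (c f : Torus d S → ℝ) (y : Torus d S) :
    jumpPart c f y = ∑ ν : Jump d S, c ν * f (y + ν) := by
  simp [jumpPart, Finset.sum_apply]

lemma exp_jumpOp (c : Torus d S → ℝ) : NormedSpace.exp (jumpOp c) =
    Real.exp (-∑ ν : Jump d S, c ν) • NormedSpace.exp (jumpPart c) := by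
  have h1 : jumpOp c = algebraMap ℝ (FunOp d S) (-∑ ν : Jump d S, c ν) + jumpPart c := by
    rw [Algebra.algebraMap_eq_smul_one]
    simp only [jumpOp, jumpPart, smul_sub, Finset.sum_sub_distrib, neg_smul, Finset.sum_smul]
    abel
  rw [h1, NormedSpace.exp_add_of_commute (Algebra.commutes _ _), ← NormedSpace.algebraMap_exp_comm,
    ← Real.exp_eq_exp_ℝ, Algebra.algebraMap_eq_smul_one, smul_mul_assoc, one_mul]

lemma jumpPart_pow_nonneg {c : Torus d S → ℝ} (hc : ∀ ν ≠ 0, 0 ≤ c ν) {f : Torus d S → ℝ}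
    (hf : ∀ z, 0 ≤ f z) (n : ℕ) (y : Torus d S) : 0 ≤ (jumpPart c ^ n) f y := by
  induction n generalizing y with
  | zero => simpa using hf y
  | succ n ih =>
    rw [pow_succ', mul_apply_eq_comp, jumpPart_apply]
    exact Finset.sum_nonneg fun ν _ => mul_nonneg (hc ν ν.2) (ih _)

lemma pow_le_jumpPart_pow {c : Torus d S → ℝ} (hc : ∀ ν ≠ 0, 0 ≤ c ν) {f : Torus d S → ℝ}
    (hf : ∀ z, 0 ≤ f z) {α : ℝ} (hα : 0 ≤ α) (l : List (Torus d S))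
    (hl : ∀ ν ∈ l, ν ≠ 0 ∧ α ≤ c ν) (y : Torus d S) :
    α ^ l.length * f (y + l.sum) ≤ (jumpPart c ^ l.length) f y := by
  induction l generalizing y with
  | nil => simp
  | cons ν l ih =>
    have hν := hl ν (by simp)
    have h1 := ih (fun ν' hν' => hl ν' (by simp [hν'])) (y + ν)
    rw [List.length_cons, pow_succ' (jumpPart c), mul_apply_eq_comp, jumpPart_apply]
    refine le_trans ?_ (Finset.single_le_sum (f := fun ν : Jump d S =>
      c ν * (jumpPart c ^ l.length) f (y + ν)) (fun ν _ => mul_nonneg (hc ν ν.2)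
        (jumpPart_pow_nonneg hc hf _ _)) (Finset.mem_univ ⟨ν, hν.1⟩))
    rw [List.sum_cons, ← add_assoc, pow_succ', mul_assoc]
    exact mul_le_mul hν.2 h1 (mul_nonneg (pow_nonneg hα _) (hf _)) (hc ν hν.1)

/-- A leap realizes a given sequence of jumps of positive rates with a probability of the order
of the product of these rates. -/
lemma leap_lower_bound (y : Torus d S) {c : Torus d S → ℝ} (hc : ∀ ν ≠ 0, 0 ≤ c ν) {α : ℝ}
    (hα : 0 ≤ α) (l : List (Torus d S)) (hl : ∀ ν ∈ l, ν ≠ 0 ∧ α ≤ c ν) :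
    Real.exp (-∑ ν : Jump d S, c ν) * ((l.length.factorial : ℝ)⁻¹ * α ^ l.length) ≤
      (leap y c).real {y + l.sum} := by
  classical
  rw [leap_real_singleton y hc, exp_jumpOp, smul_apply, Pi.smul_apply, smul_eq_mul]
  refine mul_le_mul_of_nonneg_left ?_ (Real.exp_nonneg _)
  have hf : ∀ z, 0 ≤ (Pi.single (y + l.sum) (1 : ℝ) : Torus d S → ℝ) z := by
    intro z; rw [Pi.single_apply]; split_ifs <;> simp
  have h1 := pow_le_jumpPart_pow hc hf hα l hl y
  rw [Pi.single_eq_same, mul_one] at h1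
  refine le_trans (mul_le_mul_of_nonneg_left h1 (by positivity)) ?_
  exact le_hasSum (hasSum_exp_apply (jumpPart c) _ y) l.length fun n _ =>
    mul_nonneg (by positivity) (jumpPart_pow_nonneg hc hf n y)

lemma leap_pos (y : Torus d S) {c : Torus d S → ℝ} (hc : ∀ ν ≠ 0, 0 ≤ c ν)
    (l : List (Torus d S)) (hl : ∀ ν ∈ l, ν ≠ 0 ∧ 0 < c ν) :
    0 < (leap y c).real {y + l.sum} := by
  obtain ⟨α, hα, hle⟩ : ∃ α > 0, ∀ ν ∈ l, α ≤ c ν := by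
    clear y
    induction l with
    | nil => exact ⟨1, one_pos, by simp⟩
    | cons ν l ih =>
      obtain ⟨α, hα, hle⟩ := ih fun ν' hν' => hl ν' (by simp [hν'])
      refine ⟨min α (c ν), lt_min hα (hl ν (by simp)).2, fun ν' hν' => ?_⟩
      rcases List.mem_cons.1 hν' with rfl | hν'
      · exact min_le_right _ _
      · exact (min_le_left _ _).trans (hle ν' hν')
  exact lt_of_lt_of_le (by positivity)
    (leap_lower_bound y hc hα.le l fun ν hν => ⟨(hl ν hν).1, hle ν hν⟩)

/-! ### The backward equation of the forward process -/

lemma sum_jump_add (z : Torus d S) (g : Torus d S → ℝ) :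
    ∑ ν : Jump d S, g (z + ν) = ∑ x ∈ Finset.univ.erase z, g x := by
  classical
  refine Finset.sum_bij' (fun ν _ => z + (ν : Torus d S))
    (fun x hx => ⟨x - z, sub_ne_zero.2 (Finset.ne_of_mem_erase hx)⟩) ?_ ?_ ?_ ?_ ?_
  · intro ν _
    simpa using ν.2
  · intros; exact Finset.mem_univ _
  · intro ν _; simp
  · intro x _; simp
  · intros; rfl

lemma sum_jump_sub (z : Torus d S) (g : Torus d S → ℝ) :
    ∑ ν : Jump d S, g (z - ν) = ∑ x ∈ Finset.univ.erase z, g x := by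
  classical
  refine Finset.sum_bij' (fun ν _ => z - (ν : Torus d S))
    (fun x hx => ⟨z - x, sub_ne_zero.2 (Finset.ne_of_mem_erase hx).symm⟩) ?_ ?_ ?_ ?_ ?_
  · intro ν _
    simpa using ν.2
  · intros; exact Finset.mem_univ _
  · intro ν _; simp
  · intro x _; simp
  · intros; rfl

namespace ForwardProcess

variable {T : ℝ} (F : ForwardProcess d S T)

lemma law_nonneg {t : ℝ} (ht : t ∈ Set.Icc 0 T) (x : Torus d S) : 0 ≤ F.law t x :=
  (F.law_mem t ht).1 x

/-- No mass flows into a state of probability zero at a positive time: the probability of that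
state is minimal there, so its derivative is not positive. -/
lemma rate_mul_law_eq_zero {t : ℝ} (ht : t ∈ Set.Ioc 0 T) {y : Torus d S} (hy : F.law t y = 0)
    (x : Torus d S) : F.rate t y x * F.law t x = 0 := by
  classical
  have ht' : t ∈ Set.Icc 0 T := Set.Ioc_subset_Icc_self ht
  have hD := F.law_deriv t ht' y
  have hD' : HasDerivWithinAt (fun u => F.law u y) (∑ x, F.rate t y x * F.law t x)
      (Set.Ico 0 t) t := hD.mono fun u hu => ⟨hu.1, hu.2.le.trans ht.2⟩
  rw [hasDerivWithinAt_iff_tendsto_slope' (by simp)] at hD'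
  have hne : (nhdsWithin t (Set.Ico 0 t)).NeBot := by
    rw [← mem_closure_iff_nhdsWithin_neBot, closure_Ico ht.1.ne]
    exact Set.right_mem_Icc.2 ht.1.le
  have hle : ∑ x, F.rate t y x * F.law t x ≤ 0 := by
    refine le_of_tendsto hD' (eventually_nhdsWithin_of_forall fun u hu => ?_)
    rw [slope_def_field, hy, sub_zero]
    exact div_nonpos_of_nonneg_of_nonpos
      (F.law_nonneg ⟨hu.1, hu.2.le.trans ht.2⟩ y) (sub_nonpos.2 hu.2.le)
  have hnn : ∀ x ∈ Finset.univ, 0 ≤ F.rate t y x * F.law t x := by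
    intro x _
    by_cases hxy : x = y
    · simp [hxy, hy]
    · exact mul_nonneg (F.rate_nonneg t ht' x y hxy) (F.law_nonneg ht' x)
  exact (Finset.sum_eq_zero_iff_of_nonneg hnn).1 (le_antisymm hle (Finset.sum_nonneg hnn)) x
    (Finset.mem_univ x)

/-- The probability flux of the backward process along a jump is the flux of the forward process
along the reversed jump. At a state of probability zero, where the score is a division by zero, both
fluxes vanish. -/
lemma law_mul_intensity {s : ℝ} (hs : T - s ∈ Set.Ioc 0 T) (ν y : Torus d S) :
    F.law (T - s) y * F.intensity s ν y =
      F.rate (T - s) y (y + ν) * F.law (T - s) (y + ν) := by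
  by_cases hy : F.law (T - s) y = 0
  · rw [F.rate_mul_law_eq_zero hs hy, hy, zero_mul]
  · simp only [intensity, intensityOf, score]
    field_simp

/-- The time-reversed laws solve the forward equation of the backward process. -/
lemma hasDerivWithinAt_law_sub {s : ℝ} (hs : T - s ∈ Set.Ioc 0 T) (z : Torus d S) :
    HasDerivWithinAt (fun u => F.law (T - u) z)
      (forwardField (F.intensity s) (F.law (T - s)) z) (Set.Icc 0 T) s := by
  classical
  have h1 := (F.law_deriv (T - s) (Set.Ioc_subset_Icc_self hs) z).scomp s
    ((hasDerivWithinAt_id s (Set.Icc 0 T)).const_sub T)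
    (fun u hu => ⟨sub_nonneg.2 hu.2, sub_le_self T hu.1⟩)
  convert! h1 using 1
  set t := T - s
  have e1 : ∀ w, F.law t w * gen (F.intensity s) (Pi.single z 1) w =
      ∑ ν : Jump d S, F.rate t w (w + ν) * F.law t (w + ν) *
        ((Pi.single z (1 : ℝ) : Torus d S → ℝ) (w + ν) -
          (Pi.single z (1 : ℝ) : Torus d S → ℝ) w) := by
    intro w
    rw [gen, Finset.mul_sum]
    refine Finset.sum_congr rfl fun ν _ => ?_
    rw [← F.law_mul_intensity hs, mul_assoc]
  have e2 : ∀ ν : Jump d S, ∑ w, F.rate t w (w + ν) * F.law t (w + ν) *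
        ((Pi.single z (1 : ℝ) : Torus d S → ℝ) (w + ν) - (Pi.single z (1 : ℝ) : Torus d S → ℝ) w) =
      F.rate t (z - ν) z * F.law t z - F.rate t z (z + ν) * F.law t (z + ν) := by
    intro ν
    simp only [mul_sub, Finset.sum_sub_distrib, Pi.single_apply, mul_ite, mul_one, mul_zero]
    congr 1
    · rw [Finset.sum_eq_single (z - ν)]
      · simp
      · intro w _ hw
        rw [if_neg]
        rintro rfl
        simp at hw
      · simp
    · simp
  simp only [forwardField, e1]
  rw [Finset.sum_comm, Finset.sum_congr rfl fun ν _ => e2 ν, Finset.sum_sub_distrib,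
    sum_jump_sub z fun x => F.rate t x z * F.law t z,
    sum_jump_add z fun x => F.rate t z x * F.law t x]
  rw [← Finset.add_sum_erase Finset.univ (fun x => F.rate t z x * F.law t x) (Finset.mem_univ z),
    F.rate_diag t (Set.Ioc_subset_Icc_self hs) z, ← Finset.sum_mul]
  simp only [smul_eq_mul]
  ring

lemma law_pos_of_intensity_pos {s : ℝ} (hs : T - s ∈ Set.Icc 0 T) {ν y : Torus d S}
    (h : 0 < F.intensity s ν y) : 0 < F.law (T - s) y ∧ 0 < F.law (T - s) (y + ν) := by
  simp only [intensity, intensityOf, score] at h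
  constructor
  · refine (F.law_nonneg hs y).lt_of_ne fun h0 => ?_
    simp [← h0] at h
  · refine (F.law_nonneg hs _).lt_of_ne fun h0 => ?_
    simp [← h0] at h

lemma intensity_nonneg {s : ℝ} (hs : T - s ∈ Set.Icc 0 T) {ν : Torus d S} (hν : ν ≠ 0)
    (y : Torus d S) : 0 ≤ F.intensity s ν y :=
  mul_nonneg (div_nonneg (F.law_nonneg hs _) (F.law_nonneg hs _))
    (F.rate_nonneg _ hs _ _ (by simpa using hν))

end ForwardProcess

/-! ### Consequences of the regularity of the intensities -/

lemma C2Bounded.mono {M M' τ : ℝ} {f : ℝ → ℝ} (hf : C2Bounded M τ f) (h : M ≤ M') :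
    C2Bounded M' τ f :=
  ⟨hf.1, fun k hk s hs => (hf.2 k hk s hs).trans h⟩

lemma C2Bounded.zero {M τ : ℝ} (hM : 0 ≤ M) : C2Bounded M τ fun _ => 0 := by
  refine ⟨contDiffOn_const, fun k _ s _ => ?_⟩
  rw [iteratedDerivWithin_fun_const_zero]
  simpa using hM

namespace C2Bounded

variable {M τ : ℝ} {f : ℝ → ℝ}

lemma abs_le (hf : C2Bounded M τ f) {s : ℝ} (hs : s ∈ Set.Icc 0 τ) : |f s| ≤ M := by
  simpa using hf.2 0 (by norm_num) s hs

lemma abs_derivWithin_le (hf : C2Bounded M τ f) {s : ℝ} (hs : s ∈ Set.Icc 0 τ) :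
    |derivWithin f (Set.Icc 0 τ) s| ≤ M := by
  simpa [iteratedDerivWithin_one] using hf.2 1 (by norm_num) s hs

lemma hasDerivWithinAt (hf : C2Bounded M τ f) {s : ℝ} (hs : s ∈ Set.Icc 0 τ) :
    HasDerivWithinAt f (derivWithin f (Set.Icc 0 τ) s) (Set.Icc 0 τ) s :=
  ((hf.1.differentiableOn (by norm_num)) s hs).hasDerivWithinAt

lemma hasDerivWithinAt_derivWithin (hτ : 0 < τ) (hf : C2Bounded M τ f) {s : ℝ}
    (hs : s ∈ Set.Icc 0 τ) : HasDerivWithinAt (derivWithin f (Set.Icc 0 τ))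
      (iteratedDerivWithin 2 f (Set.Icc 0 τ) s) (Set.Icc 0 τ) s := by
  have h1 : DifferentiableOn ℝ (derivWithin f (Set.Icc 0 τ)) (Set.Icc 0 τ) :=
    (hf.1.derivWithin (m := 1) (uniqueDiffOn_Icc hτ) (by norm_num)).differentiableOn (by norm_num)
  have h2 := (h1 s hs).hasDerivWithinAt
  rwa [iteratedDerivWithin_succ, show iteratedDerivWithin 1 f (Set.Icc 0 τ) =
    derivWithin f (Set.Icc 0 τ) from by ext y; rw [iteratedDerivWithin_one]]

lemma abs_sub_le (hf : C2Bounded M τ f) {s t : ℝ} (hs : s ∈ Set.Icc 0 τ) (ht : t ∈ Set.Icc 0 τ) :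
    |f t - f s| ≤ M * |t - s| := by
  simpa using Convex.norm_image_sub_le_of_norm_hasDerivWithin_le
    (fun u hu => hf.hasDerivWithinAt hu) (fun u hu => hf.abs_derivWithin_le hu) (convex_Icc _ _)
    hs ht

lemma abs_sub_affine_le (hτ : 0 < τ) (hf : C2Bounded M τ f) {s x : ℝ} (hs : s ∈ Set.Icc 0 τ)
    (hx : 0 ≤ x) (hsx : s + x ∈ Set.Icc 0 τ) :
    |f (s + x) - f s - x * derivWithin f (Set.Icc 0 τ) s| ≤ M * x ^ 2 := by
  have hM : 0 ≤ M := (abs_nonneg _).trans (hf.abs_le hs)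
  have hmem : ∀ u ∈ Set.Icc 0 x, s + u ∈ Set.Icc 0 τ := fun u hu =>
    ⟨add_nonneg hs.1 hu.1, (add_le_add_right hu.2 s).trans hsx.2⟩
  have h1 := abs_sub_le_of_deriv_le_pow (h := x) (B := M)
    (g := fun u => f (s + u) - u * derivWithin f (Set.Icc 0 τ) s)
    (g' := fun u => derivWithin f (Set.Icc 0 τ) (s + u) - derivWithin f (Set.Icc 0 τ) s) 1 hM
    (fun u hu => by
      have d1 := (hf.hasDerivWithinAt (hmem u hu)).scomp u
        ((hasDerivWithinAt_id u (Set.Icc 0 x)).const_add s) (fun w hw => hmem w hw)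
      have d2 := (hasDerivWithinAt_id u (Set.Icc 0 x)).mul_const (derivWithin f (Set.Icc 0 τ) s)
      convert! d1.sub d2 using 1
      simp)
    (fun u hu => by
      have := Convex.norm_image_sub_le_of_norm_hasDerivWithin_le
        (fun u hu => hf.hasDerivWithinAt_derivWithin hτ hu)
        (fun u hu => hf.2 2 le_rfl u hu) (convex_Icc _ _) hs (hmem u hu)
      simpa [abs_of_nonneg hu.1] using this)
    (Set.right_mem_Icc.2 hx)
  convert! h1 using 2
  simp; ring

end C2Bounded

/-! ### One step of the sampler: domination of the exact transition -/

lemma alpha₁_pos {θ : ℝ} (hθ : θ ∈ Set.Ioo (0 : ℝ) 1) : 0 < alpha₁ θ := by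
  have h0 := hθ.1
  have h1 : 0 < 1 - θ := sub_pos.2 hθ.2
  unfold alpha₁
  positivity

lemma alpha₂_pos {θ : ℝ} (hθ : θ ∈ Set.Ioo (0 : ℝ) 1) : 0 < alpha₂ θ := by
  have h0 := hθ.1
  have h1 : 0 < 1 - θ := sub_pos.2 hθ.2
  unfold alpha₂
  positivity

lemma alpha₁_sub_alpha₂ {θ : ℝ} (hθ : θ ∈ Set.Ioo (0 : ℝ) 1) : alpha₁ θ - alpha₂ θ = 1 := by
  have h0 := hθ.1.ne'
  have h1 : 1 - θ ≠ 0 := (sub_pos.2 hθ.2).ne'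
  unfold alpha₁ alpha₂
  field_simp
  ring

/-- The situation in one step of length `h`: the true rates are `a x` at time `x ∈ [0, h]`, with
derivative `a'` at `0`; the estimated rates at the times `0` and `θ h` are `b₀` and `b₁`; `charged`
is the set of states of positive probability under the true law at time `0`, and `perm ν y` says
that the jump `ν` is permissible from `y`. The last field says that the extrapolated rates are
nonnegative on the range of the first stage. -/
structure StepData (θ m R h : ℝ) (a : ℝ → Torus d S → Torus d S → ℝ)
    (a' b₀ b₁ : Torus d S → Torus d S → ℝ) (charged : Torus d S → Prop)
    (perm : Torus d S → Torus d S → Prop) : Prop where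
  rate_bounds : RateBounds a a' h R
  rate_nonneg : ∀ x ∈ Set.Icc 0 h, ∀ ν ≠ 0, ∀ y, 0 ≤ a x ν y
  b₀_nonneg : ∀ ν ≠ 0, ∀ y, 0 ≤ b₀ ν y
  b₁_nonneg : ∀ ν ≠ 0, ∀ y, 0 ≤ b₁ ν y
  b₀_le : ∀ ν ≠ 0, ∀ y, charged y → b₀ ν y ≤ R
  b₁_le : ∀ ν ≠ 0, ∀ y, charged y → b₁ ν y ≤ R
  b_lipschitz : ∀ ν ≠ 0, ∀ y, charged y → |b₁ ν y - b₀ ν y| ≤ R * h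
  charged_add : ∀ ν ≠ 0, ∀ y, perm ν y → charged y ∧ charged (y + ν)
  le_b₀ : ∀ ν ≠ 0, ∀ y, perm ν y → m ≤ b₀ ν y
  rate_eq_zero : ∀ x ∈ Set.Icc 0 h, ∀ ν ≠ 0, ∀ y, ¬ perm ν y → a x ν y = 0
  extrapolated_nonneg : ∀ y, charged y → ∀ z, 0 < (leap y fun ν => b₀ ν y * (θ * h)).real {z} →
    ∀ ν ≠ 0, 0 ≤ alpha₁ θ * b₁ ν z - alpha₂ θ * b₀ ν y

/-- The transition probability from `y` to `z` of one step of the sampler. -/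
noncomputable def stepKernel (θ h : ℝ) (b₀ b₁ : Torus d S → Torus d S → ℝ) (y z : Torus d S) : ℝ :=
  ∑ w, (leap y fun ν => b₀ ν y * (θ * h)).real {w} *
    (leap w fun ν => max (alpha₁ θ * b₁ ν w - alpha₂ θ * b₀ ν y) 0 * ((1 - θ) * h)).real {z}

namespace StepData

variable {θ m R h : ℝ} {a : ℝ → Torus d S → Torus d S → ℝ}
  {a' b₀ b₁ : Torus d S → Torus d S → ℝ} {charged : Torus d S → Prop}
  {perm : Torus d S → Torus d S → Prop}

lemma leap_first_pos (D : StepData θ m R h a a' b₀ b₁ charged perm) (hθ : θ ∈ Set.Ioo (0 : ℝ) 1)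
    (hh : 0 < h) (y : Torus d S) (l : List (Torus d S)) (hl : ∀ ν ∈ l, ν ≠ 0 ∧ 0 < b₀ ν y) :
    0 < (leap y fun ν => b₀ ν y * (θ * h)).real {y + l.sum} :=
  leap_pos y (fun ν hν => mul_nonneg (D.b₀_nonneg ν hν y) (mul_pos hθ.1 hh).le) l
    fun ν hν => ⟨(hl ν hν).1, mul_pos (hl ν hν).2 (mul_pos hθ.1 hh)⟩

/-- If the jump `ν` is permissible from `y`, then a jump that is possible for the estimated rates
at `y + ν` is also possible at `y`, at a comparable rate. Nonnegativity of the extrapolation at `y`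
makes `ν` itself possible at `y + ν`; since the torus is finite, repeating `ν` leads back to `y`,
so nonnegativity of the extrapolation at `y + ν` can be used with `y` as the intermediate state. -/
lemma le_b₀_of_le_b₀_add (D : StepData θ m R h a a' b₀ b₁ charged perm)
    (hθ : θ ∈ Set.Ioo (0 : ℝ) 1) (hh : 0 < h) (hm : 0 < m) {c : ℝ}
    {c₁ : ℝ} (hc₁ : c₁ = alpha₂ θ / (2 * alpha₁ θ))
    (hhm : R * h ≤ c₁ * m) (hhc : R * h ≤ c₁ * c)
    {ν ν' y : Torus d S} (hν : ν ≠ 0) (hν' : ν' ≠ 0) (hp : perm ν y) (hb : c ≤ b₀ ν' (y + ν)) :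
    c₁ * c ≤ b₀ ν' y := by
  have hα₁ := alpha₁_pos hθ
  have hα₂ := alpha₂_pos hθ
  have hc₁0 : 0 < c₁ := by rw [hc₁]; positivity
  have hα : alpha₂ θ = 2 * c₁ * alpha₁ θ := by rw [hc₁]; field_simp
  -- the factor `1 / 2` in `c₁` makes up for the change of `b` between the times `0` and `θ h`
  have transfer : ∀ {y₁ z ν₁ : Torus d S} {e : ℝ}, charged y₁ → charged z → ν₁ ≠ 0 →
      0 < (leap y₁ fun ν => b₀ ν y₁ * (θ * h)).real {z} → e ≤ b₀ ν₁ y₁ → R * h ≤ c₁ * e →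
      c₁ * e ≤ b₀ ν₁ z := by
    intro y₁ z ν₁ e h1 h2 h3 h4 h5 h6
    have h7 := D.extrapolated_nonneg y₁ h1 z h4 ν₁ h3
    have h8 := (abs_le.1 (D.b_lipschitz ν₁ h3 z h2)).2
    have h9 : 2 * c₁ * e ≤ b₁ ν₁ z := by
      rw [hα] at h7
      have : 0 ≤ alpha₁ θ * (b₁ ν₁ z - 2 * c₁ * b₀ ν₁ y₁) := by linarith
      have := nonneg_of_mul_nonneg_right this hα₁
      nlinarith [mul_le_mul_of_nonneg_left h5 hc₁0.le]
    linarith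
  obtain ⟨hy, hyν⟩ := D.charged_add ν hν y hp
  have hactive : c₁ * m ≤ b₀ ν (y + ν) := by
    refine transfer hy hyν hν ?_ (D.le_b₀ ν hν y hp) hhm
    have := D.leap_first_pos hθ hh y [ν] (by simpa using ⟨hν, hm.trans_le (D.le_b₀ ν hν y hp)⟩)
    simpa using this
  refine transfer hyν hy hν' ?_ hb hhc
  have h1 := D.leap_first_pos hθ hh (y + ν) (List.replicate (S - 1) ν) fun ν₁ h₁ => by
    rw [List.eq_of_mem_replicate h₁]
    exact ⟨hν, (mul_pos hc₁0 hm).trans_le hactive⟩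
  have h2 : y + ν + (List.replicate (S - 1) ν).sum = y := by
    rw [List.sum_replicate, add_assoc, ← succ_nsmul', Nat.sub_add_cancel (NeZero.one_le (n := S))]
    ext i
    simp
  rwa [h2] at h1

/-- All jumps of a permissible path are possible for the estimated rates at its starting point. -/
lemma le_b₀_of_isJumpPath (D : StepData θ m R h a a' b₀ b₁ charged perm)
    (hθ : θ ∈ Set.Ioo (0 : ℝ) 1) (hh : 0 < h) (hm : 0 < m)
    {c₁ : ℝ} (hc₁ : c₁ = alpha₂ θ / (2 * alpha₁ θ)) (l : List (Torus d S)) {y : Torus d S}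
    (hl : IsJumpPath perm y l) (hhm : R * h ≤ c₁ ^ (l.length + 1) * m) :
    ∀ ν ∈ l, ν ≠ 0 ∧ c₁ ^ l.length * m ≤ b₀ ν y := by
  have hα₁ := alpha₁_pos hθ
  have hα₂ := alpha₂_pos hθ
  have hα := alpha₁_sub_alpha₂ hθ
  have hc₁0 : 0 < c₁ := by rw [hc₁]; positivity
  have hc₁1 : c₁ ≤ 1 := by rw [hc₁, div_le_one (by positivity)]; linarith
  induction l generalizing y with
  | nil => simp
  | cons ν l ih =>
    obtain ⟨hν, hp, hl⟩ := hl
    have e1 : c₁ ^ (l.length + 1 + 1) * m ≤ c₁ ^ (l.length + 1) * m :=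
      mul_le_mul_of_nonneg_right (pow_le_pow_of_le_one hc₁0.le hc₁1 (by omega)) hm.le
    have hhm' : R * h ≤ c₁ ^ (l.length + 1) * m := hhm.trans e1
    intro ν' hν'
    rw [List.length_cons]
    rcases List.mem_cons.1 hν' with rfl | hν'
    · exact ⟨hν, le_trans (mul_le_of_le_one_left hm.le (pow_le_one₀ hc₁0.le hc₁1))
        (D.le_b₀ _ hν y hp)⟩
    · obtain ⟨h1, h2⟩ := ih hl hhm' ν' hν'
      refine ⟨h1, ?_⟩
      rw [pow_succ', mul_assoc]
      refine D.le_b₀_of_le_b₀_add hθ hh hm hc₁ ?_ ?_ hν h1 hp h2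
      · refine hhm'.trans (mul_le_mul_of_nonneg_right ?_ hm.le)
        exact pow_le_of_le_one hc₁0.le hc₁1 (by omega)
      · rwa [← mul_assoc, ← pow_succ']

lemma charged_of_isJumpPath (D : StepData θ m R h a a' b₀ b₁ charged perm) {y : Torus d S}
    (hy : charged y) (l : List (Torus d S)) (hl : IsJumpPath perm y l) : charged (y + l.sum) := by
  induction l generalizing y with
  | nil => simpa using hy
  | cons ν l ih =>
    obtain ⟨hν, hp, hl⟩ := hl
    rw [List.sum_cons, ← add_assoc]
    exact ih (D.charged_add ν hν y hp).2 hl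

/-- The exact transition probabilities are dominated by those of the sampler. Both are of the
order `h ^ k` at a state whose distance from the starting point in permissible jumps is `k`. -/
lemma exists_flow_le_mul_stepKernel (d S : ℕ) [NeZero S] {θ m R : ℝ} (hθ : θ ∈ Set.Ioo (0 : ℝ) 1)
    (hm : 0 < m) (hR : 0 ≤ R) :
    ∃ C κ₀ : ℝ, 0 ≤ C ∧ 0 < κ₀ ∧ ∀ {h : ℝ} {a : ℝ → Torus d S → Torus d S → ℝ}
      {a' b₀ b₁ : Torus d S → Torus d S → ℝ} {charged : Torus d S → Prop}
      {perm : Torus d S → Torus d S → Prop}, StepData θ m R h a a' b₀ b₁ charged perm →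
      0 < h → h ≤ κ₀ → ∀ {y : Torus d S} {v : ℝ → Torus d S → ℝ}, IsFlow a h y v → charged y →
      ∀ z, v h z ≤ C * stepKernel θ h b₀ b₁ y z := by
  have hθ0 := hθ.1
  have hθ1 : 0 < 1 - θ := sub_pos.2 hθ.2
  have hα₁ := alpha₁_pos hθ
  have hα₂ := alpha₂_pos hθ
  have hα := alpha₁_sub_alpha₂ hθ
  set c₁ : ℝ := alpha₂ θ / (2 * alpha₁ θ) with hc₁
  have hc₁0 : 0 < c₁ := by rw [hc₁]; positivity
  have hc₁1 : c₁ ≤ 1 := by rw [hc₁, div_le_one (by positivity)]; linarith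
  set N := Fintype.card (Torus d S) with hN
  set B := fieldBound d S R with hB
  have hB0 : 0 ≤ B := by rw [hB]; unfold fieldBound; positivity
  set J : ℝ := ((Fintype.card (Jump d S) : ℕ) : ℝ) with hJ
  have hJ0 : 0 ≤ J := by positivity
  -- all jumps of a shortest path have estimated rate at least `c₁ ^ N m` at the starting point
  set β : ℝ := θ * (c₁ ^ N * m) with hβ
  have hβ0 : 0 < β := by positivity
  -- a lower bound for the probability that no further jumps occur in the two stages
  set E : ℝ := Real.exp (-(J * R)) * Real.exp (-(J * (alpha₁ θ * R))) with hE
  have hE0 : 0 < E := by positivity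
  -- for `h ≤ κ₀`, unreachable states are not charged by the exact transition (`B h < 1`), and the
  -- jumps of a shortest path stay possible along it (`R h ≤ c₁ ^ (N + 1) m`)
  set κ₀ : ℝ := min 1 (min (1 / (B + 1)) (c₁ ^ (N + 1) * m / (R + 1))) with hκ₀
  refine ⟨E⁻¹ * N.factorial * (max 1 (B / β)) ^ N, κ₀, by positivity, by positivity, ?_⟩
  intro h a a' b₀ b₁ charged perm D hh hhκ y v hv hy z
  have hh1 : h ≤ 1 := hhκ.trans (min_le_left _ _)
  have hh2 : B * h < 1 := by
    have : h ≤ 1 / (B + 1) := hhκ.trans ((min_le_right _ _).trans (min_le_left _ _))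
    rw [le_div_iff₀ (by positivity)] at this
    nlinarith
  have hh3 : R * h ≤ c₁ ^ (N + 1) * m := by
    have : h ≤ c₁ ^ (N + 1) * m / (R + 1) := hhκ.trans ((min_le_right _ _).trans (min_le_right _ _))
    rw [le_div_iff₀ (by positivity)] at this
    nlinarith
  have hhmem : h ∈ Set.Icc 0 h := Set.right_mem_Icc.2 hh.le
  have hK0 : ∀ w, 0 ≤ (leap y fun ν => b₀ ν y * (θ * h)).real {w} *
    (leap w fun ν => max (alpha₁ θ * b₁ ν w - alpha₂ θ * b₀ ν y) 0 * ((1 - θ) * h)).real {z} :=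
    fun w => mul_nonneg measureReal_nonneg measureReal_nonneg
  by_cases hreach : ∃ l, IsJumpPath perm y l ∧ y + l.sum = z
  · obtain ⟨l, hl, hlz, hlen, hmin⟩ := exists_short_isJumpPath hreach
    have hupper := hv.le_pow hR D.rate_bounds.bound D.rate_eq_zero l.length z hmin hhmem
    have hpowN : c₁ ^ (N + 1) * m ≤ c₁ ^ (l.length + 1) * m :=
      mul_le_mul_of_nonneg_right (pow_le_pow_of_le_one hc₁0.le hc₁1 (by omega)) hm.le
    have hactive := D.le_b₀_of_isJumpPath hθ hh hm hc₁ l hl (hh3.trans hpowN)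
    have hz : charged z := hlz ▸ D.charged_of_isJumpPath hy l hl
    -- the first stage makes all jumps of the shortest path, the second stage makes none
    have hfirst := leap_lower_bound y (c := fun ν => b₀ ν y * (θ * h))
      (fun ν hν => mul_nonneg (D.b₀_nonneg ν hν y) (by positivity)) (α := β * h)
      (by positivity) l (fun ν hν => ⟨(hactive ν hν).1, by
        have h1 : c₁ ^ N * m ≤ b₀ ν y := le_trans (mul_le_mul_of_nonneg_right
          (pow_le_pow_of_le_one hc₁0.le hc₁1 hlen) hm.le) (hactive ν hν).2
        calc β * h = c₁ ^ N * m * (θ * h) := by rw [hβ]; ring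
          _ ≤ b₀ ν y * (θ * h) := by gcongr⟩)
    have hsecond := leap_lower_bound z
      (c := fun ν => max (alpha₁ θ * b₁ ν z - alpha₂ θ * b₀ ν y) 0 * ((1 - θ) * h))
      (fun ν hν => mul_nonneg (le_max_right _ _) (by positivity)) (α := 0) le_rfl [] (by simp)
    rw [hlz] at hfirst
    simp only [List.sum_nil, add_zero, List.length_nil, Nat.factorial_zero, Nat.cast_one, inv_one,
      pow_zero, mul_one] at hsecond
    have hs1 : ∑ ν : Jump d S, b₀ ν y * (θ * h) ≤ J * R := by
      rw [hJ, ← nsmul_eq_mul, ← Finset.card_univ, ← Finset.sum_const]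
      refine Finset.sum_le_sum fun ν _ => ?_
      have h1 : θ * h ≤ 1 := mul_le_one₀ hθ.2.le hh.le hh1
      exact (mul_le_of_le_one_right (D.b₀_nonneg ν ν.2 y) h1).trans (D.b₀_le ν ν.2 y hy)
    have hs2 : ∑ ν : Jump d S, max (alpha₁ θ * b₁ ν z - alpha₂ θ * b₀ ν y) 0 * ((1 - θ) * h) ≤
        J * (alpha₁ θ * R) := by
      rw [hJ, ← nsmul_eq_mul, ← Finset.card_univ, ← Finset.sum_const]
      refine Finset.sum_le_sum fun ν _ => ?_
      have h1 : (1 - θ) * h ≤ 1 := mul_le_one₀ (by linarith) hh.le hh1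
      refine (mul_le_of_le_one_right (le_max_right _ _) h1).trans (max_le ?_ (by positivity))
      have h2 := mul_le_mul_of_nonneg_left (D.b₁_le ν ν.2 z hz) hα₁.le
      have h3 := mul_nonneg hα₂.le (D.b₀_nonneg ν ν.2 y)
      linarith
    have hlower : E * ((N.factorial : ℝ)⁻¹ * (β * h) ^ l.length) ≤ stepKernel θ h b₀ b₁ y z := by
      refine le_trans ?_ (Finset.single_le_sum (fun w _ => hK0 w) (Finset.mem_univ z))
      have e1 : E * ((N.factorial : ℝ)⁻¹ * (β * h) ^ l.length) =
          Real.exp (-(J * R)) * ((N.factorial : ℝ)⁻¹ * (β * h) ^ l.length) *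
            Real.exp (-(J * (alpha₁ θ * R))) := by rw [hE]; ring
      rw [e1]
      refine mul_le_mul (le_trans ?_ hfirst) (le_trans ?_ hsecond) (Real.exp_nonneg _)
        measureReal_nonneg
      · gcongr
      · gcongr
    calc v h z ≤ (B * h) ^ l.length := hupper
      _ = (B / β) ^ l.length * (β * h) ^ l.length := by
          rw [← mul_pow]; congr 1; field_simp
      _ ≤ (max 1 (B / β)) ^ N * (β * h) ^ l.length := by
          refine mul_le_mul_of_nonneg_right ?_ (by positivity)
          refine (pow_le_pow_left₀ (by positivity) (le_max_right 1 _) _).trans ?_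
          exact pow_le_pow_right₀ (le_max_left _ _) hlen
      _ = E⁻¹ * N.factorial * (max 1 (B / β)) ^ N *
            (E * ((N.factorial : ℝ)⁻¹ * (β * h) ^ l.length)) := by
          have : (N.factorial : ℝ) ≠ 0 := by positivity
          field_simp
      _ ≤ _ := mul_le_mul_of_nonneg_left hlower (by positivity)
  · rw [hv.eq_zero_of_unreachable hR D.rate_bounds.bound D.rate_eq_zero hreach hhmem hh2]
    exact mul_nonneg (by positivity) (Finset.sum_nonneg fun w _ => hK0 w)

end StepData

/-! ### One step of the sampler: third-order local error -/

/-- The mean of `f` under the law of a leap. -/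
noncomputable def leapMean (y : Torus d S) (c f : Torus d S → ℝ) : ℝ :=
  ∑ z, (leap y c).real {z} * f z

lemma abs_leapMean_le (y : Torus d S) (c : Torus d S → ℝ) {f : Torus d S → ℝ} {F : ℝ}
    (hf : ∀ z, |f z| ≤ F) : |leapMean y c f| ≤ F := by
  calc |leapMean y c f| ≤ ∑ z, |(leap y c).real {z} * f z| := Finset.abs_sum_le_sum_abs _ _
    _ ≤ ∑ z, (leap y c).real {z} * F := by
        refine Finset.sum_le_sum fun z _ => ?_
        rw [abs_mul, abs_of_nonneg measureReal_nonneg]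
        exact mul_le_mul_of_nonneg_left (hf z) measureReal_nonneg
    _ = F := by rw [← Finset.sum_mul, sum_measureReal_singleton]; simp

section Expansion

variable {c : Torus d S → ℝ} {ρ P F x : ℝ} {f : Torus d S → ℝ}

/-- Rates that are constant in time and space trivially satisfy the bounds required of the exact
rates, so the expansions of jump processes apply to leaps. -/
lemma rateBounds_const (hρ : 0 ≤ ρ) (hc : ∀ ν ≠ 0, |c ν| ≤ ρ) (h : ℝ) :
    RateBounds (fun _ ν (_ : Torus d S) => c ν) (fun _ _ => 0) h ρ where
  nonneg := hρ
  bound := fun _ _ ν hν _ => hc ν hν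
  lipschitz := fun x hx _ _ _ => by simpa using mul_nonneg hρ hx.1
  deriv_bound := fun _ _ _ => by simpa using hρ
  affine := fun x _ _ _ _ => by simpa using mul_nonneg hρ (sq_nonneg x)

variable (y : Torus d S) (hρ : 0 ≤ ρ) (hc0 : ∀ ν ≠ 0, 0 ≤ c ν) (hc : ∀ ν ≠ 0, c ν ≤ ρ)
  (hP : 2 * Fintype.card (Jump d S) * ρ ≤ P) (hP1 : 1 ≤ P) (hf : ∀ z, |f z| ≤ F) (hx : 0 ≤ x)

include hρ hc0 hc hP hf hx

lemma abs_leapMean_sub_le : |leapMean y (fun ν => x * c ν) f - f y| ≤ P * F * x := by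
  have hF : 0 ≤ F := (abs_nonneg _).trans (hf 0)
  have h := (isFlow_leap y hc0 x).abs_sum_sub_le (rateBounds_const hρ
    (fun ν hν => (abs_of_nonneg (hc0 ν hν)).trans_le (hc ν hν)) x) hf ⟨hx, le_rfl⟩
  refine h.trans ?_
  gcongr

include hP1

lemma abs_leapMean_sub_first_order_le :
    |leapMean y (fun ν => x * c ν) f - f y - x * gen (fun ν _ => c ν) f y| ≤
      2 * P ^ 2 * F * x ^ 2 := by
  have hF : 0 ≤ F := (abs_nonneg _).trans (hf 0)
  have h := (isFlow_leap y hc0 x).abs_sum_sub_first_order_le (rateBounds_const hρ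
    (fun ν hν => (abs_of_nonneg (hc0 ν hν)).trans_le (hc ν hν)) x) hf ⟨hx, le_rfl⟩
  refine h.trans ?_
  set Λ := 2 * Fintype.card (Jump d S) * ρ
  have hΛ : 0 ≤ Λ := by positivity
  gcongr
  nlinarith [pow_le_pow_left₀ hΛ hP 2]

lemma abs_leapMean_sub_second_order_le :
    |leapMean y (fun ν => x * c ν) f - f y - x * gen (fun ν _ => c ν) f y
        - x ^ 2 / 2 * gen (fun ν _ => c ν) (gen (fun ν _ => c ν) f) y| ≤
      4 * P ^ 3 * F * x ^ 3 := by
  have hF : 0 ≤ F := (abs_nonneg _).trans (hf 0)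
  have h := (isFlow_leap y hc0 x).abs_sum_sub_second_order_le (rateBounds_const hρ
    (fun ν hν => (abs_of_nonneg (hc0 ν hν)).trans_le (hc ν hν)) x) hf ⟨hx, le_rfl⟩
  have e : gen (fun _ (_ : Torus d S) => (0 : ℝ)) f y = 0 := by simp [gen]
  rw [e, add_zero] at h
  refine h.trans ?_
  set Λ := 2 * Fintype.card (Jump d S) * ρ
  have hΛ : 0 ≤ Λ := by positivity
  gcongr
  have h2 := pow_le_pow_left₀ hΛ hP 2
  have h3 := pow_le_pow_left₀ hΛ hP 3
  nlinarith [mul_nonneg (sq_nonneg P) (sub_nonneg.2 hP1)]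

end Expansion

lemma abs_gen_le_sum (a : Torus d S → Torus d S → ℝ) (u : Torus d S → ℝ) (y : Torus d S) :
    |gen a u y| ≤ ∑ ν : Jump d S, |a ν y| * (|u (y + ν)| + |u y|) := by
  refine (Finset.abs_sum_le_sum_abs _ _).trans (Finset.sum_le_sum fun ν _ => ?_)
  rw [abs_mul]
  exact mul_le_mul_of_nonneg_left (abs_sub _ _) (abs_nonneg _)

/-- The `ℓ¹` distance of two families of jump rates. -/
def rateDist (c c' : Torus d S → ℝ) : ℝ := ∑ ν : Jump d S, |c ν - c' ν|

lemma rateDist_nonneg (c c' : Torus d S → ℝ) : 0 ≤ rateDist c c' :=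
  Finset.sum_nonneg fun _ _ => abs_nonneg _

lemma abs_gen_sub_gen_le (a b : Torus d S → Torus d S → ℝ) {f : Torus d S → ℝ} {F : ℝ}
    (hf : ∀ z, |f z| ≤ F) (y : Torus d S) :
    |gen a f y - gen b f y| ≤ 2 * F * rateDist (fun ν => a ν y) (fun ν => b ν y) := by
  rw [← IsFlow.gen_rate_sub, rateDist, Finset.mul_sum]
  refine (abs_gen_le_sum _ _ _).trans (Finset.sum_le_sum fun ν _ => ?_)
  rw [mul_comm]
  exact mul_le_mul_of_nonneg_right (by linarith [hf (y + ν), hf y]) (abs_nonneg _)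

lemma abs_gen_gen_sub_le {c c' f : Torus d S → ℝ} {ρ P F : ℝ} (hρ : 0 ≤ ρ)
    (hc : ∀ ν ≠ 0, |c ν| ≤ ρ) (hc' : ∀ ν ≠ 0, |c' ν| ≤ ρ)
    (hP : 2 * Fintype.card (Jump d S) * ρ ≤ P) (hf : ∀ z, |f z| ≤ F) (y : Torus d S) :
    |gen (fun ν _ => c ν) (gen (fun ν _ => c ν) f) y
      - gen (fun ν _ => c' ν) (gen (fun ν _ => c' ν) f) y| ≤ 4 * P * F * rateDist c c' := by
  have hF : 0 ≤ F := (abs_nonneg _).trans (hf 0)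
  have hE := rateDist_nonneg c c'
  have h1 : |gen (fun ν _ => c ν) (fun z => gen (fun ν _ => c ν) f z - gen (fun ν _ => c' ν) f z) y|
      ≤ P * (2 * F * rateDist c c') := by
    refine (abs_gen_le hρ y (fun ν hν => hc ν hν)
      (fun z => abs_gen_sub_gen_le (fun ν _ => c ν) (fun ν _ => c' ν) hf z)).trans ?_
    gcongr
  have h2 := abs_gen_sub_gen_le (fun ν _ => c ν) (fun ν _ => c' ν) (F := P * F)
    (f := gen (fun ν _ => c' ν) f) (fun z => (abs_gen_le hρ z (fun ν hν => hc' ν hν) hf).trans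
      (by gcongr)) y
  rw [gen_sub] at h1
  have e : gen (fun ν _ => c ν) (gen (fun ν _ => c ν) f) y
      - gen (fun ν _ => c' ν) (gen (fun ν _ => c' ν) f) y =
      (gen (fun ν _ => c ν) (gen (fun ν _ => c ν) f) y
        - gen (fun ν _ => c ν) (gen (fun ν _ => c' ν) f) y) +
      (gen (fun ν _ => c ν) (gen (fun ν _ => c' ν) f) y
        - gen (fun ν _ => c' ν) (gen (fun ν _ => c' ν) f) y) := by ring
  rw [e]
  refine (abs_add_le _ _).trans ((add_le_add h1 h2).trans (le_of_eq ?_))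
  ring

/-- The mean of `f` after the second stage, from the intermediate state `w`, when the step was
started from `y`. -/
noncomputable def secondMean (θ h : ℝ) (b₀ b₁ : Torus d S → Torus d S → ℝ) (f : Torus d S → ℝ)
    (y w : Torus d S) : ℝ :=
  leapMean w (fun ν => max (alpha₁ θ * b₁ ν w - alpha₂ θ * b₀ ν y) 0 * ((1 - θ) * h)) f

namespace StepData

variable {θ m R h : ℝ} {a : ℝ → Torus d S → Torus d S → ℝ}
  {a' b₀ b₁ : Torus d S → Torus d S → ℝ} {charged : Torus d S → Prop}
  {perm : Torus d S → Torus d S → Prop} {P : ℝ} {f : Torus d S → ℝ}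

lemma extrapolated_le (D : StepData θ m R h a a' b₀ b₁ charged perm) (hθ : θ ∈ Set.Ioo (0 : ℝ) 1)
    (y : Torus d S) {w ν : Torus d S} (hw : charged w) (hν : ν ≠ 0) :
    alpha₁ θ * b₁ ν w - alpha₂ θ * b₀ ν y ≤ alpha₁ θ * R := by
  have h2 := mul_le_mul_of_nonneg_left (D.b₁_le ν hν w hw) (alpha₁_pos hθ).le
  have h3 := mul_nonneg (alpha₂_pos hθ).le (D.b₀_nonneg ν hν y)
  linarith

/-- The zeroth-order expansion of the second stage. -/
lemma abs_secondMean_sub_le (D : StepData θ m R h a a' b₀ b₁ charged perm)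
    (hθ : θ ∈ Set.Ioo (0 : ℝ) 1) (hh : 0 ≤ h)
    (hP : 2 * Fintype.card (Jump d S) * (alpha₁ θ * R) ≤ P) (hf : ∀ z, |f z| ≤ 1)
    (y : Torus d S) {w : Torus d S} (hw : charged w) :
    |secondMean θ h b₀ b₁ f y w - f w| ≤ P * h := by
  have hα := (alpha₁_pos hθ).le
  have hR := D.rate_bounds.nonneg
  have hP0 : 0 ≤ P := le_trans (by positivity) hP
  have h1 : 0 < 1 - θ := sub_pos.2 hθ.2
  have := abs_leapMean_sub_le w (x := (1 - θ) * h)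
    (c := fun ν => max (alpha₁ θ * b₁ ν w - alpha₂ θ * b₀ ν y) 0) (ρ := alpha₁ θ * R)
    (by positivity) (fun ν _ => le_max_right _ _)
    (fun ν hν => max_le (D.extrapolated_le hθ y hw hν) (by positivity)) hP hf (by positivity)
  simp only [mul_comm ((1 - θ) * h)] at this
  refine this.trans ?_
  rw [mul_one]
  have : h * (1 - θ) ≤ h := mul_le_of_le_one_right hh (by linarith [hθ.1])
  nlinarith

/-- On the range of the first stage, where the extrapolated rates are nonnegative, these differ
from the true ones by the estimation errors. -/
lemma rateDist_extrapolated_le (hθ : θ ∈ Set.Ioo (0 : ℝ) 1)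
    (D : StepData θ m R h a a' b₀ b₁ charged perm) (hP : alpha₁ θ ≤ P)
    {y w : Torus d S} (hy : charged y)
    (hw : 0 < (leap y fun ν => b₀ ν y * (θ * h)).real {w}) :
    rateDist (fun ν => max (alpha₁ θ * b₁ ν w - alpha₂ θ * b₀ ν y) 0)
      (fun ν => alpha₁ θ * a (θ * h) ν w - alpha₂ θ * a 0 ν y) ≤
      P * (rateDist (fun ν => a (θ * h) ν w) (fun ν => b₁ ν w) +
        rateDist (fun ν => a 0 ν y) (fun ν => b₀ ν y)) := by
  have hα := alpha₁_sub_alpha₂ hθ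
  have hα₁ := alpha₁_pos hθ
  have hα₂ := alpha₂_pos hθ
  simp only [rateDist, ← Finset.sum_add_distrib, Finset.mul_sum]
  refine Finset.sum_le_sum fun ν _ => ?_
  rw [max_eq_left (D.extrapolated_nonneg y hy w hw ν ν.2)]
  have e : alpha₁ θ * b₁ ν w - alpha₂ θ * b₀ ν y - (alpha₁ θ * a (θ * h) ν w - alpha₂ θ * a 0 ν y)
      = -(alpha₁ θ * (a (θ * h) ν w - b₁ ν w)) + alpha₂ θ * (a 0 ν y - b₀ ν y) := by ring
  rw [e]
  refine (abs_add_le _ _).trans ?_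
  rw [abs_neg, abs_mul, abs_mul, abs_of_pos hα₁, abs_of_pos hα₂, mul_add]
  gcongr
  linarith

/-- The first-order expansion of the second stage, in terms of the true rates. -/
lemma abs_secondMean_sub_first_order_le (D : StepData θ m R h a a' b₀ b₁ charged perm)
    (hθ : θ ∈ Set.Ioo (0 : ℝ) 1) (hh : 0 ≤ h)
    (hP : 2 * Fintype.card (Jump d S) * (alpha₁ θ * R) ≤ P) (hP1 : 1 ≤ P) (hPα : alpha₁ θ ≤ P)
    (hf : ∀ z, |f z| ≤ 1) {y w : Torus d S} (hy : charged y) (hw : charged w)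
    (hyw : 0 < (leap y fun ν => b₀ ν y * (θ * h)).real {w}) :
    |secondMean θ h b₀ b₁ f y w - (f w + (1 - θ) * h *
        (alpha₁ θ * gen (a (θ * h)) f w - alpha₂ θ * gen (fun ν _ => a 0 ν y) f w))| ≤
      2 * P ^ 2 * h ^ 2 + 2 * P * h * (rateDist (fun ν => a (θ * h) ν w) (fun ν => b₁ ν w) +
        rateDist (fun ν => a 0 ν y) (fun ν => b₀ ν y)) := by
  have hα := (alpha₁_pos hθ).le
  have hR := D.rate_bounds.nonneg
  have h1 : 0 < 1 - θ := sub_pos.2 hθ.2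
  set k := (1 - θ) * h with hk
  have hk0 : 0 ≤ k := by positivity
  have hkh : k ≤ h := mul_le_of_le_one_left hh (by linarith [hθ.1])
  set c : Torus d S → ℝ := fun ν => max (alpha₁ θ * b₁ ν w - alpha₂ θ * b₀ ν y) 0 with hc
  have hexp := abs_leapMean_sub_first_order_le w (x := k) (c := c) (ρ := alpha₁ θ * R)
    (by positivity) (fun ν _ => le_max_right _ _)
    (fun ν hν => max_le (D.extrapolated_le hθ y hw hν) (by positivity)) hP hP1 hf hk0
  simp only [mul_comm k (c _)] at hexp
  have hdist := D.rateDist_extrapolated_le hθ hPα hy hyw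
  set e := rateDist (fun ν => a (θ * h) ν w) (fun ν => b₁ ν w) +
        rateDist (fun ν => a 0 ν y) (fun ν => b₀ ν y) with he
  have he0 : 0 ≤ e := add_nonneg (rateDist_nonneg _ _) (rateDist_nonneg _ _)
  have hgen := abs_gen_sub_gen_le (fun ν _ => c ν)
    (fun ν w => alpha₁ θ * a (θ * h) ν w - alpha₂ θ * a 0 ν y) hf w
  rw [IsFlow.gen_rate_sub (fun ν w => alpha₁ θ * a (θ * h) ν w) (fun ν _ => alpha₂ θ * a 0 ν y),
    IsFlow.gen_rate_const_mul, IsFlow.gen_rate_const_mul (alpha₂ θ) (fun ν _ => a 0 ν y)] at hgen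
  set H := alpha₁ θ * gen (a (θ * h)) f w - alpha₂ θ * gen (fun ν _ => a 0 ν y) f w
  have hgen' : |k * (gen (fun ν _ => c ν) f w - H)| ≤ h * (2 * (P * e)) := by
    rw [abs_mul, abs_of_nonneg hk0]
    refine mul_le_mul hkh (hgen.trans ?_) (abs_nonneg _) hh
    rw [mul_one]
    gcongr
  change |secondMean θ h b₀ b₁ f y w - f w - k * gen (fun ν _ => c ν) f w| ≤ _ at hexp
  have hk2 : 2 * P ^ 2 * 1 * k ^ 2 ≤ 2 * P ^ 2 * h ^ 2 := by
    rw [mul_one]; gcongr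
  calc |secondMean θ h b₀ b₁ f y w - (f w + k * H)|
      = |(secondMean θ h b₀ b₁ f y w - f w - k * gen (fun ν _ => c ν) f w)
          + k * (gen (fun ν _ => c ν) f w - H)| := by congr 1; ring
    _ ≤ _ := (abs_add_le _ _).trans (add_le_add (hexp.trans hk2) hgen')
    _ = _ := by ring

/-- The second-order expansion of the second stage when the first stage makes no jump, in terms of
the true rates. -/
lemma abs_secondMean_sub_second_order_le (D : StepData θ m R h a a' b₀ b₁ charged perm)
    (hθ : θ ∈ Set.Ioo (0 : ℝ) 1) (hh : 0 < h) (hh1 : h ≤ 1)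
    (hP : 2 * Fintype.card (Jump d S) * (alpha₁ θ * R) ≤ P) (hP1 : 1 ≤ P) (hPα : alpha₁ θ ≤ P)
    (hf : ∀ z, |f z| ≤ 1) {y : Torus d S} (hy : charged y) :
    |secondMean θ h b₀ b₁ f y y - (f y + (1 - θ) * h *
        (alpha₁ θ * gen (a (θ * h)) f y - alpha₂ θ * gen (a 0) f y)
        + ((1 - θ) * h) ^ 2 / 2 * gen (fun ν _ => a 0 ν y) (gen (fun ν _ => a 0 ν y) f) y)| ≤
      6 * P ^ 3 * h ^ 3 + 4 * P ^ 2 * h * (rateDist (fun ν => a (θ * h) ν y) (fun ν => b₁ ν y) +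
        rateDist (fun ν => a 0 ν y) (fun ν => b₀ ν y)) := by
  have hα := (alpha₁_pos hθ).le
  have hα₂ := (alpha₂_pos hθ).le
  have hα' := alpha₁_sub_alpha₂ hθ
  have hR := D.rate_bounds.nonneg
  have h1 : 0 < 1 - θ := sub_pos.2 hθ.2
  have h0mem : (0 : ℝ) ∈ Set.Icc 0 h := ⟨le_rfl, hh.le⟩
  have hθmem : θ * h ∈ Set.Icc 0 h :=
    ⟨(mul_pos hθ.1 hh).le, mul_le_of_le_one_left hh.le hθ.2.le⟩
  have hyy : 0 < (leap y fun ν => b₀ ν y * (θ * h)).real {y} := by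
    simpa using D.leap_first_pos hθ hh y [] (by simp)
  set k := (1 - θ) * h with hk
  have hk0 : 0 ≤ k := by positivity
  have hkh : k ≤ h := mul_le_of_le_one_left hh.le (by linarith [hθ.1])
  set c : Torus d S → ℝ := fun ν => max (alpha₁ θ * b₁ ν y - alpha₂ θ * b₀ ν y) 0 with hc
  have hcR : ∀ ν ≠ 0, c ν ≤ alpha₁ θ * R := fun ν hν =>
    max_le (D.extrapolated_le hθ y hy hν) (by positivity)
  have hexp := abs_leapMean_sub_second_order_le y (x := k) (c := c) (ρ := alpha₁ θ * R)
    (by positivity) (fun ν _ => le_max_right _ _) hcR hP hP1 hf hk0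
  simp only [mul_comm k (c _)] at hexp
  have hdist := D.rateDist_extrapolated_le hθ hPα hy hyy
  set e := rateDist (fun ν => a (θ * h) ν y) (fun ν => b₁ ν y) +
        rateDist (fun ν => a 0 ν y) (fun ν => b₀ ν y) with he
  have he0 : 0 ≤ e := add_nonneg (rateDist_nonneg _ _) (rateDist_nonneg _ _)
  have hgen := abs_gen_sub_gen_le (fun ν _ => c ν)
    (fun ν w => alpha₁ θ * a (θ * h) ν w - alpha₂ θ * a 0 ν w) hf y
  rw [IsFlow.gen_rate_sub (fun ν w => alpha₁ θ * a (θ * h) ν w) (fun ν w => alpha₂ θ * a 0 ν w),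
    IsFlow.gen_rate_const_mul, IsFlow.gen_rate_const_mul (alpha₂ θ) (a 0)] at hgen
  set H := alpha₁ θ * gen (a (θ * h)) f y - alpha₂ θ * gen (a 0) f y
  have hgen' : |k * (gen (fun ν _ => c ν) f y - H)| ≤ h * (2 * (P * e)) := by
    rw [abs_mul, abs_of_nonneg hk0]
    refine mul_le_mul hkh (hgen.trans ?_) (abs_nonneg _) hh.le
    rw [mul_one]
    gcongr
  -- in the second-order term the extrapolated rates may be replaced by the rates at time `0`,
  -- because the extrapolation weights satisfy `α₁ - α₂ = 1`
  have hdist2 : rateDist c (fun ν => a 0 ν y) ≤ P * e + P * h := by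
    have h2 : rateDist (fun ν => alpha₁ θ * a (θ * h) ν y - alpha₂ θ * a 0 ν y)
        (fun ν => a 0 ν y) ≤ P * h := by
      calc rateDist (fun ν => alpha₁ θ * a (θ * h) ν y - alpha₂ θ * a 0 ν y) (fun ν => a 0 ν y)
          ≤ ∑ _ν : Jump d S, alpha₁ θ * R * h := by
            refine Finset.sum_le_sum fun ν _ => ?_
            have e1 : alpha₁ θ * a (θ * h) ν y - alpha₂ θ * a 0 ν y - a 0 ν y =
                alpha₁ θ * (a (θ * h) ν y - a 0 ν y) := by
              linear_combination (a 0 ν y) * hα'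
            rw [e1, abs_mul, abs_of_nonneg hα, mul_assoc]
            refine mul_le_mul_of_nonneg_left ?_ hα
            exact (D.rate_bounds.lipschitz _ hθmem ν ν.2 y).trans
              (mul_le_mul_of_nonneg_left hθmem.2 hR)
        _ = Fintype.card (Jump d S) * (alpha₁ θ * R) * h := by
            simp only [Finset.sum_const, Finset.card_univ, nsmul_eq_mul]; ring
        _ ≤ P * h := by
            refine mul_le_mul_of_nonneg_right ?_ hh.le
            have : 0 ≤ (Fintype.card (Jump d S) : ℝ) * (alpha₁ θ * R) := by positivity
            linarith
    refine le_trans ?_ (add_le_add hdist h2)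
    simp only [rateDist, ← Finset.sum_add_distrib]
    exact Finset.sum_le_sum fun ν _ => abs_sub_le _ _ _
  have haR : ∀ ν ≠ 0, |a 0 ν y| ≤ alpha₁ θ * R := fun ν hν =>
    (D.rate_bounds.bound 0 h0mem ν hν y).trans (le_mul_of_one_le_left hR (by linarith))
  have hsq := abs_gen_gen_sub_le (c := c) (c' := fun ν => a 0 ν y) (by positivity)
    (fun ν hν => (abs_of_nonneg (le_max_right _ _)).trans_le (hcR ν hν)) haR hP hf y
  set G := gen (fun ν _ => c ν) (gen (fun ν _ => c ν) f) y
  set G' := gen (fun ν _ => a 0 ν y) (gen (fun ν _ => a 0 ν y) f) y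
  have hk2 : k ^ 2 ≤ h ^ 2 := pow_le_pow_left₀ hk0 hkh 2
  have hsq' : |k ^ 2 / 2 * (G - G')| ≤ h ^ 2 / 2 * (4 * P * (P * e + P * h)) := by
    rw [abs_mul, abs_of_nonneg (by positivity)]
    refine mul_le_mul (by linarith) (hsq.trans ?_) (abs_nonneg _) (by positivity)
    rw [mul_one]
    gcongr
  change |secondMean θ h b₀ b₁ f y y - f y - k * gen (fun ν _ => c ν) f y - k ^ 2 / 2 * G| ≤ _
    at hexp
  have hk3 : 4 * P ^ 3 * 1 * k ^ 3 ≤ 4 * P ^ 3 * h ^ 3 := by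
    rw [mul_one]; gcongr
  have hP0 : 0 ≤ P := by linarith
  calc |secondMean θ h b₀ b₁ f y y - (f y + k * H + k ^ 2 / 2 * G')|
      = |(secondMean θ h b₀ b₁ f y y - f y - k * gen (fun ν _ => c ν) f y - k ^ 2 / 2 * G)
          + k * (gen (fun ν _ => c ν) f y - H) + k ^ 2 / 2 * (G - G')| := by congr 1; ring
    _ ≤ 4 * P ^ 3 * h ^ 3 + h * (2 * (P * e)) + h ^ 2 / 2 * (4 * P * (P * e + P * h)) :=
        (abs_add_three _ _ _).trans (add_le_add (add_le_add (hexp.trans hk3) hgen') hsq')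
    _ ≤ _ := by
        have i1 : h ^ 2 * (P ^ 2 * e) ≤ h * (P ^ 2 * e) :=
          mul_le_mul_of_nonneg_right (by nlinarith) (by positivity)
        have i2 : h * e * P ≤ h * e * P ^ 2 :=
          mul_le_mul_of_nonneg_left (by nlinarith) (by positivity)
        have i3 : h ^ 3 * P ^ 2 ≤ h ^ 3 * P ^ 3 :=
          mul_le_mul_of_nonneg_left (pow_le_pow_right₀ hP1 (by norm_num)) (by positivity)
        nlinarith

end StepData

namespace StepData

variable {θ m R h : ℝ} {a : ℝ → Torus d S → Torus d S → ℝ}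
  {a' b₀ b₁ : Torus d S → Torus d S → ℝ} {charged : Torus d S → Prop}
  {perm : Torus d S → Torus d S → Prop} {P : ℝ} {f : Torus d S → ℝ}

/-- If two jumps are permissible from `y`, but the second is no longer permissible after the first,
then nonnegativity of the extrapolation forces an estimation error of order one after the first
jump. -/
lemma le_rateDist_of_not_perm (D : StepData θ m R h a a' b₀ b₁ charged perm)
    (hθ : θ ∈ Set.Ioo (0 : ℝ) 1) (hh : 0 < h) (hm : 0 < m) {y ν ν' : Torus d S} (hν : ν ≠ 0)
    (hν' : ν' ≠ 0) (hp : perm ν y) (hp' : perm ν' y) (hn : ¬ perm ν' (y + ν)) :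
    alpha₂ θ / alpha₁ θ * m ≤
      rateDist (fun ν₁ => a (θ * h) ν₁ (y + ν)) (fun ν₁ => b₁ ν₁ (y + ν)) := by
  have hα₁ := alpha₁_pos hθ
  have hα₂ := alpha₂_pos hθ
  have hpos := D.leap_first_pos hθ hh y [ν]
    (by simpa using ⟨hν, hm.trans_le (D.le_b₀ ν hν y hp)⟩)
  rw [List.sum_singleton] at hpos
  have h1 := D.extrapolated_nonneg y (D.charged_add ν hν y hp).1 _ hpos ν' hν'
  have h2 := D.le_b₀ ν' hν' y hp'
  have h3 : a (θ * h) ν' (y + ν) = 0 := D.rate_eq_zero _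
    ⟨(mul_pos hθ.1 hh).le, mul_le_of_le_one_left hh.le hθ.2.le⟩ ν' hν' _ hn
  have h4 : alpha₂ θ / alpha₁ θ * m ≤ b₁ ν' (y + ν) := by
    rw [div_mul_eq_mul_div, div_le_iff₀ hα₁]
    nlinarith [mul_le_mul_of_nonneg_left h2 hα₂.le]
  refine h4.trans ?_
  have h5 := Finset.single_le_sum
    (f := fun ν₁ : Jump d S => |a (θ * h) ν₁ (y + ν) - b₁ ν₁ (y + ν)|)
    (fun _ _ => abs_nonneg _) (Finset.mem_univ ⟨ν', hν'⟩)
  refine le_trans ?_ h5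
  simp only [h3, zero_sub, abs_neg]
  exact le_abs_self _

/-- The second stage after two jumps of the first stage changes means only by `O(h)`, up to the
estimation error. -/
lemma mul_abs_secondMean_sub_le (D : StepData θ m R h a a' b₀ b₁ charged perm)
    (hθ : θ ∈ Set.Ioo (0 : ℝ) 1) (hh : 0 < h) (hm : 0 < m)
    (hP : 2 * Fintype.card (Jump d S) * (alpha₁ θ * R) ≤ P)
    (hf : ∀ z, |f z| ≤ 1) {y ν ν' : Torus d S} (hν : ν ≠ 0) (hν' : ν' ≠ 0) :
    a 0 ν y * a 0 ν' y * |secondMean θ h b₀ b₁ f y (y + ν + ν') - f (y + ν + ν')| ≤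
      R ^ 2 * (P * h) + 2 * R / (alpha₂ θ / alpha₁ θ * m) * (a 0 ν y *
        rateDist (fun ν₁ => a (θ * h) ν₁ (y + ν)) (fun ν₁ => b₁ ν₁ (y + ν))) := by
  have hα₁ := alpha₁_pos hθ
  have hα₂ := alpha₂_pos hθ
  have hR := D.rate_bounds.nonneg
  have hP0 : 0 ≤ P := le_trans (by positivity) hP
  have h0mem : (0 : ℝ) ∈ Set.Icc 0 h := ⟨le_rfl, hh.le⟩
  have ha0 := D.rate_nonneg 0 h0mem ν hν y
  have ha0' := D.rate_nonneg 0 h0mem ν' hν' y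
  have haR := (le_abs_self _).trans (D.rate_bounds.bound 0 h0mem ν hν y)
  have haR' := (le_abs_self _).trans (D.rate_bounds.bound 0 h0mem ν' hν' y)
  set e := rateDist (fun ν₁ => a (θ * h) ν₁ (y + ν)) (fun ν₁ => b₁ ν₁ (y + ν)) with he
  have he0 : 0 ≤ e := rateDist_nonneg _ _
  set η := alpha₂ θ / alpha₁ θ * m with hη
  have hη0 : 0 < η := by positivity
  have hrhs : 0 ≤ R ^ 2 * (P * h) + 2 * R / η * (a 0 ν y * e) := by positivity
  by_cases hp : perm ν y
  swap
  · rw [D.rate_eq_zero 0 h0mem ν hν y hp, zero_mul, zero_mul]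
    positivity
  by_cases hp' : perm ν' y
  swap
  · rw [D.rate_eq_zero 0 h0mem ν' hν' y hp', mul_zero, zero_mul]
    positivity
  by_cases hn : perm ν' (y + ν)
  · have hb := D.abs_secondMean_sub_le hθ hh.le hP hf y (D.charged_add ν' hν' _ hn).2
    calc a 0 ν y * a 0 ν' y * |secondMean θ h b₀ b₁ f y (y + ν + ν') - f (y + ν + ν')|
        ≤ R * R * (P * h) := by gcongr
      _ ≤ _ := by rw [← pow_two]; exact le_add_of_nonneg_right (by positivity)
  · have hle := D.le_rateDist_of_not_perm hθ hh hm hν hν' hp hp' hn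
    have h2 : |secondMean θ h b₀ b₁ f y (y + ν + ν') - f (y + ν + ν')| ≤ 2 := by
      refine (abs_sub _ _).trans ?_
      have := abs_leapMean_le (y + ν + ν') (fun ν₁ => max (alpha₁ θ * b₁ ν₁ (y + ν + ν')
        - alpha₂ θ * b₀ ν₁ y) 0 * ((1 - θ) * h)) hf
      have h3 := hf (y + ν + ν')
      change |secondMean θ h b₀ b₁ f y (y + ν + ν')| ≤ 1 at this
      linarith
    calc a 0 ν y * a 0 ν' y * |secondMean θ h b₀ b₁ f y (y + ν + ν') - f (y + ν + ν')|
        ≤ a 0 ν y * R * 2 := by gcongr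
      _ = 2 * R / η * (a 0 ν y * η) := by field_simp
      _ ≤ 2 * R / η * (a 0 ν y * e) := by gcongr
      _ ≤ _ := le_add_of_nonneg_left (by positivity)

lemma sum_jump_le {g : Torus d S → ℝ} {B : ℝ} (hg : ∀ ν ≠ 0, g ν ≤ B) :
    ∑ ν : Jump d S, g ν ≤ Fintype.card (Jump d S) * B := by
  rw [← nsmul_eq_mul, ← Finset.card_univ, ← Finset.sum_const]
  exact Finset.sum_le_sum fun ν _ => hg ν ν.2

/-- The first-order term of the first stage. The error terms at `y + ν` are weighted with the true
rate of `ν`, which vanishes unless `ν` is permissible, so they are only needed at charged states. -/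
lemma abs_gen_secondMean_sub_le (D : StepData θ m R h a a' b₀ b₁ charged perm)
    (hθ : θ ∈ Set.Ioo (0 : ℝ) 1) (hh : 0 < h) (hm : 0 < m)
    (hP : 2 * Fintype.card (Jump d S) * (alpha₁ θ * R) ≤ P) (hP1 : 1 ≤ P) (hPα : alpha₁ θ ≤ P)
    (hf : ∀ z, |f z| ≤ 1) {y : Torus d S} (hy : charged y) :
    |gen (a 0) (secondMean θ h b₀ b₁ f y) y - gen (a 0) (fun w => f w + (1 - θ) * h *
        (alpha₁ θ * gen (a (θ * h)) f w - alpha₂ θ * gen (fun ν _ => a 0 ν y) f w)) y| ≤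
      4 * P ^ 3 * h ^ 2 + 4 * P ^ 2 * h * (rateDist (fun ν => a (θ * h) ν y) (fun ν => b₁ ν y) +
        rateDist (fun ν => a 0 ν y) (fun ν => b₀ ν y)) + 2 * P * h * ∑ ν : Jump d S, a 0 ν y *
          rateDist (fun ν₁ => a (θ * h) ν₁ (y + ν)) (fun ν₁ => b₁ ν₁ (y + ν)) := by
  have hα₁ := alpha₁_pos hθ
  have hα' := alpha₁_sub_alpha₂ hθ
  have hα₂ := alpha₂_pos hθ
  have hR := D.rate_bounds.nonneg
  have h0mem : (0 : ℝ) ∈ Set.Icc 0 h := ⟨le_rfl, hh.le⟩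
  have hyy : 0 < (leap y fun ν => b₀ ν y * (θ * h)).real {y} := by
    simpa using D.leap_first_pos hθ hh y [] (by simp)
  have hJR : (Fintype.card (Jump d S) : ℝ) * R ≤ P := by
    have : (Fintype.card (Jump d S) : ℝ) * R ≤ 2 * Fintype.card (Jump d S) * (alpha₁ θ * R) := by
      have : (0 : ℝ) ≤ Fintype.card (Jump d S) * R := by positivity
      nlinarith
    linarith
  set e₀ := rateDist (fun ν => a 0 ν y) (fun ν => b₀ ν y) with he₀
  let e₁ : Torus d S → ℝ := fun w => rateDist (fun ν₁ => a (θ * h) ν₁ w) (fun ν₁ => b₁ ν₁ w)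
  have he₀0 : 0 ≤ e₀ := rateDist_nonneg _ _
  have he₁0 : ∀ w, 0 ≤ e₁ w := fun w => rateDist_nonneg _ _
  rw [← gen_sub]
  refine (abs_gen_le_sum _ _ _).trans ?_
  have hterm : ∀ ν ≠ 0, |a 0 ν y| * (|secondMean θ h b₀ b₁ f y (y + ν) - (f (y + ν) + (1 - θ) * h *
        (alpha₁ θ * gen (a (θ * h)) f (y + ν) - alpha₂ θ * gen (fun ν _ => a 0 ν y) f (y + ν)))|
        + |secondMean θ h b₀ b₁ f y y - (f y + (1 - θ) * h *
        (alpha₁ θ * gen (a (θ * h)) f y - alpha₂ θ * gen (fun ν _ => a 0 ν y) f y))|) ≤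
      R * (4 * P ^ 2 * h ^ 2 + 4 * P * h * (e₁ y + e₀)) + 2 * P * h * (a 0 ν y * e₁ (y + ν)) := by
    intro ν hν
    have ha0 := D.rate_nonneg 0 h0mem ν hν y
    have haR := D.rate_bounds.bound 0 h0mem ν hν y
    have hP0 : 0 ≤ P := by linarith
    by_cases hp : perm ν y
    swap
    · rw [D.rate_eq_zero 0 h0mem ν hν y hp, abs_zero, zero_mul, zero_mul, mul_zero, add_zero]
      have := he₁0 y
      positivity
    have hpos := D.leap_first_pos hθ hh y [ν]
      (by simpa using ⟨hν, hm.trans_le (D.le_b₀ ν hν y hp)⟩)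
    rw [List.sum_singleton] at hpos
    have b1 := D.abs_secondMean_sub_first_order_le hθ hh.le hP hP1 hPα hf hy
      (D.charged_add ν hν y hp).2 hpos
    have b2 := D.abs_secondMean_sub_first_order_le hθ hh.le hP hP1 hPα hf hy hy hyy
    have b3 := mul_le_mul_of_nonneg_left (add_le_add b1 b2) (abs_nonneg (a 0 ν y))
    refine b3.trans ?_
    change |a 0 ν y| * (2 * P ^ 2 * h ^ 2 + 2 * P * h * (e₁ (y + ν) + e₀)
      + (2 * P ^ 2 * h ^ 2 + 2 * P * h * (e₁ y + e₀))) ≤ _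
    have e : |a 0 ν y| * (2 * P ^ 2 * h ^ 2 + 2 * P * h * (e₁ (y + ν) + e₀)
      + (2 * P ^ 2 * h ^ 2 + 2 * P * h * (e₁ y + e₀))) =
      |a 0 ν y| * (4 * P ^ 2 * h ^ 2 + 2 * P * h * (e₁ y + 2 * e₀))
        + 2 * P * h * (|a 0 ν y| * e₁ (y + ν)) := by ring
    rw [e, abs_of_nonneg ha0]
    rw [abs_of_nonneg ha0] at haR
    have i1 : 0 ≤ 2 * P * h * e₁ y := by have := he₁0 y; positivity
    have i2 : 4 * P ^ 2 * h ^ 2 + 2 * P * h * (e₁ y + 2 * e₀) ≤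
        4 * P ^ 2 * h ^ 2 + 4 * P * h * (e₁ y + e₀) := by linarith
    have i3 : 0 ≤ 4 * P ^ 2 * h ^ 2 + 4 * P * h * (e₁ y + e₀) := by
      have := he₁0 y; positivity
    have := mul_le_mul haR i2 (by have := he₁0 y; positivity) hR
    linarith
  refine le_trans (Finset.sum_le_sum fun (ν : Jump d S) _ => hterm ν ν.2) ?_
  rw [Finset.sum_add_distrib, Finset.sum_const, Finset.card_univ, nsmul_eq_mul]
  change _ ≤ 4 * P ^ 3 * h ^ 2 + 4 * P ^ 2 * h * (e₁ y + e₀) +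
    2 * P * h * ∑ ν : Jump d S, a 0 ν y * e₁ (y + ν)
  refine add_le_add ?_ (Finset.mul_sum _ _ _).ge
  have hP0 : 0 ≤ P := by linarith
  have h1 := he₁0 y
  calc (Fintype.card (Jump d S) : ℝ) * (R * (4 * P ^ 2 * h ^ 2 + 4 * P * h * (e₁ y + e₀)))
      = (Fintype.card (Jump d S) * R) * (4 * P ^ 2 * h ^ 2 + 4 * P * h * (e₁ y + e₀)) := by ring
    _ ≤ P * (4 * P ^ 2 * h ^ 2 + 4 * P * h * (e₁ y + e₀)) := by gcongr
    _ = _ := by ring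

/-- The second-order term of the first stage, where the mean after the second stage may be replaced
by the test function itself. -/
lemma abs_gen_gen_secondMean_sub_le (D : StepData θ m R h a a' b₀ b₁ charged perm)
    (hθ : θ ∈ Set.Ioo (0 : ℝ) 1) (hh : 0 < h) (hm : 0 < m)
    (hP : 2 * Fintype.card (Jump d S) * (alpha₁ θ * R) ≤ P) (hP1 : 1 ≤ P)
    (hf : ∀ z, |f z| ≤ 1) {y : Torus d S} (hy : charged y) :
    |gen (fun ν _ => a 0 ν y) (gen (fun ν _ => a 0 ν y) (secondMean θ h b₀ b₁ f y)) y
      - gen (fun ν _ => a 0 ν y) (gen (fun ν _ => a 0 ν y) f) y| ≤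
      4 * P ^ 3 * h + Fintype.card (Jump d S) * (2 * R / (alpha₂ θ / alpha₁ θ * m)) *
        ∑ ν : Jump d S, a 0 ν y *
          rateDist (fun ν₁ => a (θ * h) ν₁ (y + ν)) (fun ν₁ => b₁ ν₁ (y + ν)) := by
  have hα₁ := alpha₁_pos hθ
  have hα' := alpha₁_sub_alpha₂ hθ
  have hα₂ := alpha₂_pos hθ
  have hR := D.rate_bounds.nonneg
  have hP0 : 0 ≤ P := by linarith
  have h0mem : (0 : ℝ) ∈ Set.Icc 0 h := ⟨le_rfl, hh.le⟩
  have hJR : (Fintype.card (Jump d S) : ℝ) * R ≤ P := by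
    have : (Fintype.card (Jump d S) : ℝ) * R ≤ 2 * Fintype.card (Jump d S) * (alpha₁ θ * R) := by
      have : (0 : ℝ) ≤ Fintype.card (Jump d S) * R := by positivity
      nlinarith
    linarith
  let e₁ : Torus d S → ℝ := fun w => rateDist (fun ν₁ => a (θ * h) ν₁ w) (fun ν₁ => b₁ ν₁ w)
  let u : Torus d S → ℝ := fun w => secondMean θ h b₀ b₁ f y w - f w
  set K := 2 * R / (alpha₂ θ / alpha₁ θ * m) with hK
  have ha0 : ∀ ν ≠ 0, 0 ≤ a 0 ν y := fun ν hν => D.rate_nonneg 0 h0mem ν hν y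
  have haR : ∀ ν ≠ 0, a 0 ν y ≤ R := fun ν hν =>
    (le_abs_self _).trans (D.rate_bounds.bound 0 h0mem ν hν y)
  have e : gen (fun ν _ => a 0 ν y) (gen (fun ν _ => a 0 ν y) (secondMean θ h b₀ b₁ f y)) y
      - gen (fun ν _ => a 0 ν y) (gen (fun ν _ => a 0 ν y) f) y =
      gen (fun ν _ => a 0 ν y) (gen (fun ν _ => a 0 ν y) u) y := by
    rw [← gen_sub]
    congr 1
    ext w
    rw [← gen_sub]
  have huy : |u y| ≤ P * h := D.abs_secondMean_sub_le hθ hh.le hP hf y hy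
  have hu1 : ∀ ν ≠ 0, a 0 ν y * |u (y + ν)| ≤ R * (P * h) := by
    intro ν hν
    by_cases hp : perm ν y
    · exact mul_le_mul (haR ν hν)
        (D.abs_secondMean_sub_le hθ hh.le hP hf y (D.charged_add ν hν y hp).2) (abs_nonneg _) hR
    · rw [D.rate_eq_zero 0 h0mem ν hν y hp, zero_mul]; positivity
  have hterm : ∀ ν ≠ 0, ∀ ν' ≠ 0, a 0 ν y * (a 0 ν' y * (|u (y + ν + ν')| + |u (y + ν)|)
      + a 0 ν' y * (|u (y + ν')| + |u y|)) ≤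
      4 * (R ^ 2 * (P * h)) + K * (a 0 ν y * e₁ (y + ν)) := by
    intro ν hν ν' hν'
    have i1 : a 0 ν y * a 0 ν' y * |u (y + ν + ν')| ≤
        R ^ 2 * (P * h) + K * (a 0 ν y * e₁ (y + ν)) :=
      D.mul_abs_secondMean_sub_le hθ hh hm hP hf hν hν'
    have i2 := mul_le_mul (haR ν' hν') (hu1 ν hν)
      (mul_nonneg (ha0 ν hν) (abs_nonneg _)) hR
    have i3 := mul_le_mul (haR ν hν) (hu1 ν' hν')
      (mul_nonneg (ha0 ν' hν') (abs_nonneg _)) hR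
    have i4 := mul_le_mul (mul_le_mul (haR ν hν) (haR ν' hν') (ha0 ν' hν') hR) huy
      (abs_nonneg _) (by positivity)
    nlinarith
  rw [e]
  calc |gen (fun ν _ => a 0 ν y) (gen (fun ν _ => a 0 ν y) u) y|
      ≤ ∑ ν : Jump d S, |a 0 ν y| * (|gen (fun ν _ => a 0 ν y) u (y + ν)|
          + |gen (fun ν _ => a 0 ν y) u y|) := abs_gen_le_sum _ _ _
    _ ≤ ∑ ν : Jump d S, a 0 ν y * (∑ ν' : Jump d S, a 0 ν' y * (|u (y + ν + ν')| + |u (y + ν)|)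
          + ∑ ν' : Jump d S, a 0 ν' y * (|u (y + ν')| + |u y|)) := by
        have hin : ∀ w, |gen (fun ν _ => a 0 ν y) u w| ≤
            ∑ ν' : Jump d S, a 0 ν' y * (|u (w + ν')| + |u w|) := fun w => by
          refine (abs_gen_le_sum _ _ _).trans (le_of_eq ?_)
          exact Finset.sum_congr rfl fun (ν : Jump d S) _ => by rw [abs_of_nonneg (ha0 ν ν.2)]
        refine Finset.sum_le_sum fun ν _ => ?_
        rw [abs_of_nonneg (ha0 ν ν.2)]
        exact mul_le_mul_of_nonneg_left (add_le_add (hin _) (hin _)) (ha0 ν ν.2)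
    _ = ∑ ν : Jump d S, ∑ ν' : Jump d S, a 0 ν y * (a 0 ν' y * (|u (y + ν + ν')| + |u (y + ν)|)
          + a 0 ν' y * (|u (y + ν')| + |u y|)) := by
        simp only [← Finset.sum_add_distrib, Finset.mul_sum]
    _ ≤ ∑ ν : Jump d S, ∑ _ν' : Jump d S,
          (4 * (R ^ 2 * (P * h)) + K * (a 0 ν y * e₁ (y + ν))) :=
        Finset.sum_le_sum fun ν _ => Finset.sum_le_sum fun ν' _ => hterm ν ν.2 ν' ν'.2
    _ = 4 * (Fintype.card (Jump d S) * R) ^ 2 * P * h +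
          Fintype.card (Jump d S) * K * ∑ ν : Jump d S, a 0 ν y * e₁ (y + ν) := by
        simp only [Finset.sum_const, Finset.card_univ, nsmul_eq_mul, mul_add,
          Finset.sum_add_distrib, ← Finset.mul_sum]
        ring
    _ ≤ _ := by
        refine add_le_add_left ?_ _
        have : (Fintype.card (Jump d S) * R) ^ 2 ≤ P ^ 2 :=
          pow_le_pow_left₀ (by positivity) hJR 2
        calc 4 * (Fintype.card (Jump d S) * R) ^ 2 * P * h ≤ 4 * P ^ 2 * P * h := by gcongr
          _ = _ := by ring

lemma stepKernel_eq_leapMean (θ h : ℝ) (b₀ b₁ : Torus d S → Torus d S → ℝ) (y z : Torus d S) :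
    stepKernel θ h b₀ b₁ y z = leapMean y (fun ν => b₀ ν y * (θ * h))
      (secondMean θ h b₀ b₁ (Pi.single z 1) y) := by
  classical
  unfold stepKernel secondMean
  rw [leapMean]
  refine Finset.sum_congr rfl fun w _ => ?_
  congr 1
  simp [leapMean, Pi.single_apply]

lemma abs_iterated_sub_le (p₁ p₂ p₃ p₄ p₅ p₆ p₇ p₈ p₉ : ℝ) :
    |p₁ - p₂ - p₃ - p₄ - p₅ - p₆ - p₇ - p₈ - p₉| ≤
      |p₁| + |p₂| + |p₃| + |p₄| + |p₅| + |p₆| + |p₇| + |p₈| + |p₉| := by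
  refine (abs_sub _ _).trans (add_le_add_left ?_ _)
  refine (abs_sub _ _).trans (add_le_add_left ?_ _)
  refine (abs_sub _ _).trans (add_le_add_left ?_ _)
  refine (abs_sub _ _).trans (add_le_add_left ?_ _)
  refine (abs_sub _ _).trans (add_le_add_left ?_ _)
  refine (abs_sub _ _).trans (add_le_add_left ?_ _)
  refine (abs_sub _ _).trans (add_le_add_left ?_ _)
  exact abs_sub _ _

set_option maxHeartbeats 1000000 in
/-- The cancellation behind the method. With `x = θ h` and `k = (1 - θ) h`, the numbers `L0`, `Lx`,
`L'` stand for the generators at the times `0` and `x` and the time derivative of the generator,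
applied to a test function; `LL0`, `LLx`, `GG` for their compositions with the generator at `0`,
the last one with frozen rates; `Gg`, `GGg` and `Gb`, `GGb` for true and estimated generators
applied to the mean `g` after the second stage; `v` and `w` for the exact and the numerical mean;
`e₀`, `e₁` and `s` for the estimation errors at the current state and after one jump. -/
lemma abs_sub_le_of_expansions {θ h P K e₀ e₁ s v w f g L0 Lx L' LL0 LLx GG GGg GGb Gb Gg J R : ℝ}
    (hθ : θ ∈ Set.Ioo (0 : ℝ) 1) (hh : 0 < h) (hh1 : h ≤ 1) (hP1 : 1 ≤ P) (hK0 : 0 ≤ K)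
    (hJ : 0 ≤ J) (hR : 0 ≤ R) (hPR : 2 * J * (alpha₁ θ * R) ≤ P)
    (he₀ : 0 ≤ e₀) (he₁ : 0 ≤ e₁) (hs : 0 ≤ s)
    (hF : |v - f - h * L0 - h ^ 2 / 2 * (LL0 + L')| ≤
      (2 * J * R + 2 * (2 * J * R) ^ 2 + (2 * J * R) ^ 3) * h ^ 3)
    (hexp : |w - g - θ * h * Gb - (θ * h) ^ 2 / 2 * GGb| ≤ 4 * P ^ 3 * (θ * h) ^ 3)
    (hA1 : |Gb - Gg| ≤ 2 * e₀) (hA2 : |GGb - GGg| ≤ 4 * P * e₀)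
    (hB : |g - (f + (1 - θ) * h * (alpha₁ θ * Lx - alpha₂ θ * L0) + ((1 - θ) * h) ^ 2 / 2 * GG)| ≤
      6 * P ^ 3 * h ^ 3 + 4 * P ^ 2 * h * (e₁ + e₀))
    (hC : |Gg - (L0 + (1 - θ) * h * (alpha₁ θ * LLx - alpha₂ θ * GG))| ≤
      4 * P ^ 3 * h ^ 2 + 4 * P ^ 2 * h * (e₁ + e₀) + 2 * P * h * s)
    (hD : |GGg - GG| ≤ 4 * P ^ 3 * h + K * s)
    (hG1 : |Lx - L0 - θ * h * L'| ≤ 2 * J * (R * (θ * h) ^ 2))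
    (hG2 : |LLx - LL0| ≤ 2 * J * R * (P * (θ * h))) :
    |v - w| ≤ (40 * P ^ 3 + K) * (h ^ 3 + h * (e₁ + e₀) + h ^ 2 * s) := by
  have hα₁ := alpha₁_pos hθ
  have hα₂ := alpha₂_pos hθ
  have hα := alpha₁_sub_alpha₂ hθ
  have hθ1 : 0 < 1 - θ := sub_pos.2 hθ.2
  have hP0 : 0 ≤ P := by linarith
  have hPR' : 2 * J * R ≤ P := by
    have : 0 ≤ 2 * J * R := by positivity
    nlinarith
  have hx0 : 0 ≤ θ * h := (mul_pos hθ.1 hh).le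
  have hxh : θ * h ≤ h := mul_le_of_le_one_left hh.le hθ.2.le
  have hk0 : 0 ≤ (1 - θ) * h := by positivity
  have hkh : (1 - θ) * h ≤ h := mul_le_of_le_one_left hh.le (by linarith [hθ.1])
  -- the order conditions; together with `α₁ - α₂ = 1` they make the terms of `key` cancel
  have c1 : (1 - θ) * θ * alpha₁ θ = 1 / 2 := by
    have h0 := hθ.1.ne'
    have h1 := hθ1.ne'
    unfold alpha₁; field_simp
  have c2 : (1 - θ) ^ 2 / 2 + θ ^ 2 / 2 = θ * (1 - θ) * alpha₂ θ := by
    have h0 := hθ.1.ne'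
    have h1 := hθ1.ne'
    unfold alpha₂; field_simp
  have key : v - w =
      (v - f - h * L0 - h ^ 2 / 2 * (LL0 + L'))
      - (w - g - θ * h * Gb - (θ * h) ^ 2 / 2 * GGb)
      - θ * h * (Gb - Gg) - (θ * h) ^ 2 / 2 * (GGb - GGg)
      - (g - (f + (1 - θ) * h * (alpha₁ θ * Lx - alpha₂ θ * L0) + ((1 - θ) * h) ^ 2 / 2 * GG))
      - θ * h * (Gg - (L0 + (1 - θ) * h * (alpha₁ θ * LLx - alpha₂ θ * GG)))
      - (θ * h) ^ 2 / 2 * (GGg - GG)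
      - (1 - θ) * h * alpha₁ θ * (Lx - L0 - θ * h * L')
      - h ^ 2 / 2 * (LLx - LL0) := by
    linear_combination (-(h ^ 2) * L' - h ^ 2 * LLx) * c1 - h ^ 2 * GG * c2
      - (1 - θ) * h * L0 * hα
  set x := θ * h with hxdef
  set k := (1 - θ) * h with hkdef
  have hx2 : x ^ 2 ≤ h ^ 2 := pow_le_pow_left₀ hx0 hxh 2
  have hx3 : x ^ 3 ≤ h ^ 3 := pow_le_pow_left₀ hx0 hxh 3
  have hpow1 : P ≤ P ^ 3 := le_self_pow₀ hP1 (by norm_num)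
  have hpow2 : P ^ 2 ≤ P ^ 3 := pow_le_pow_right₀ hP1 (by norm_num)
  set Q := P ^ 3 with hQ
  have hQ0 : 0 ≤ Q := by positivity
  have hQ1 : 1 ≤ Q := hP1.trans hpow1
  set e := e₁ + e₀ with he
  have he0 : 0 ≤ e := add_nonneg he₁ he₀
  have hhe : 0 ≤ h * e := by positivity
  have hh2e : h ^ 2 * e ≤ h * e := mul_le_mul_of_nonneg_right (by nlinarith) he0
  have hh2s : 0 ≤ h ^ 2 * s := by positivity
  have hh30 : 0 ≤ h ^ 3 := by positivity
  have t1 : |v - f - h * L0 - h ^ 2 / 2 * (LL0 + L')| ≤ 4 * Q * h ^ 3 := by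
    refine hF.trans ?_
    have hΛ : 0 ≤ 2 * J * R := by positivity
    have i2 := pow_le_pow_left₀ hΛ hPR' 2
    have i3 := pow_le_pow_left₀ hΛ hPR' 3
    exact mul_le_mul_of_nonneg_right (by linarith) hh30
  have t2 : |w - g - x * Gb - x ^ 2 / 2 * GGb| ≤ 4 * Q * h ^ 3 := by
    refine hexp.trans ?_
    exact mul_le_mul_of_nonneg_left hx3 (by positivity)
  have t3 : |x * (Gb - Gg)| ≤ 2 * Q * (h * e) := by
    rw [abs_mul, abs_of_nonneg hx0]
    calc x * |Gb - Gg| ≤ h * (2 * e₀) := mul_le_mul hxh hA1 (abs_nonneg _) hh.le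
      _ ≤ h * (2 * Q * e) := by
          refine mul_le_mul_of_nonneg_left ?_ hh.le
          exact mul_le_mul (by linarith) (by linarith) he₀ (by positivity)
      _ = _ := by ring
  have t4 : |x ^ 2 / 2 * (GGb - GGg)| ≤ 2 * Q * (h * e) := by
    rw [abs_mul, abs_of_nonneg (by positivity)]
    calc x ^ 2 / 2 * |GGb - GGg| ≤ h ^ 2 / 2 * (4 * P * e₀) :=
          mul_le_mul (by linarith) hA2 (abs_nonneg _) (by positivity)
      _ ≤ h ^ 2 / 2 * (4 * Q * e) := by
          refine mul_le_mul_of_nonneg_left ?_ (by positivity)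
          exact mul_le_mul (by linarith) (by linarith) he₀ (by positivity)
      _ = 2 * Q * (h ^ 2 * e) := by ring
      _ ≤ _ := mul_le_mul_of_nonneg_left hh2e (by positivity)
  have t5 : |g - (f + k * (alpha₁ θ * Lx - alpha₂ θ * L0) + k ^ 2 / 2 * GG)| ≤
      6 * Q * h ^ 3 + 4 * Q * (h * e) := by
    refine hB.trans (add_le_add le_rfl ?_)
    calc 4 * P ^ 2 * h * e = 4 * P ^ 2 * (h * e) := by ring
      _ ≤ _ := mul_le_mul_of_nonneg_right (by linarith) hhe
  have t6 : |x * (Gg - (L0 + k * (alpha₁ θ * LLx - alpha₂ θ * GG)))| ≤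
      4 * Q * h ^ 3 + 4 * Q * (h * e) + 2 * Q * (h ^ 2 * s) := by
    rw [abs_mul, abs_of_nonneg hx0]
    calc _ ≤ h * (4 * Q * h ^ 2 + 4 * P ^ 2 * h * e + 2 * P * h * s) :=
          mul_le_mul hxh hC (abs_nonneg _) hh.le
      _ = 4 * Q * h ^ 3 + 4 * P ^ 2 * (h ^ 2 * e) + 2 * P * (h ^ 2 * s) := by ring
      _ ≤ _ := by
          refine add_le_add (add_le_add le_rfl ?_) ?_
          · exact mul_le_mul (by linarith) hh2e (by positivity) (by positivity)
          · exact mul_le_mul_of_nonneg_right (by linarith) hh2s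
  have t7 : |x ^ 2 / 2 * (GGg - GG)| ≤ 2 * Q * h ^ 3 + K * (h ^ 2 * s) := by
    rw [abs_mul, abs_of_nonneg (by positivity)]
    calc x ^ 2 / 2 * |GGg - GG| ≤ h ^ 2 / 2 * (4 * Q * h + K * s) :=
          mul_le_mul (by linarith) hD (abs_nonneg _) (by positivity)
      _ = 2 * Q * h ^ 3 + K * (h ^ 2 * s) / 2 := by ring
      _ ≤ _ := by linarith [mul_nonneg hK0 hh2s]
  have t8 : |k * alpha₁ θ * (Lx - L0 - x * L')| ≤ Q * h ^ 3 := by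
    rw [abs_mul, abs_of_nonneg (by positivity)]
    calc k * alpha₁ θ * |Lx - L0 - x * L'|
        ≤ h * alpha₁ θ * (2 * J * (R * x ^ 2)) := by gcongr
      _ ≤ h * alpha₁ θ * (2 * J * (R * h ^ 2)) := by gcongr
      _ = (2 * J * (alpha₁ θ * R)) * h ^ 3 := by ring
      _ ≤ Q * h ^ 3 := mul_le_mul_of_nonneg_right (hPR.trans hpow1) hh30
  have t9 : |h ^ 2 / 2 * (LLx - LL0)| ≤ Q * h ^ 3 := by
    rw [abs_mul, abs_of_nonneg (by positivity)]
    calc h ^ 2 / 2 * |LLx - LL0| ≤ h ^ 2 / 2 * (P * (P * h)) := by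
          refine mul_le_mul_of_nonneg_left (hG2.trans ?_) (by positivity)
          exact mul_le_mul hPR' (by gcongr) (by positivity) hP0
      _ = P ^ 2 * h ^ 3 / 2 := by ring
      _ ≤ P ^ 2 * h ^ 3 := half_le_self (by positivity)
      _ ≤ _ := mul_le_mul_of_nonneg_right hpow2 hh30
  rw [key]
  refine (abs_iterated_sub_le _ _ _ _ _ _ _ _ _).trans ?_
  linarith [mul_nonneg hQ0 hh30, mul_nonneg hQ0 hhe, mul_nonneg hQ0 hh2s, mul_nonneg hK0 hh30,
    mul_nonneg hK0 hhe]

/-- The local error of the method: one step of the sampler agrees with the exact transition up to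
third order in the step size, apart from the estimation errors at the current state and after one
permissible jump. The weights `α₁` and `α₂` are such that all terms up to second order cancel. -/
lemma exists_abs_flow_sub_stepKernel_le (d S : ℕ) [NeZero S] {θ m R : ℝ}
    (hθ : θ ∈ Set.Ioo (0 : ℝ) 1) (hm : 0 < m) (hR : 0 ≤ R) :
    ∃ C : ℝ, 0 ≤ C ∧ ∀ {h : ℝ} {a : ℝ → Torus d S → Torus d S → ℝ}
      {a' b₀ b₁ : Torus d S → Torus d S → ℝ} {charged : Torus d S → Prop}
      {perm : Torus d S → Torus d S → Prop}, StepData θ m R h a a' b₀ b₁ charged perm →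
      0 < h → h ≤ 1 → ∀ {y : Torus d S} {v : ℝ → Torus d S → ℝ}, IsFlow a h y v → charged y →
      ∀ z, |v h z - stepKernel θ h b₀ b₁ y z| ≤ C * (h ^ 3 +
        h * (rateDist (fun ν => a (θ * h) ν y) (fun ν => b₁ ν y) +
          rateDist (fun ν => a 0 ν y) (fun ν => b₀ ν y)) +
        h ^ 2 * ∑ ν : Jump d S, a 0 ν y *
          rateDist (fun ν₁ => a (θ * h) ν₁ (y + ν)) (fun ν₁ => b₁ ν₁ (y + ν))) := by
  have hα₁ := alpha₁_pos hθ
  have hα₂ := alpha₂_pos hθ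
  have hα := alpha₁_sub_alpha₂ hθ
  have hθ1 : 0 < 1 - θ := sub_pos.2 hθ.2
  set P : ℝ := 1 + alpha₁ θ + 2 * Fintype.card (Jump d S) * (alpha₁ θ * R) with hPdef
  have hcard : 0 ≤ 2 * Fintype.card (Jump d S) * (alpha₁ θ * R) := by positivity
  have hP : 2 * Fintype.card (Jump d S) * (alpha₁ θ * R) ≤ P := by linarith
  have hP1 : 1 ≤ P := by linarith
  have hPα : alpha₁ θ ≤ P := by linarith
  have hP0 : 0 ≤ P := by linarith
  set K := (Fintype.card (Jump d S) : ℝ) * (2 * R / (alpha₂ θ / alpha₁ θ * m)) with hK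
  have hK0 : 0 ≤ K := by positivity
  refine ⟨40 * P ^ 3 + K, by positivity, ?_⟩
  intro h a a' b₀ b₁ charged perm D hh hh1 y v hv hy z
  have hRα : R ≤ alpha₁ θ * R := le_mul_of_one_le_left hR (by linarith)
  have hPR : 2 * Fintype.card (Jump d S) * R ≤ P := le_trans (by gcongr) hP
  have h0mem : (0 : ℝ) ∈ Set.Icc 0 h := ⟨le_rfl, hh.le⟩
  have hhmem : h ∈ Set.Icc 0 h := ⟨hh.le, le_rfl⟩
  have hx0 : 0 ≤ θ * h := (mul_pos hθ.1 hh).le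
  have hxh : θ * h ≤ h := mul_le_of_le_one_left hh.le hθ.2.le
  have hθmem : θ * h ∈ Set.Icc 0 h := ⟨hx0, hxh⟩
  set f : Torus d S → ℝ := Pi.single z 1 with hfdef
  have hf : ∀ w, |f w| ≤ 1 := abs_single_le_one z
  rw [stepKernel_eq_leapMean]
  set g := secondMean θ h b₀ b₁ f y with hg
  have hg1 : ∀ w, |g w| ≤ 1 := fun w => abs_leapMean_le w _ hf
  set e₀ := rateDist (fun ν => a 0 ν y) (fun ν => b₀ ν y) with he₀
  set e₁ := rateDist (fun ν => a (θ * h) ν y) (fun ν => b₁ ν y) with he₁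
  set s := ∑ ν : Jump d S, a 0 ν y *
          rateDist (fun ν₁ => a (θ * h) ν₁ (y + ν)) (fun ν₁ => b₁ ν₁ (y + ν)) with hs
  have he₀0 : 0 ≤ e₀ := rateDist_nonneg _ _
  have he₁0 : 0 ≤ e₁ := rateDist_nonneg _ _
  have hs0 : 0 ≤ s := Finset.sum_nonneg fun ν _ =>
    mul_nonneg (D.rate_nonneg 0 h0mem ν ν.2 y) (rateDist_nonneg _ _)
  -- the first stage
  have hexp := abs_leapMean_sub_second_order_le y (x := θ * h) (c := fun ν => b₀ ν y) (f := g)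
    (ρ := alpha₁ θ * R) (by positivity) (fun ν hν => D.b₀_nonneg ν hν y)
    (fun ν hν => (D.b₀_le ν hν y hy).trans hRα) hP hP1 hg1 hx0
  rw [show (fun ν => θ * h * b₀ ν y) = fun ν => b₀ ν y * (θ * h) from
    funext fun ν => mul_comm _ _] at hexp
  have hA1 := abs_gen_sub_gen_le (fun ν _ => b₀ ν y) (fun ν _ => a 0 ν y) hg1 y
  have hA2 := abs_gen_gen_sub_le (c := fun ν => b₀ ν y) (c' := fun ν => a 0 ν y) (ρ := alpha₁ θ * R)
    (by positivity) (fun ν hν => (abs_of_nonneg (D.b₀_nonneg ν hν y)).trans_le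
      ((D.b₀_le ν hν y hy).trans hRα))
    (fun ν hν => (D.rate_bounds.bound 0 h0mem ν hν y).trans hRα) hP hg1 y
  have hsymm : rateDist (fun ν => b₀ ν y) (fun ν => a 0 ν y) = e₀ :=
    Finset.sum_congr rfl fun ν _ => abs_sub_comm _ _
  rw [hsymm] at hA1 hA2
  have hB := D.abs_secondMean_sub_second_order_le hθ hh hh1 hP hP1 hPα hf hy
  have hC := D.abs_gen_secondMean_sub_le hθ hh hm hP hP1 hPα hf hy
  have hD := D.abs_gen_gen_secondMean_sub_le hθ hh hm hP hP1 hf hy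
  rw [← hK, ← hs, ← hg] at hD
  rw [← hs, ← hg, ← he₁, ← he₀] at hC
  rw [← hg, ← he₁, ← he₀] at hB
  have hE : gen (a 0) (fun w => f w + (1 - θ) * h *
      (alpha₁ θ * gen (a (θ * h)) f w - alpha₂ θ * gen (fun ν _ => a 0 ν y) f w)) y =
      gen (a 0) f y + (1 - θ) * h * (alpha₁ θ * gen (a 0) (gen (a (θ * h)) f) y
        - alpha₂ θ * gen (fun ν _ => a 0 ν y) (gen (fun ν _ => a 0 ν y) f) y) := by
    rw [gen_add, gen_const_mul, gen_sub, gen_const_mul, gen_const_mul]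
    rfl
  rw [hE] at hC
  -- the exact transition
  have hF := hv.abs_sum_sub_second_order_le D.rate_bounds hf hhmem
  have hvz : ∑ w, v h w * f w = v h z := by
    classical
    simp [hfdef, Pi.single_apply]
  rw [hvz, mul_one] at hF
  have hG1 := abs_gen_le (a := fun ν w => a (θ * h) ν w - a 0 ν w - θ * h * a' ν w)
    (A := R * (θ * h) ^ 2)
    (by positivity) y (fun ν hν => D.rate_bounds.affine (θ * h) hθmem ν hν y) hf
  rw [IsFlow.gen_rate_sub (fun ν w => a (θ * h) ν w - a 0 ν w) (fun ν w => θ * h * a' ν w),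
    IsFlow.gen_rate_sub, IsFlow.gen_rate_const_mul, mul_one, mul_assoc] at hG1
  have hG2 := abs_gen_le (a := a 0) hR y (fun ν hν => D.rate_bounds.bound 0 h0mem ν hν y)
    (f := fun w => gen (a (θ * h)) f w - gen (a 0) f w) (F := P * (θ * h)) (fun w => by
      rw [← IsFlow.gen_rate_sub]
      refine (abs_gen_le (A := R * (θ * h)) (by positivity) w
        (fun ν hν => D.rate_bounds.lipschitz (θ * h) hθmem ν hν w) hf).trans ?_
      calc 2 * (Fintype.card (Jump d S) : ℝ) * (R * (θ * h)) * 1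
          = 2 * Fintype.card (Jump d S) * R * (θ * h) := by ring
        _ ≤ P * (θ * h) := by gcongr)
  rw [gen_sub] at hG2
  rw [mul_one] at hA1 hA2 hexp
  exact abs_sub_le_of_expansions hθ hh hh1 hP1 hK0 (Nat.cast_nonneg _) hR hP he₀0 he₁0 hs0 hF hexp
    hA1 hA2 hB hC hD (by simpa only [mul_assoc] using hG1) hG2

end StepData

/-! ### The relative entropy produced in one step -/

namespace StepData

variable {θ m R h : ℝ} {a : ℝ → Torus d S → Torus d S → ℝ}
  {a' b₀ b₁ : Torus d S → Torus d S → ℝ} {charged : Torus d S → Prop}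
  {perm : Torus d S → Torus d S → Prop} {q : Torus d S → ℝ} {v : Torus d S → ℝ → Torus d S → ℝ}

/-- The estimation error at the intermediate time, averaged over the true law at that time, controls
the estimation errors seen from the law at the beginning of the step: at the current state, and
after one true jump. -/
lemma sum_mul_rateDist_le (D : StepData θ m R h a a' b₀ b₁ charged perm)
    (hθ : θ ∈ Set.Ioo (0 : ℝ) 1) (hh : 0 < h) (hsmall : Fintype.card (Jump d S) * R * h ≤ 1 / 2)
    (hq0 : ∀ y, 0 ≤ q y) (hq1 : ∑ y, q y = 1) (hqc : ∀ y, 0 < q y → charged y)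
    (hv : ∀ y, IsFlow a h y (v y)) :
    ∑ y, q y * (1 / 2 * rateDist (fun ν => a (θ * h) ν y) (fun ν => b₁ ν y) +
        θ * h * ∑ ν : Jump d S, a 0 ν y *
          rateDist (fun ν₁ => a (θ * h) ν₁ (y + ν)) (fun ν₁ => b₁ ν₁ (y + ν))) ≤
      ∑ z, (∑ y, q y * v y (θ * h) z) * rateDist (fun ν => a (θ * h) ν z) (fun ν => b₁ ν z) +
        (2 * Fintype.card (Jump d S) * R + (2 * Fintype.card (Jump d S) * R) ^ 2) *
          (Fintype.card (Jump d S) * R) * h ^ 2 := by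
  classical
  have hR := D.rate_bounds.nonneg
  have h0mem : (0 : ℝ) ∈ Set.Icc 0 h := ⟨le_rfl, hh.le⟩
  have hx0 : 0 ≤ θ * h := (mul_pos hθ.1 hh).le
  have hxh : θ * h ≤ h := mul_le_of_le_one_left hh.le hθ.2.le
  have hxmem : θ * h ∈ Set.Icc 0 h := ⟨hx0, hxh⟩
  set e : Torus d S → ℝ := fun z => rateDist (fun ν => a (θ * h) ν z) (fun ν => b₁ ν z) with he
  have he0 : ∀ z, 0 ≤ e z := fun z => rateDist_nonneg _ _
  -- the estimated rates are not controlled at states that are not charged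
  let f : Torus d S → ℝ := fun z => if charged z then e z else 0
  have hf0 : ∀ z, 0 ≤ f z := fun z => by
    by_cases hz : charged z
    · simpa [f, hz] using he0 z
    · simp [f, hz]
  have hfe : ∀ z, f z ≤ e z := fun z => by
    by_cases hz : charged z
    · simp [f, hz]
    · simpa [f, hz] using he0 z
  have hfb : ∀ z, |f z| ≤ Fintype.card (Jump d S) * R := fun z => by
    rw [abs_of_nonneg (hf0 z)]
    by_cases hz : charged z
    · simp only [f, hz, if_true, he]
      refine sum_jump_le (g := fun ν => |a (θ * h) ν z - b₁ ν z|) fun ν hν => ?_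
      have i1 := D.rate_nonneg _ hxmem ν hν z
      have i2 := (le_abs_self _).trans (D.rate_bounds.bound _ hxmem ν hν z)
      have i3 := D.b₁_nonneg ν hν z
      have i4 := D.b₁_le ν hν z hz
      rw [abs_le]; constructor <;> linarith
    · simp only [f, hz, if_false]; positivity
  set B := (2 * Fintype.card (Jump d S) * R + (2 * Fintype.card (Jump d S) * R) ^ 2) *
          (Fintype.card (Jump d S) * R) with hB
  have hB0 : 0 ≤ B := by positivity
  have hpoint : ∀ y, 0 < q y → 1 / 2 * e y + θ * h * ∑ ν : Jump d S, a 0 ν y * e (y + ν) ≤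
      ∑ z, v y (θ * h) z * f z + B * h ^ 2 := by
    intro y hy
    have hcy := hqc y hy
    have h1 := (abs_le.1 ((hv y).abs_sum_sub_first_order_le D.rate_bounds hfb hxmem)).1
    have h2 : gen (a 0) f y = ∑ ν : Jump d S, a 0 ν y * e (y + ν)
        - (∑ ν : Jump d S, a 0 ν y) * e y := by
      rw [gen, Finset.sum_mul, ← Finset.sum_sub_distrib]
      refine Finset.sum_congr rfl fun ν _ => ?_
      by_cases hp : perm ν y
      · simp only [f, hcy, (D.charged_add ν ν.2 y hp).2, if_true]
        ring
      · rw [D.rate_eq_zero 0 h0mem ν ν.2 y hp]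
        ring
    have h3 : ∑ ν : Jump d S, a 0 ν y ≤ Fintype.card (Jump d S) * R :=
      sum_jump_le (g := fun ν => a 0 ν y) fun ν hν =>
        (le_abs_self _).trans (D.rate_bounds.bound _ h0mem ν hν y)
    -- the process stays at its current state with probability at least `1 / 2`, to first order
    have h4 : θ * h * (∑ ν : Jump d S, a 0 ν y) ≤ 1 / 2 := by
      calc θ * h * (∑ ν : Jump d S, a 0 ν y) ≤ h * (Fintype.card (Jump d S) * R) :=
            mul_le_mul hxh h3 (Finset.sum_nonneg fun ν _ => D.rate_nonneg 0 h0mem ν ν.2 y) hh.le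
        _ ≤ 1 / 2 := by linarith
    have h5 : B * (θ * h) ^ 2 ≤ B * h ^ 2 :=
      mul_le_mul_of_nonneg_left (pow_le_pow_left₀ hx0 hxh 2) hB0
    have h6 : f y = e y := by simp [f, hcy]
    have h7 := mul_le_mul_of_nonneg_right h4 (he0 y)
    rw [h2, h6] at h1
    linarith
  calc ∑ y, q y * (1 / 2 * e y + θ * h * ∑ ν : Jump d S, a 0 ν y * e (y + ν))
      ≤ ∑ y, q y * (∑ z, v y (θ * h) z * f z + B * h ^ 2) := by
        refine Finset.sum_le_sum fun y _ => ?_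
        rcases (hq0 y).eq_or_lt with h0 | h0
        · simp [← h0]
        · exact mul_le_mul_of_nonneg_left (hpoint y h0) h0.le
    _ = ∑ z, (∑ y, q y * v y (θ * h) z) * f z + B * h ^ 2 := by
        simp only [mul_add, Finset.sum_add_distrib, ← Finset.sum_mul, hq1, one_mul]
        congr 1
        simp only [Finset.mul_sum, Finset.sum_mul, ← mul_assoc]
        exact Finset.sum_comm
    _ ≤ _ := by
        refine add_le_add (Finset.sum_le_sum fun z _ => mul_le_mul_of_nonneg_left (hfe z) ?_) le_rfl
        exact Finset.sum_nonneg fun y _ => mul_nonneg (hq0 y) ((hv y).nonneg _ hxmem z)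

/-- The relative entropy of the exact transition with respect to one step of the sampler, averaged
over the true law at the beginning of the step. -/
lemma exists_sum_klTerm_le (d S : ℕ) [NeZero S] {θ m R : ℝ} (hθ : θ ∈ Set.Ioo (0 : ℝ) 1)
    (hm : 0 < m) (hR : 0 ≤ R) :
    ∃ C κ₀ : ℝ, 0 ≤ C ∧ 0 < κ₀ ∧ ∀ {h ε : ℝ} {a : ℝ → Torus d S → Torus d S → ℝ}
      {a' b₀ b₁ : Torus d S → Torus d S → ℝ} {charged : Torus d S → Prop}
      {perm : Torus d S → Torus d S → Prop} {q : Torus d S → ℝ}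
      {v : Torus d S → ℝ → Torus d S → ℝ}, StepData θ m R h a a' b₀ b₁ charged perm →
      0 < h → h ≤ κ₀ → (∀ y, 0 ≤ q y) → ∑ y, q y = 1 → (∀ y, 0 < q y → charged y) →
      (∀ y, IsFlow a h y (v y)) → 0 ≤ ε →
      ∑ y, q y * rateDist (fun ν => a 0 ν y) (fun ν => b₀ ν y) ≤ ε →
      ∑ z, (∑ y, q y * v y (θ * h) z) * rateDist (fun ν => a (θ * h) ν z) (fun ν => b₁ ν z) ≤ ε →
      (∀ y, 0 < q y → ∀ z, stepKernel θ h b₀ b₁ y z = 0 → v y h z = 0) ∧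
      ∑ y, q y * ∑ z, klTerm (v y h z) (stepKernel θ h b₀ b₁ y z) ≤ C * (h ^ 3 + h * ε) := by
  obtain ⟨C₁, κ₁, hC₁, hκ₁, hdom⟩ := exists_flow_le_mul_stepKernel d S hθ hm hR
  obtain ⟨C₂, hC₂, hloc⟩ := exists_abs_flow_sub_stepKernel_le d S hθ hm hR
  have hθ0 := hθ.1
  set J : ℝ := (Fintype.card (Jump d S) : ℝ) with hJ
  have hJ0 : 0 ≤ J := Nat.cast_nonneg _
  set B : ℝ := (2 * J * R + (2 * J * R) ^ 2) * (J * R) with hB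
  have hB0 : 0 ≤ B := by positivity
  set A : ℝ := (Fintype.card (Torus d S) : ℝ) * ((1 + C₁) * C₂) with hA
  have hA0 : 0 ≤ A := by positivity
  refine ⟨A * ((3 + θ⁻¹) * (1 + B)), min κ₁ (min 1 (2 * (J * R + 1))⁻¹), by positivity,
    lt_min hκ₁ (lt_min one_pos (by positivity)), ?_⟩
  intro h ε a a' b₀ b₁ charged perm q v D hh hhκ hq0 hq1 hqc hv hε hε₀ hε₁
  have hh1 : h ≤ κ₁ := hhκ.trans (min_le_left _ _)
  have hh2 : h ≤ 1 := hhκ.trans ((min_le_right _ _).trans (min_le_left _ _))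
  have hh3 : J * R * h ≤ 1 / 2 := by
    have h1 : h ≤ (2 * (J * R + 1))⁻¹ := hhκ.trans ((min_le_right _ _).trans (min_le_right _ _))
    have h2 : 0 ≤ J * R := by positivity
    have h3 := mul_le_mul_of_nonneg_left h1 (by positivity : 0 ≤ 2 * (J * R + 1))
    rw [mul_inv_cancel₀ (by positivity)] at h3
    linarith
  have hK0 : ∀ y z, 0 ≤ stepKernel θ h b₀ b₁ y z := fun y z =>
    Finset.sum_nonneg fun _ _ => mul_nonneg measureReal_nonneg measureReal_nonneg
  have hhmem : h ∈ Set.Icc 0 h := ⟨hh.le, le_rfl⟩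
  refine ⟨fun y hy z hz => ?_, ?_⟩
  · have := hdom D hh hh1 (hv y) (hqc y hy) z
    rw [hz, mul_zero] at this
    exact le_antisymm this ((hv y).nonneg h hhmem z)
  set e₀ : Torus d S → ℝ := fun y => rateDist (fun ν => a 0 ν y) (fun ν => b₀ ν y) with he₀
  set e₁ : Torus d S → ℝ := fun y => rateDist (fun ν => a (θ * h) ν y) (fun ν => b₁ ν y) with he₁
  let s : Torus d S → ℝ := fun y => ∑ ν : Jump d S, a 0 ν y * e₁ (y + ν)
  have hpoint : ∀ y, 0 < q y → ∑ z, klTerm (v y h z) (stepKernel θ h b₀ b₁ y z) ≤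
      A * (h ^ 3 + h * (e₁ y + e₀ y) + h ^ 2 * s y) := by
    intro y hy
    calc ∑ z, klTerm (v y h z) (stepKernel θ h b₀ b₁ y z)
        ≤ ∑ _z : Torus d S, (1 + C₁) * (C₂ * (h ^ 3 + h * (e₁ y + e₀ y) + h ^ 2 * s y)) := by
          refine Finset.sum_le_sum fun z _ => ?_
          refine (klTerm_le_abs_sub ((hv y).nonneg h hhmem z) (hK0 y z)
            (hdom D hh hh1 (hv y) (hqc y hy) z)).trans ?_
          exact mul_le_mul_of_nonneg_left (hloc D hh hh2 (hv y) (hqc y hy) z) (by positivity)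
      _ = _ := by
          rw [Finset.sum_const, Finset.card_univ, nsmul_eq_mul, hA]; ring
  have hmid := D.sum_mul_rateDist_le hθ hh hh3 hq0 hq1 hqc hv
  have hmid' : 1 / 2 * ∑ y, q y * e₁ y + θ * h * ∑ y, q y * s y ≤ ε + B * h ^ 2 := by
    refine le_trans (le_of_eq ?_) (hmid.trans (add_le_add hε₁ le_rfl))
    rw [Finset.mul_sum, Finset.mul_sum, ← Finset.sum_add_distrib]
    exact Finset.sum_congr rfl fun y _ => by simp only [s, he₁]; ring
  have hE₁ : 0 ≤ ∑ y, q y * e₁ y :=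
    Finset.sum_nonneg fun y _ => mul_nonneg (hq0 y) (rateDist_nonneg _ _)
  have hs0 : 0 ≤ ∑ y, q y * s y := Finset.sum_nonneg fun y _ => mul_nonneg (hq0 y) <|
    Finset.sum_nonneg fun ν _ => mul_nonneg (D.rate_nonneg 0 ⟨le_rfl, hh.le⟩ ν ν.2 y)
      (rateDist_nonneg _ _)
  have hs1 : h * ∑ y, q y * s y ≤ θ⁻¹ * (ε + B * h ^ 2) := by
    have h1 : θ * (h * ∑ y, q y * s y) ≤ ε + B * h ^ 2 := by linarith
    have h2 := mul_le_mul_of_nonneg_left h1 (inv_nonneg.2 hθ0.le)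
    rwa [← mul_assoc, inv_mul_cancel₀ hθ0.ne', one_mul] at h2
  have hE₁' : ∑ y, q y * e₁ y ≤ 2 * (ε + B * h ^ 2) := by
    have : 0 ≤ θ * h * ∑ y, q y * s y := by positivity
    linarith
  have hsum : ∑ y, q y * (h ^ 3 + h * (e₁ y + e₀ y) + h ^ 2 * s y) =
      h ^ 3 + h * (∑ y, q y * e₁ y + ∑ y, q y * e₀ y) + h * (h * ∑ y, q y * s y) := by
    calc _ = ∑ y, (h ^ 3 * q y + (h * (q y * e₁ y) + h * (q y * e₀ y)) + h ^ 2 * (q y * s y)) :=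
          Finset.sum_congr rfl fun y _ => by ring
      _ = _ := by
          simp only [Finset.sum_add_distrib, ← Finset.mul_sum, hq1]; ring
  calc ∑ y, q y * ∑ z, klTerm (v y h z) (stepKernel θ h b₀ b₁ y z)
      ≤ ∑ y, q y * (A * (h ^ 3 + h * (e₁ y + e₀ y) + h ^ 2 * s y)) := by
        refine Finset.sum_le_sum fun y _ => ?_
        rcases (hq0 y).eq_or_lt with h0 | h0
        · simp [← h0]
        · exact mul_le_mul_of_nonneg_left (hpoint y h0) h0.le
    _ = A * ∑ y, q y * (h ^ 3 + h * (e₁ y + e₀ y) + h ^ 2 * s y) := by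
        rw [Finset.mul_sum]; exact Finset.sum_congr rfl fun y _ => by ring
    _ ≤ A * (h ^ 3 + h * (2 * (ε + B * h ^ 2) + ε) + h * (θ⁻¹ * (ε + B * h ^ 2))) := by
        rw [hsum]
        refine mul_le_mul_of_nonneg_left (add_le_add (add_le_add le_rfl ?_) ?_) hA0
        · exact mul_le_mul_of_nonneg_left (add_le_add hE₁' hε₀) hh.le
        · exact mul_le_mul_of_nonneg_left hs1 hh.le
    _ ≤ A * ((3 + θ⁻¹) * (1 + B) * (h ^ 3 + h * ε)) := by
        refine mul_le_mul_of_nonneg_left ?_ hA0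
        have hi : 0 ≤ θ⁻¹ := inv_nonneg.2 hθ0.le
        have i1 : 0 ≤ h ^ 3 := by positivity
        have i2 : 0 ≤ h * ε := by positivity
        have i3 : 0 ≤ B * h ^ 3 := by positivity
        have i4 : 0 ≤ B * (h * ε) := by positivity
        have i5 : 0 ≤ θ⁻¹ * h ^ 3 := by positivity
        have i6 : 0 ≤ θ⁻¹ * B * (h * ε) := by positivity
        linarith
    _ = _ := by ring

end StepData

/-! ### One step of the backward process -/

lemma C2Bounded.congr {M τ : ℝ} {f f₁ : ℝ → ℝ} (hf : C2Bounded M τ f)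
    (h : Set.EqOn f₁ f (Set.Icc 0 τ)) : C2Bounded M τ f₁ :=
  ⟨hf.1.congr h, fun k hk s hs => by
    rw [iteratedDerivWithin_congr h hs]
    exact hf.2 k hk s hs⟩

namespace RegularIntensities

variable {T δ m M : ℝ} {F : ForwardProcess d S T} {μ' : ℝ → Torus d S → Torus d S → ℝ}

lemma sub_mem_Icc (hδ : 0 ≤ δ) {s : ℝ} (hs : s ∈ Set.Icc 0 (T - δ)) : T - s ∈ Set.Icc 0 T :=
  ⟨by linarith [hs.2], by linarith [hs.1]⟩

/-- At states that are not achievable, the true intensity vanishes, because division by zero gives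
the score the value zero. -/
lemma c2Bounded_intensity (hreg : RegularIntensities F μ' δ m M) (hδ : 0 ≤ δ) {ν : Torus d S}
    (hν : ν ≠ 0) (y : Torus d S) : C2Bounded (max M 0) (T - δ) fun s => F.intensity s ν y := by
  by_cases hy : ∃ s ∈ Set.Icc 0 (T - δ), 0 < F.law (T - s) y
  · exact (hreg.smooth ν hν y hy).1.mono (le_max_left _ _)
  · refine (C2Bounded.zero (le_max_right _ _)).congr fun s hs => ?_
    have h0 : F.law (T - s) y = 0 := le_antisymm (not_lt.1 fun h => hy ⟨s, hs, h⟩)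
      (F.law_nonneg (sub_mem_Icc hδ hs) y)
    simp [ForwardProcess.intensity, ForwardProcess.intensityOf, ForwardProcess.score, h0]

lemma le_of_permissible (hreg : RegularIntensities F μ' δ m M) (hδ : 0 ≤ δ) {ν : Torus d S}
    (hν : ν ≠ 0) {y : Torus d S} (hp : ∃ u ∈ Set.Icc 0 (T - δ), 0 < F.intensity u ν y)
    {s : ℝ} (hs : s ∈ Set.Icc 0 (T - δ)) : m ≤ F.intensity s ν y ∧ m ≤ μ' s ν y := by
  obtain ⟨u, hu, hp⟩ := hp
  exact hreg.lower ν hν y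
    ⟨u, hu, (F.law_pos_of_intensity_pos (sub_mem_Icc hδ hu) hp).1, hp⟩ s hs

/-- The data of a step of length `h` that starts at the backward time `s`. -/
lemma stepData (hreg : RegularIntensities F μ' δ m M) (hδ : 0 ≤ δ) (hm : 0 < m) {θ : ℝ}
    (hθ : θ ∈ Set.Ioo (0 : ℝ) 1)
    (hμ' : ∀ s ∈ Set.Icc 0 (T - δ), ∀ ν ≠ 0, ∀ y, 0 ≤ μ' s ν y) {s h : ℝ} (hs : 0 ≤ s)
    (hh : 0 < h) (hsh : s + h ≤ T - δ)
    (hext : ∀ y, 0 < F.law (T - s) y → ∀ z, 0 < (leap y fun ν => μ' s ν y * (θ * h)).real {z} →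
      ∀ ν ≠ 0, 0 ≤ alpha₁ θ * μ' (s + θ * h) ν z - alpha₂ θ * μ' s ν y) :
    StepData θ m (max M 0) h (fun x => F.intensity (s + x))
      (fun ν y => derivWithin (fun u => F.intensity u ν y) (Set.Icc 0 (T - δ)) s)
      (μ' s) (μ' (s + θ * h)) (fun y => 0 < F.law (T - s) y)
      (fun ν y => ∃ u ∈ Set.Icc 0 (T - δ), 0 < F.intensity u ν y) := by
  have hτ : 0 < T - δ := by linarith
  have hmem : ∀ x ∈ Set.Icc 0 h, s + x ∈ Set.Icc 0 (T - δ) := fun x hx =>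
    ⟨add_nonneg hs hx.1, by linarith [hx.2]⟩
  have hx0 : 0 ≤ θ * h := (mul_pos hθ.1 hh).le
  have hxh : θ * h ≤ h := mul_le_of_le_one_left hh.le hθ.2.le
  have hsmem : s ∈ Set.Icc 0 (T - δ) := ⟨hs, by linarith⟩
  have hρmem : s + θ * h ∈ Set.Icc 0 (T - δ) := hmem _ ⟨hx0, hxh⟩
  have hc2 : ∀ ν ≠ 0, ∀ y, 0 < F.law (T - s) y →
      C2Bounded (max M 0) (T - δ) fun s => μ' s ν y := fun ν hν y hy =>
    (hreg.smooth ν hν y ⟨s, hsmem, hy⟩).2.mono (le_max_left _ _)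
  refine
    { rate_bounds :=
        { nonneg := le_max_right _ _
          bound := fun x hx ν hν y => (hreg.c2Bounded_intensity hδ hν y).abs_le (hmem x hx)
          lipschitz := fun x hx ν hν y => ?_
          deriv_bound := fun ν hν y => (hreg.c2Bounded_intensity hδ hν y).abs_derivWithin_le hsmem
          affine := fun x hx ν hν y => ?_ }
      rate_nonneg := fun x hx ν hν y => F.intensity_nonneg (sub_mem_Icc hδ (hmem x hx)) hν y
      b₀_nonneg := hμ' s hsmem
      b₁_nonneg := hμ' _ hρmem
      b₀_le := fun ν hν y hy => (le_abs_self _).trans ((hc2 ν hν y hy).abs_le hsmem)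
      b₁_le := fun ν hν y hy => (le_abs_self _).trans ((hc2 ν hν y hy).abs_le hρmem)
      b_lipschitz := fun ν hν y hy => ?_
      charged_add := fun ν hν y hp => F.law_pos_of_intensity_pos (sub_mem_Icc hδ hsmem)
        (hm.trans_le (hreg.le_of_permissible hδ hν hp hsmem).1)
      le_b₀ := fun ν hν y hp => (hreg.le_of_permissible hδ hν hp hsmem).2
      rate_eq_zero := fun x hx ν hν y hp => ?_
      extrapolated_nonneg := hext }
  · have := (hreg.c2Bounded_intensity hδ hν y).abs_sub_le hsmem (hmem x hx)
    simpa [abs_of_nonneg hx.1] using this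
  · have := (hreg.c2Bounded_intensity hδ hν y).abs_sub_affine_le hτ hsmem hx.1 (hmem x hx)
    simpa using this
  · refine ((hc2 ν hν y hy).abs_sub_le hsmem hρmem).trans ?_
    rw [add_sub_cancel_left, abs_of_nonneg hx0]
    exact mul_le_mul_of_nonneg_left hxh (le_max_right _ _)
  · exact le_antisymm (not_lt.1 fun h => hp ⟨_, hmem x hx, h⟩)
      (F.intensity_nonneg (sub_mem_Icc hδ (hmem x hx)) hν y)

/-- The transition probabilities of the backward process during a step. When `δ = 0`, the backward
equation of the laws may fail at the end `s + h = T` of the last step, but is not needed there. -/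
lemma exists_isFlow (hreg : RegularIntensities F μ' δ m M) (hδ : 0 ≤ δ) {s h : ℝ} (hs : 0 ≤ s)
    (hh : 0 < h) (hsh : s + h ≤ T - δ) (hsmall : 2 * fieldBound d S (max M 0) * h ≤ 1) :
    ∃ v : Torus d S → ℝ → Torus d S → ℝ, (∀ y, IsFlow (fun x => F.intensity (s + x)) h y (v y)) ∧
      ∀ x ∈ Set.Icc 0 h, ∀ z, F.law (T - (s + x)) z = ∑ y, F.law (T - s) y * v y x z := by
  have hmem : ∀ x ∈ Set.Icc 0 h, s + x ∈ Set.Icc 0 (T - δ) := fun x hx =>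
    ⟨add_nonneg hs hx.1, by linarith [hx.2]⟩
  have hb : ∀ x ∈ Set.Icc 0 h, ∀ ν ≠ 0, ∀ y, |F.intensity (s + x) ν y| ≤ max M 0 :=
    fun x hx ν hν y => (hreg.c2Bounded_intensity hδ hν y).abs_le (hmem x hx)
  choose v hv using fun y => DiscreteDiffusion.exists_isFlow
    (a := fun x => F.intensity (s + x)) hh.le (le_max_right M 0)
    (fun x hx ν hν y => F.intensity_nonneg (sub_mem_Icc hδ (hmem x hx)) hν y)
    (fun x hx ν hν y => (le_abs_self _).trans (hb x hx ν hν y))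
    (fun ν hν y => (hreg.c2Bounded_intensity hδ hν y).1.continuousOn.comp
      (continuous_const.add continuous_id).continuousOn hmem) hsmall y
  refine ⟨v, hv, fun x hx z => ?_⟩
  have key := eq_sum_mul_flow (le_max_right M 0) hb hv (q := fun x z => F.law (T - (s + x)) z)
    (fun z x hx => ?_) (fun x hx z => ?_) hx z
  · simpa using key
  · exact ((F.law_deriv _ (sub_mem_Icc hδ (hmem x hx)) z).continuousWithinAt).comp
      (f := fun x => T - (s + x)) (by fun_prop) fun u hu => sub_mem_Icc hδ (hmem u hu)
  · have hx' : x ∈ Set.Icc 0 h := ⟨hx.1, hx.2.le⟩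
    have h1 := F.hasDerivWithinAt_law_sub (s := s + x)
      ⟨by linarith [hx.2], by linarith [hx.1]⟩ z
    have h2 := h1.scomp x ((hasDerivWithinAt_id x (Set.Icc 0 h)).const_add s)
      (fun u hu => ⟨(hmem u hu).1, (hmem u hu).2.trans (sub_le_self T hδ)⟩)
    rw [one_smul] at h2
    exact hasDerivWithinAt_Ici_of_Icc hx h2

/-- Each term of the score entropy is a relative entropy between intensities. -/
lemma entropy_nonneg (hreg : RegularIntensities F μ' δ m M) (hδ : 0 ≤ δ) (hm : 0 < m)
    (hμ' : ∀ s ∈ Set.Icc 0 (T - δ), ∀ ν ≠ 0, ∀ y, 0 ≤ μ' s ν y) {s : ℝ}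
    (hs : s ∈ Set.Icc 0 (T - δ)) : 0 ≤ ∑ y, F.law (T - s) y * ∑ ν : Jump d S,
      (F.intensity s ν y * (Real.log (F.intensity s ν y / μ' s ν y) - 1) + μ' s ν y) := by
  refine Finset.sum_nonneg fun y _ => mul_nonneg (F.law_nonneg (sub_mem_Icc hδ hs) y) <|
    Finset.sum_nonneg fun ν _ => ?_
  have h0 := F.intensity_nonneg (sub_mem_Icc hδ hs) ν.2 y
  have h := klTerm_nonneg h0 (hμ' s hs ν ν.2 y) fun h => by
    by_contra hne
    have := (hreg.le_of_permissible hδ ν.2 ⟨s, hs, h0.lt_of_ne (Ne.symm hne)⟩ hs).2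
    linarith
  unfold klTerm at h
  linarith

end RegularIntensities

/-! ### The law of the sampler -/

lemma bind_real_singleton {X : Type*} [Fintype X] [MeasurableSpace X] [MeasurableSingletonClass X]
    (P : Measure X) [IsFiniteMeasure P] (κ : X → Measure X) [∀ x, IsProbabilityMeasure (κ x)]
    (z : X) : (P.bind κ).real {z} = ∑ x, P.real {x} * (κ x).real {z} := by
  have hκ : Measurable κ := measurable_of_finite κ
  rw [Measure.real, Measure.bind_apply (measurableSet_singleton z) hκ.aemeasurable,
    lintegral_fintype, ENNReal.toReal_sum fun x _ => ENNReal.mul_ne_top (measure_ne_top _ _)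
      (measure_ne_top _ _)]
  exact Finset.sum_congr rfl fun x _ => by rw [ENNReal.toReal_mul, mul_comm]; rfl

lemma isProbabilityMeasure_bind {X : Type*} [Finite X] [MeasurableSpace X]
    [MeasurableSingletonClass X] (P : Measure X) [IsProbabilityMeasure P] (κ : X → Measure X)
    [∀ x, IsProbabilityMeasure (κ x)] : IsProbabilityMeasure (P.bind κ) := by
  refine ⟨?_⟩
  rw [Measure.bind_apply MeasurableSet.univ (measurable_of_finite κ).aemeasurable]
  simp

section Sampler

variable {τ θ : ℝ} {μ' : ℝ → Torus d S → Torus d S → ℝ} {g : TimeGrid τ} {q₀ : Measure (Torus d S)}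

instance (n : ℕ) (y : Torus d S) : IsProbabilityMeasure (firstStage μ' g θ n y) := by
  unfold firstStage; infer_instance

instance (n : ℕ) (y y' : Torus d S) : IsProbabilityMeasure (secondStage μ' g θ n y y') := by
  unfold secondStage; infer_instance

instance (n : ℕ) (y : Torus d S) :
    IsProbabilityMeasure ((firstStage μ' g θ n y).bind (secondStage μ' g θ n y)) :=
  isProbabilityMeasure_bind _ _

instance [IsProbabilityMeasure q₀] (n : ℕ) : IsProbabilityMeasure (trapLaw μ' g θ q₀ n) := by
  induction n with
  | zero => assumption
  | succ n ih => exact isProbabilityMeasure_bind _ _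

lemma stepKernel_eq_bind (n : ℕ) (y z : Torus d S) :
    stepKernel θ (g.step n) (μ' (g.pt n)) (μ' (g.sectionPt θ n)) y z =
      ((firstStage μ' g θ n y).bind (secondStage μ' g θ n y)).real {z} :=
  (bind_real_singleton _ _ _).symm

lemma trapLaw_succ_real_singleton [IsProbabilityMeasure q₀] (n : ℕ) (z : Torus d S) :
    (trapLaw μ' g θ q₀ (n + 1)).real {z} = ∑ y, (trapLaw μ' g θ q₀ n).real {y} *
      stepKernel θ (g.step n) (μ' (g.pt n)) (μ' (g.sectionPt θ n)) y z := by
  simp only [stepKernel_eq_bind]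
  exact bind_real_singleton _ _ _

/-- On a finite space, almost sure statements hold at every point of positive mass. -/
lemma ExtrapolationNonneg.nonneg (h : ExtrapolationNonneg μ' g θ q₀) {n : ℕ} (hn : n < g.N)
    {y : Torus d S} (hy : (trapLaw μ' g θ q₀ n).real {y} ≠ 0) {z : Torus d S}
    (hz : 0 < (firstStage μ' g θ n y).real {z}) : ∀ ν ≠ 0, 0 ≤ extrapolated μ' g θ n y z ν := by
  have aux : ∀ {P : Measure (Torus d S)} {p : Torus d S → Prop} {x : Torus d S},
      (∀ᵐ x ∂P, p x) → P.real {x} ≠ 0 → p x := by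
    intro P p x hp hx
    by_contra hne
    exact hx (by rw [Measure.real, measure_mono_null (Set.singleton_subset_iff.2 hne) hp]; rfl)
  exact aux (aux (h n hn) hy) hz.ne'

end Sampler

namespace TimeGrid

variable {τ : ℝ} (g : TimeGrid τ)

lemma step_pos {n : ℕ} (hn : n < g.N) : 0 < g.step n := sub_pos.2 (g.pt_lt n hn)

lemma sum_step (n : ℕ) : ∑ i ∈ Finset.range n, g.step i = g.pt n := by
  simp only [step, Finset.sum_range_sub, g.pt_zero, sub_zero]

lemma pt_add_step (n : ℕ) : g.pt n + g.step n = g.pt (n + 1) := by simp [step]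

lemma sectionPt_eq (θ : ℝ) (n : ℕ) : g.sectionPt θ n = g.pt n + θ * g.step n := by
  simp only [sectionPt, step]; ring

lemma pt_nonneg {n : ℕ} (hn : n ≤ g.N) : 0 ≤ g.pt n := by
  rw [← g.sum_step]
  exact Finset.sum_nonneg fun i hi =>
    (g.step_pos ((Finset.mem_range.1 hi).trans_le hn)).le

lemma pt_le {n : ℕ} (hn : n ≤ g.N) : g.pt n ≤ τ := by
  refine le_trans ?_ g.pt_last.le
  rw [← g.sum_step n, ← g.sum_step g.N]
  exact Finset.sum_le_sum_of_subset_of_nonneg (Finset.range_mono hn)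
    fun i hi _ => (g.step_pos (Finset.mem_range.1 hi)).le

lemma step_le_maxStep {n : ℕ} (hn : n < g.N) : g.step n ≤ g.maxStep :=
  le_ciSup (f := fun n : Fin g.N => g.step n) (Set.finite_range _).bddAbove ⟨n, hn⟩

lemma N_pos (hτ : 0 < τ) : 0 < g.N := by
  refine Nat.pos_of_ne_zero fun h => ?_
  have := g.pt_last
  rw [h, g.pt_zero] at this
  exact hτ.ne this

end TimeGrid

/-! ### Accumulation of the relative entropy over the steps -/

/-- One step of the sampler preserves absolute continuity of the true law and increases the relative
entropy by at most the local error. -/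
lemma exists_sum_klTerm_succ_le (d S : ℕ) [NeZero S] {θ : ℝ} (hθ : θ ∈ Set.Ioo (0 : ℝ) 1)
    {m : ℝ} (M : ℝ) (hm : 0 < m) :
    ∃ C κ₀ : ℝ, 0 ≤ C ∧ 0 < κ₀ ∧ ∀ {T δ : ℝ}, 0 ≤ δ → ∀ {F : ForwardProcess d S T}
      {μ' : ℝ → Torus d S → Torus d S → ℝ} {g : TimeGrid (T - δ)} {εI εII : ℝ}
      {q₀ : Measure (Torus d S)} [IsProbabilityMeasure q₀],
      (∀ s ∈ Set.Icc 0 (T - δ), ∀ ν ≠ 0, ∀ y, 0 ≤ μ' s ν y) →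
      RegularIntensities F μ' δ m M → EstimationError F μ' g θ εI εII →
      ExtrapolationNonneg μ' g θ q₀ → 0 ≤ εII → ∀ n < g.N, g.step n ≤ κ₀ →
      (∀ z, (trapLaw μ' g θ q₀ n).real {z} = 0 → F.law (T - g.pt n) z = 0) →
      (∀ z, (trapLaw μ' g θ q₀ (n + 1)).real {z} = 0 → F.law (T - g.pt (n + 1)) z = 0) ∧
      ∑ z, klTerm (F.law (T - g.pt (n + 1)) z) ((trapLaw μ' g θ q₀ (n + 1)).real {z}) ≤
        ∑ z, klTerm (F.law (T - g.pt n) z) ((trapLaw μ' g θ q₀ n).real {z}) +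
          C * (g.step n ^ 3 + g.step n * εII) := by
  obtain ⟨C, κ₁, hC, hκ₁, hstep⟩ :=
    StepData.exists_sum_klTerm_le d S hθ hm (le_max_right M 0)
  have hB0 : 0 ≤ fieldBound d S (max M 0) := by
    have := le_max_right M 0
    unfold fieldBound; positivity
  -- the second bound on the step makes the transition law exist
  refine ⟨C, min κ₁ (2 * fieldBound d S (max M 0) + 1)⁻¹, hC, lt_min hκ₁ (by positivity), ?_⟩
  intro T δ hδ F μ' g εI εII q₀ _ hμ' hreg hest hext hε n hn hκ hac
  set h := g.step n with hh
  set s := g.pt n with hs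
  have hh0 : 0 < h := g.step_pos hn
  have hs0 : 0 ≤ s := g.pt_nonneg hn.le
  have hsh : s + h = g.pt (n + 1) := g.pt_add_step n
  have hsh' : s + h ≤ T - δ := hsh.trans_le (g.pt_le hn)
  have hρ : g.sectionPt θ n = s + θ * h := g.sectionPt_eq θ n
  have hsmall : 2 * fieldBound d S (max M 0) * h ≤ 1 := by
    have h1 := mul_le_mul_of_nonneg_left (hκ.trans (min_le_right _ _))
      (by positivity : 0 ≤ 2 * fieldBound d S (max M 0) + 1)
    rw [mul_inv_cancel₀ (by positivity)] at h1
    linarith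
  obtain ⟨v, hv, hlaw⟩ := hreg.exists_isFlow hδ hs0 hh0 hsh' hsmall
  have D := hreg.stepData hδ hm hθ hμ' hs0 hh0 hsh' fun y hy z hz ν hν => by
    have := hext.nonneg hn (fun h0 => hy.ne' (hac y h0)) hz ν hν
    rwa [extrapolated, hρ] at this
  rw [← hρ] at D
  have hxmem : θ * h ∈ Set.Icc 0 h :=
    ⟨(mul_pos hθ.1 hh0).le, mul_le_of_le_one_left hh0.le hθ.2.le⟩
  have hhmem : h ∈ Set.Icc 0 h := ⟨hh0.le, le_rfl⟩
  have hTs : T - s ∈ Set.Icc 0 T := ⟨by linarith, by linarith⟩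
  have hq := F.law_mem _ hTs
  obtain ⟨hdom, hle⟩ := hstep (q := F.law (T - s)) (ε := εII) D hh0
    (hκ.trans (min_le_left _ _)) hq.1 hq.2 (fun y hy => hy) hv hε
    (by simpa [rateDist] using (hest n hn).1.l1)
    (by
      have := (hest n hn).2.l1
      simpa only [rateDist, ← hlaw _ hxmem, ← hρ] using this)
  have hnext : ∀ z, F.law (T - g.pt (n + 1)) z = ∑ y, F.law (T - s) y * v y h z := fun z => by
    rw [← hlaw h hhmem, hsh]
  simp only [hnext, trapLaw_succ_real_singleton]
  have hK0 : ∀ y z, 0 ≤ stepKernel θ h (μ' s) (μ' (g.sectionPt θ n)) y z := fun y z => by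
    rw [hh, hs, stepKernel_eq_bind]; exact measureReal_nonneg
  have hK1 : ∀ y, ∑ z, stepKernel θ h (μ' s) (μ' (g.sectionPt θ n)) y z = 1 := fun y => by
    simp only [hh, hs, stepKernel_eq_bind, sum_measureReal_singleton]
    simp
  refine ⟨fun z hz => ?_, ?_⟩
  · rw [Finset.sum_eq_zero_iff_of_nonneg fun y _ => mul_nonneg measureReal_nonneg (hK0 y z)] at hz
    refine Finset.sum_eq_zero fun y hy => ?_
    rcases (hq.1 y).eq_or_lt with h0 | h0
    · rw [← h0, zero_mul]
    · rw [hdom y h0 z ((mul_eq_zero.1 (hz y hy)).resolve_left fun h1 => h0.ne' (hac y h1)),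
        mul_zero]
  · exact (klTerm_transition_le (F.law (T - s)) (fun y => (trapLaw μ' g θ q₀ n).real {y})
      (fun y => v y h) (stepKernel θ h (μ' s) (μ' (g.sectionPt θ n))) hq.1
      (fun _ => measureReal_nonneg) hac (fun y => (hv y).nonneg h hhmem) hK0 hdom
      (fun y => (hv y).sum_eq_one h hhmem) hK1).trans (add_le_add le_rfl hle)

end DiscreteDiffusion

theorem mainTheorem1 (d S : ℕ) [NeZero S] (θ : ℝ) (hθ : θ ∈ Set.Ioo (0 : ℝ) 1)
    (m M C₀ : ℝ) (hm : 0 < m) :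
    ∃ C κ₀ : ℝ, 0 < C ∧ 0 < κ₀ ∧
      ∀ (T δ : ℝ), 0 ≤ δ → δ < T →
      ∀ (F : DiscreteDiffusion.ForwardProcess d S T)
        (pInf : DiscreteDiffusion.Torus d S → ℝ)
        (score' : ℝ → DiscreteDiffusion.Torus d S → DiscreteDiffusion.Torus d S → ℝ)
        (g : DiscreteDiffusion.TimeGrid (T - δ)) (εI εII : ℝ),
      pInf ∈ stdSimplex ℝ (DiscreteDiffusion.Torus d S) →
      (∀ t ∈ Set.Icc δ T, ∀ x y, 0 ≤ score' t x y) →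
      InformationTheory.klDiv (DiscreteDiffusion.vecLaw (F.law T)) (DiscreteDiffusion.vecLaw pInf)
        ≤ ENNReal.ofReal (C₀ * Real.exp (-T)) →
      DiscreteDiffusion.RegularIntensities F (F.intensityOf score') δ m M →
      DiscreteDiffusion.EstimationError F (F.intensityOf score') g θ εI εII →
      DiscreteDiffusion.ExtrapolationNonneg (F.intensityOf score') g θ
        (DiscreteDiffusion.vecLaw pInf) →
      g.maxStep ≤ κ₀ →
      InformationTheory.klDiv (DiscreteDiffusion.vecLaw (F.law δ))
        (DiscreteDiffusion.trapLaw (F.intensityOf score') g θ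
          (DiscreteDiffusion.vecLaw pInf) g.N)
        ≤ ENNReal.ofReal (C * (Real.exp (-T) + (εI + εII) * T + g.maxStep ^ 2 * T)) := by
  obtain ⟨C, κ₀, hC, hκ₀, hsucc⟩ :=
    DiscreteDiffusion.exists_sum_klTerm_succ_le d S hθ M hm
  refine ⟨max C₀ 0 + C + 1, κ₀, by positivity, hκ₀, ?_⟩
  intro T δ hδ hδT F pInf score' g εI εII hpInf hscore hkl hreg hest hext hκ
  have hτ : 0 < T - δ := sub_pos.2 hδT
  have hT : 0 < T := hδ.trans_lt hδT
  have hN := g.N_pos hτ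
  have := DiscreteDiffusion.isProbabilityMeasure_vecLaw hpInf
  set μ' := F.intensityOf score' with hμ'def
  set Q := DiscreteDiffusion.trapLaw μ' g θ (DiscreteDiffusion.vecLaw pInf) with hQ
  have hμ' : ∀ s ∈ Set.Icc 0 (T - δ), ∀ ν ≠ 0, ∀ y, 0 ≤ μ' s ν y := fun s hs ν hν y =>
    mul_nonneg (hscore _ ⟨by linarith [hs.2], by linarith [hs.1]⟩ _ _)
      (F.rate_nonneg _ ⟨by linarith [hs.2], by linarith [hs.1]⟩ _ _ (by simpa using hν))
  have h0mem : (0 : ℝ) ∈ Set.Icc 0 (T - δ) := ⟨le_rfl, hτ.le⟩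
  -- there is at least one grid point, and the errors there are nonnegative
  have hεI : 0 ≤ εI := by
    have h1 := (hest 0 hN).1.entropy
    rw [g.pt_zero] at h1
    exact (hreg.entropy_nonneg hδ hm hμ' h0mem).trans h1
  have hεII : 0 ≤ εII := by
    have h1 := (hest 0 hN).1.l1
    rw [g.pt_zero, sub_zero] at h1
    exact le_trans (Finset.sum_nonneg fun y _ =>
      mul_nonneg (F.law_nonneg ⟨hT.le, le_rfl⟩ y) (Finset.sum_nonneg fun _ _ => abs_nonneg _)) h1
  have hmain : ∀ n ≤ g.N, (∀ z, (Q n).real {z} = 0 → F.law (T - g.pt n) z = 0) ∧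
      ∑ z, DiscreteDiffusion.klTerm (F.law (T - g.pt n) z) ((Q n).real {z}) ≤
        max C₀ 0 * Real.exp (-T) +
          ∑ i ∈ Finset.range n, C * (g.step i ^ 3 + g.step i * εII) := by
    intro n
    induction n with
    | zero =>
      intro _
      rw [g.pt_zero, sub_zero]
      have hv : ∀ z, (DiscreteDiffusion.vecLaw (F.law T)).real {z} = F.law T z :=
        DiscreteDiffusion.vecLaw_real_singleton (F.law_nonneg ⟨hT.le, le_rfl⟩)
      have hac : ∀ z, (Q 0).real {z} = 0 →
          (DiscreteDiffusion.vecLaw (F.law T)).real {z} = 0 :=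
        DiscreteDiffusion.real_singleton_eq_zero_of_klDiv_ne_top
          (ne_top_of_le_ne_top ENNReal.ofReal_ne_top hkl)
      have h1 : InformationTheory.klDiv (DiscreteDiffusion.vecLaw (F.law T)) (Q 0) ≤ _ := hkl
      rw [DiscreteDiffusion.klDiv_eq_sum_klTerm _ _ hac] at h1
      have h2 : C₀ * Real.exp (-T) ≤ max C₀ 0 * Real.exp (-T) :=
        mul_le_mul_of_nonneg_right (le_max_left _ _) (Real.exp_pos _).le
      have h3 := (ENNReal.ofReal_le_ofReal_iff
        (mul_nonneg (le_max_right C₀ 0) (Real.exp_pos (-T)).le)).1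
        (h1.trans (ENNReal.ofReal_le_ofReal h2))
      simp only [hv] at hac h3
      exact ⟨hac, by simpa using h3⟩
    | succ n ih =>
      intro hn
      obtain ⟨h1, h2⟩ := ih (Nat.le_of_succ_le hn)
      obtain ⟨h3, h4⟩ := hsucc hδ hμ' hreg hest hext hεII n hn
        ((g.step_le_maxStep hn).trans hκ) h1
      refine ⟨h3, h4.trans ?_⟩
      rw [Finset.sum_range_succ, ← add_assoc]
      exact add_le_add h2 le_rfl
  obtain ⟨hac, hle⟩ := hmain g.N le_rfl
  rw [g.pt_last, sub_sub_cancel] at hac hle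
  have hv : ∀ z, (DiscreteDiffusion.vecLaw (F.law δ)).real {z} = F.law δ z :=
    DiscreteDiffusion.vecLaw_real_singleton (F.law_nonneg ⟨hδ, hδT.le⟩)
  rw [DiscreteDiffusion.klDiv_eq_sum_klTerm _ _ (by simpa only [hv] using hac)]
  simp only [hv]
  refine ENNReal.ofReal_le_ofReal (hle.trans ?_)
  have hκ0 : 0 ≤ g.maxStep := (g.step_pos hN).le.trans (g.step_le_maxStep hN)
  have hsum : ∑ i ∈ Finset.range g.N, C * (g.step i ^ 3 + g.step i * εII) ≤
      C * ((g.maxStep ^ 2 + εII) * T) := by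
    calc ∑ i ∈ Finset.range g.N, C * (g.step i ^ 3 + g.step i * εII)
        ≤ ∑ i ∈ Finset.range g.N, C * ((g.maxStep ^ 2 + εII) * g.step i) := by
          refine Finset.sum_le_sum fun i hi => mul_le_mul_of_nonneg_left ?_ hC
          have hi' := Finset.mem_range.1 hi
          have h1 := mul_le_mul_of_nonneg_right (pow_le_pow_left₀ (g.step_pos hi').le
            (g.step_le_maxStep hi') 2) (g.step_pos hi').le
          linarith
      _ = C * ((g.maxStep ^ 2 + εII) * (T - δ)) := by
          rw [← Finset.mul_sum, ← Finset.mul_sum, g.sum_step, g.pt_last]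
      _ ≤ _ := by gcongr; linarith
  have hX : 0 ≤ Real.exp (-T) := (Real.exp_pos _).le
  have hY : 0 ≤ εI * T := mul_nonneg hεI hT.le
  have hZ : 0 ≤ εII * T := mul_nonneg hεII hT.le
  have hW : 0 ≤ g.maxStep ^ 2 * T := by positivity
  have hC0 : 0 ≤ max C₀ 0 := le_max_right _ _
  have e : (max C₀ 0 + C + 1) * (Real.exp (-T) + (εI + εII) * T + g.maxStep ^ 2 * T) =
      max C₀ 0 * Real.exp (-T) + C * ((g.maxStep ^ 2 + εII) * T) +
      ((C + 1) * Real.exp (-T) + (max C₀ 0 + 1) * (εII * T + g.maxStep ^ 2 * T)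
        + (max C₀ 0 + C + 1) * (εI * T)) := by ring
  rw [e]
  have : 0 ≤ (C + 1) * Real.exp (-T) + (max C₀ 0 + 1) * (εII * T + g.maxStep ^ 2 * T)
        + (max C₀ 0 + C + 1) * (εI * T) := by positivity
  linarith
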